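/- A rectilinear angle sequence of length $n$ is a sequence $S=(s_1,\dots,s_n)$ of left ($+90^\circ$) and right ($-90^\circ$) turns. A polygon here is a simple rectilinear polygon whose vertices are points of the integer grid; its area is the number of grid cells in its interior. A polygon realizes $S$ if some counterclockwise walk along its boundary makes exactly the turns $s_1,\dots,s_n$, in this order, at the vertices it encounters. A polygon is $x$-monotone if its boundary consists of two $x$-monotone chains, and an angle sequence is $x$-monotone if some $x$-monotone polygon realizes it. Theorem. There is an algorithm that, given an $x$-monotone angle sequence $S$ of length $n$, finds in $O(n^4)$ time a polygon that realizes $S$ and has minimum area among all polygons realizing $S$. (Time is counted on a word RAM with words of $O(\log n)$ bits: additions, subtractions, multiplications and comparisons of integers of absolute value polynomially bounded in $n$, and memory accesses, take one unit of time each. The output is the list of the vertices in counterclockwise order.) -/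

import Mathlib

namespace RectPoly

/-! ### Angle sequences and rectilinear polygons on the integer grid -/

/-- A left turn (by +90 degrees) or a right turn (by -90 degrees). -/
inductive Turn : Type
  | left : Turn
  | right : Turn

/-- `1` for a left turn, `-1` for a right turn. -/
def Turn.sign : Turn → ℤ
  | .left => 1
  | .right => -1

/-- The cross product of the vectors `q - p` and `r - q`: for two consecutive axis-parallel edges
`pq` and `qr` it is positive iff the walk `p, q, r` turns left at `q`, negative iff it turns right
at `q`, and zero iff one of the edges is degenerate or there is no turn by 90 degrees. -/
def cross (p q r : ℤ × ℤ) : ℤ :=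
  (q.1 - p.1) * (r.2 - q.2) - (q.2 - p.2) * (r.1 - q.1)

/-- The grid points on the axis-parallel edge from `v i` to `v (i + 1)` (the axis-parallel box
spanned by the two endpoints, which is degenerate for an axis-parallel edge).  Two axis-parallel
segments with integral endpoints intersect iff they have a grid point in common. -/
def edge (v : ℕ → ℤ × ℤ) (i : ℕ) : Set (ℤ × ℤ) :=
  Set.uIcc (v i) (v (i + 1))

/-- Twice the signed area enclosed by the closed walk `v 0, v 1, …, v n = v 0`. -/
def signedArea₂ (n : ℕ) (v : ℕ → ℤ × ℤ) : ℤ :=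
  ∑ i ∈ Finset.range n, ((v i).1 * (v (i + 1)).2 - (v (i + 1)).1 * (v i).2)

/-- The closed walk `v 0, v 1, …, v n = v 0` (continued periodically) is a counterclockwise walk
along the boundary of a simple rectilinear polygon on the integer grid whose vertices are
`v 0, …, v (n - 1)`. -/
structure IsPolygon (n : ℕ) (v : ℕ → ℤ × ℤ) : Prop where
  periodic : ∀ i, v (i + n) = v i
  /-- The edges are axis-parallel. -/
  axisParallel : ∀ i, (v i).1 = (v (i + 1)).1 ∨ (v i).2 = (v (i + 1)).2
  /-- The edges are non-degenerate and consecutive edges are perpendicular; in particular they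
  have only their common vertex in common. -/
  perpendicular : ∀ i, cross (v i) (v (i + 1)) (v (i + 2)) ≠ 0
  /-- Edges that are not consecutive are disjoint. -/
  simple : ∀ i < n, ∀ j < n, i ≠ j → (i + 1) % n ≠ j → (j + 1) % n ≠ i →
    Disjoint (edge v i) (edge v j)
  /-- The walk is counterclockwise. -/
  ccw : 0 < signedArea₂ n v

/-- The turns that the walk `v 0, v 1, …, v n = v 0` followed by the edge to `v 1` makes at
`v 1, v 2, …, v n` form the sequence `S`. -/
def Realizes {n : ℕ} (v : ℕ → ℤ × ℤ) (S : Fin n → Turn) : Prop :=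
  ∀ i : Fin n, (cross (v i) (v (i + 1)) (v (i + 2))).sign = (S i).sign

/-- The closed walk `v` of length `n` consists of two `x`-monotone chains: starting from a suitable
vertex, the `x`-coordinate is non-decreasing for the first `m` edges and non-increasing for the
other `n - m` edges. -/
def IsXMonotone (n : ℕ) (v : ℕ → ℤ × ℤ) : Prop :=
  ∃ a m : ℕ, m ≤ n ∧
    (∀ i, i < m → (v (a + i)).1 ≤ (v (a + i + 1)).1) ∧
    (∀ i, m ≤ i → i < n → (v (a + i + 1)).1 ≤ (v (a + i)).1)

/-- An angle sequence is `x`-monotone if some `x`-monotone polygon realizes it. -/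
def IsXMonotoneSeq {n : ℕ} (S : Fin n → Turn) : Prop :=
  ∃ v : ℕ → ℤ × ℤ, IsPolygon n v ∧ IsXMonotone n v ∧ Realizes v S

/-- The number of horizontal edges crossed by the vertical downward ray that starts in the centre
of the grid cell `[c.1, c.1 + 1] × [c.2, c.2 + 1]`. -/
def crossings (n : ℕ) (v : ℕ → ℤ × ℤ) (c : ℤ × ℤ) : ℕ :=
  ((Finset.range n).filter fun i =>
    (v i).2 = (v (i + 1)).2 ∧ (v i).2 ≤ c.2 ∧
      min (v i).1 (v (i + 1)).1 ≤ c.1 ∧ c.1 < max (v i).1 (v (i + 1)).1).card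

/-- The grid cells in the interior of the polygon (a point off the boundary is in the interior iff
a generic ray from it crosses the boundary an odd number of times); a cell is named by its lower
left corner. -/
def interiorCells (n : ℕ) (v : ℕ → ℤ × ℤ) : Set (ℤ × ℤ) :=
  {c | Odd (crossings n v c)}

/-- The area of a polygon on the integer grid: the number of grid cells in its interior. -/
noncomputable def area (n : ℕ) (v : ℕ → ℤ × ℤ) : ℕ :=
  (interiorCells n v).ncard

/-- `v` is (the boundary walk of) a polygon that realizes `S` and has minimum area among all
polygons that realize `S`. -/
def IsMinAreaRealization {n : ℕ} (S : Fin n → Turn) (v : ℕ → ℤ × ℤ) : Prop :=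
  IsPolygon n v ∧ Realizes v S ∧
    ∀ w : ℕ → ℤ × ℤ, IsPolygon n w → Realizes w S → area n v ≤ area n w

/-! ### A word RAM

Programs work on integer variables and on arrays with random access.  A program is a finite object,
so it uses constantly many variables and arrays.  Each arithmetic operation, comparison, memory
access and assignment costs one unit of time.  All numbers that a computation handles (and all
addresses) have to lie between `-B` and `B`, where `B` describes the word size: a computation in
which this is violated does not produce a result. -/

/-- A memory: the integer variables and the integer arrays, each of them numbered. -/
structure Mem : Type where
  var : ℕ → ℤ
  arr : ℕ → ℕ → ℤ

/-- Arithmetic expressions; `get a i` is the entry of array `a` at the address `i`. -/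
inductive Exp : Type
  | const (c : ℤ) : Exp
  | var (x : ℕ) : Exp
  | get (a : ℕ) (i : Exp) : Exp
  | add (e f : Exp) : Exp
  | sub (e f : Exp) : Exp
  | mul (e f : Exp) : Exp

/-- The value of an expression. -/
def Exp.eval (σ : Mem) : Exp → ℤ
  | .const c => c
  | .var x => σ.var x
  | .get a i => σ.arr a (i.eval σ).toNat
  | .add e f => e.eval σ + f.eval σ
  | .sub e f => e.eval σ - f.eval σ
  | .mul e f => e.eval σ * f.eval σ

/-- The evaluation of an expression handles only numbers of absolute value at most `B`, and array
addresses are nonnegative. -/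
def Exp.Safe (B : ℕ) (σ : Mem) : Exp → Prop
  | .const c => |c| ≤ B
  | .var x => |σ.var x| ≤ B
  | .get a i => i.Safe B σ ∧ 0 ≤ i.eval σ ∧ |σ.arr a (i.eval σ).toNat| ≤ B
  | .add e f => e.Safe B σ ∧ f.Safe B σ ∧ |e.eval σ + f.eval σ| ≤ B
  | .sub e f => e.Safe B σ ∧ f.Safe B σ ∧ |e.eval σ - f.eval σ| ≤ B
  | .mul e f => e.Safe B σ ∧ f.Safe B σ ∧ |e.eval σ * f.eval σ| ≤ B

/-- The time to evaluate an expression: its number of constants, variables and operations. -/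
def Exp.cost : Exp → ℕ
  | .const _ => 1
  | .var _ => 1
  | .get _ i => i.cost + 1
  | .add e f => e.cost + f.cost + 1
  | .sub e f => e.cost + f.cost + 1
  | .mul e f => e.cost + f.cost + 1

/-- Programs.  `assign x e` is `x := e`, `put a i e` is `a[i] := e`, `branch e p q` runs `p` if
`0 < e` and `q` otherwise, and `loop e p` repeats `p` as long as `0 < e`. -/
inductive Prog : Type
  | skip : Prog
  | assign (x : ℕ) (e : Exp) : Prog
  | put (a : ℕ) (i e : Exp) : Prog
  | seq (p q : Prog) : Prog
  | branch (e : Exp) (p q : Prog) : Prog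
  | loop (e : Exp) (p : Prog) : Prog

/-- The memory after `x := z`. -/
def Mem.setVar (σ : Mem) (x : ℕ) (z : ℤ) : Mem :=
  { σ with var := Function.update σ.var x z }

/-- The memory after `a[i] := z`. -/
def Mem.setArr (σ : Mem) (a i : ℕ) (z : ℤ) : Mem :=
  { σ with arr := Function.update σ.arr a (Function.update (σ.arr a) i z) }

/-- `Exec B p σ t τ`: with word size `B`, the program `p` started in memory `σ` halts after exactly
`t` units of time in memory `τ`, without overflow. -/
inductive Exec (B : ℕ) : Prog → Mem → ℕ → Mem → Prop
  | skip (σ : Mem) : Exec B .skip σ 1 σ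
  | assign (σ : Mem) (x : ℕ) (e : Exp) (he : e.Safe B σ) :
      Exec B (.assign x e) σ (e.cost + 1) (σ.setVar x (e.eval σ))
  | put (σ : Mem) (a : ℕ) (i e : Exp) (hi : i.Safe B σ) (hi0 : 0 ≤ i.eval σ) (he : e.Safe B σ) :
      Exec B (.put a i e) σ (i.cost + e.cost + 1) (σ.setArr a (i.eval σ).toNat (e.eval σ))
  | seq {p q : Prog} {σ τ ρ : Mem} {s t : ℕ} (hp : Exec B p σ s τ) (hq : Exec B q τ t ρ) :
      Exec B (.seq p q) σ (s + t) ρ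
  | branch_pos {e : Exp} {p q : Prog} {σ τ : Mem} {t : ℕ} (he : e.Safe B σ) (h : 0 < e.eval σ)
      (hp : Exec B p σ t τ) : Exec B (.branch e p q) σ (e.cost + 1 + t) τ
  | branch_neg {e : Exp} {p q : Prog} {σ τ : Mem} {t : ℕ} (he : e.Safe B σ) (h : ¬ 0 < e.eval σ)
      (hq : Exec B q σ t τ) : Exec B (.branch e p q) σ (e.cost + 1 + t) τ
  | loop_pos {e : Exp} {p : Prog} {σ τ ρ : Mem} {s t : ℕ} (he : e.Safe B σ) (h : 0 < e.eval σ)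
      (hp : Exec B p σ s τ) (hl : Exec B (.loop e p) τ t ρ) :
      Exec B (.loop e p) σ (e.cost + 1 + s + t) ρ
  | loop_neg {e : Exp} {p : Prog} {σ : Mem} (he : e.Safe B σ) (h : ¬ 0 < e.eval σ) :
      Exec B (.loop e p) σ (e.cost + 1) σ

/-- The input memory for an angle sequence `S` of length `n`: variable `0` holds `n`, and the first
`n` entries of array `0` hold the turns, `1` for left and `-1` for right.  Everything else is `0`. -/
def inputMem {n : ℕ} (S : Fin n → Turn) : Mem where
  var x := if x = 0 then (n : ℤ) else 0
  arr a i := if h : a = 0 ∧ i < n then (S ⟨i, h.2⟩).sign else 0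

/-- The output read off a memory: the vertices `v 0, …, v (n - 1)` of a closed walk, with the
`x`-coordinates in array `1` and the `y`-coordinates in array `2`, continued periodically. -/
def outputWalk (n : ℕ) (σ : Mem) : ℕ → ℤ × ℤ :=
  fun i => (σ.arr 1 (i % n), σ.arr 2 (i % n))

end RectPoly

/-! Geometry. The turns of a polygon fix the directions of its edges up to a rotation. So if one
`x`-monotone polygon realizes `S`, every polygon that realizes `S`, rotated so that a suitable edge
points down, runs right along a bottom chain of `k` horizontal edges and back left along a top chain
of `m` of them, with `n = 2 * (k + m)` (`IsPolygon.directed`, `IsPolygon.exists_layout`). Simplicity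
forces the bottom chain strictly below the top chain (`Traces.layout`). Conversely, every such
`Layout` with the prescribed vertical signs bounds a polygon with the right turns
(`Layout.isPolygon`, `Layout.turnSign_eq`), whose area is the sum of its column heights
(`Layout.area_eq`). It remains to minimize over layouts.

Combinatorics. Of successive columns bounded by the same two edges `i` and `j` only one need be
kept, so at most `k + m - 1` columns matter. Whether a column of height `h` can be followed by one
of height `h'` depends only on `h`, `h'` and the directions in which the two boundaries move: the
condition `Valid` is necessary by `valid_of_lt` and sufficient by `bottomStep_spec`, since absolute
positions can be chosen afterwards. Replacing each height by its minimum with twice its rank among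
the occurring heights preserves `Valid` and does not increase the area (`Valid.capHeight`), so
heights up to `n` suffice. This gives a dynamic program with `O(n ^ 3)` states `(i, j, h)` and
`O(n)` candidate predecessors for each state. The table stores `n ^ 2` minus the area: larger is
better, every feasible state is positive, and zero-initialized memory already means "unreachable".
`IsTable.le_of_path` and `Layout.exists_path` give the lower bound on areas; `Layout.extend`
realizes the optimum column by column from right to left.

The chains are read off the turns: the leftmost and rightmost vertical edges are those with left
turns at both ends, while the turns at the ends of every other vertical edge cancel.

Computation. `Runs` is a Hoare logic with time and overflow bounds. If memory stays bounded by `M`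
and expressions have degree at most `16`, words bounded by `M ^ 16` never overflow; here `M = 4 * n
^ 2`. If every loop is repeated at most `L = 2 * n` times, the time is a constant times `(L + 1) ^
d`, where `d = 4` is the nesting depth of loops (`Prog.time_le`). -/

namespace RectPoly

/-! ### A program logic for the word RAM -/

/-- All addresses that occur in the evaluation of an expression are nonnegative. -/
def Exp.Addr (σ : Mem) : Exp → Prop
  | .const _ => True
  | .var _ => True
  | .get _ i => i.Addr σ ∧ 0 ≤ i.eval σ
  | .add e f => e.Addr σ ∧ f.Addr σ
  | .sub e f => e.Addr σ ∧ f.Addr σ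
  | .mul e f => e.Addr σ ∧ f.Addr σ

/-- If all entries of the memory are bounded by `M ≥ 2`, all intermediate values in the evaluation
of `e` are bounded by `M ^ e.deg`. -/
def Exp.deg : Exp → ℕ
  | .const c => c.natAbs + 1
  | .var _ => 1
  | .get _ i => i.deg
  | .add e f => max e.deg f.deg + 1
  | .sub e f => max e.deg f.deg + 1
  | .mul e f => e.deg + f.deg

/-- All entries of the memory are bounded by `M`. -/
structure Mem.Bounded (M : ℕ) (σ : Mem) : Prop where
  var : ∀ x, |σ.var x| ≤ M
  arr : ∀ a i, |σ.arr a i| ≤ M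

theorem Exp.one_le_deg (e : Exp) : 1 ≤ e.deg := by
  induction e <;> simp only [Exp.deg] <;> omega

theorem Exp.abs_eval_le {M : ℕ} {σ : Mem} (hM : 2 ≤ M) (hσ : σ.Bounded M) (e : Exp) :
    |e.eval σ| ≤ (M : ℤ) ^ e.deg := by
  have hM1 : (1 : ℤ) ≤ M := by exact_mod_cast (by omega : 1 ≤ M)
  have hM2 : (2 : ℤ) ≤ M := by exact_mod_cast hM
  have key : ∀ d e : ℕ, ∀ x y : ℤ, |x| ≤ (M : ℤ) ^ d → |y| ≤ (M : ℤ) ^ e →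
      |x| + |y| ≤ (M : ℤ) ^ (max d e + 1) := by
    intro d e x y hx hy
    have h1 : (M : ℤ) ^ d ≤ (M : ℤ) ^ (max d e) := pow_le_pow_right₀ hM1 (le_max_left _ _)
    have h2 : (M : ℤ) ^ e ≤ (M : ℤ) ^ (max d e) := pow_le_pow_right₀ hM1 (le_max_right _ _)
    have h3 : (0 : ℤ) < (M : ℤ) ^ (max d e) := by positivity
    rw [pow_succ]
    nlinarith
  induction e with
  | const c =>
    simp only [Exp.eval, Exp.deg]
    -- The degree of a constant comes from `|c| < 2 ^ |c|` and `2 ≤ M`.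
    have h1 : c.natAbs < 2 ^ c.natAbs := Nat.lt_two_pow_self
    have h2 : 2 ^ c.natAbs ≤ M ^ c.natAbs := Nat.pow_le_pow_left hM _
    have h3 : M ^ c.natAbs ≤ M ^ (c.natAbs + 1) := Nat.pow_le_pow_right (by omega) (by omega)
    rw [← Int.natCast_natAbs]
    exact_mod_cast (h1.le.trans h2).trans h3
  | var x => simpa [Exp.eval, Exp.deg] using hσ.var x
  | get a i ih =>
    simp only [Exp.eval, Exp.deg]
    refine (hσ.arr _ _).trans ?_
    calc (M : ℤ) = (M : ℤ) ^ 1 := (pow_one _).symm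
      _ ≤ _ := pow_le_pow_right₀ hM1 i.one_le_deg
  | add e f he hf => exact (abs_add_le _ _).trans (key _ _ _ _ he hf)
  | sub e f he hf => exact (abs_sub _ _).trans (key _ _ _ _ he hf)
  | mul e f he hf =>
    simp only [Exp.eval, Exp.deg, abs_mul, pow_add]
    exact mul_le_mul he hf (abs_nonneg _) (by positivity)

/-- Overflow thus never has to be discussed for individual expressions: only nonnegative addresses
and a syntactic degree bound remain. -/
theorem Exp.safe_of_addr {B M K : ℕ} {σ : Mem} (hM : 2 ≤ M) (hB : M ^ K ≤ B) (hσ : σ.Bounded M)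
    (e : Exp) (ha : e.Addr σ) (hd : e.deg ≤ K) : e.Safe B σ := by
  have hM1 : (1 : ℤ) ≤ M := by exact_mod_cast (by omega : 1 ≤ M)
  have key : ∀ e : Exp, e.deg ≤ K → |e.eval σ| ≤ B := fun e he =>
    (e.abs_eval_le hM hσ).trans ((pow_le_pow_right₀ hM1 he).trans (by exact_mod_cast hB))
  induction e with
  | const c => exact key _ hd
  | var x => exact key _ hd
  | get a i ih => exact ⟨ih ha.1 hd, ha.2, key (.get a i) hd⟩
  | add e f he hf =>
    have := hd; simp only [Exp.deg] at this
    exact ⟨he ha.1 (by omega), hf ha.2 (by omega), key (.add e f) hd⟩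
  | sub e f he hf =>
    have := hd; simp only [Exp.deg] at this
    exact ⟨he ha.1 (by omega), hf ha.2 (by omega), key (.sub e f) hd⟩
  | mul e f he hf =>
    have := hd; simp only [Exp.deg] at this
    exact ⟨he ha.1 (by omega), hf ha.2 (by omega), key (.mul e f) hd⟩

/-- A bound for the running time of a program all of whose loops are repeated at most `L` times. -/
def Prog.time (L : ℕ) : Prog → ℕ
  | .skip => 1
  | .assign _ e => e.cost + 1
  | .put _ i e => i.cost + e.cost + 1
  | .seq p q => p.time L + q.time L
  | .branch e p q => e.cost + 1 + (p.time L + q.time L)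
  | .loop e p => L * (e.cost + 1 + p.time L) + (e.cost + 1)

/-- The nesting depth of loops. -/
def Prog.depth : Prog → ℕ
  | .skip => 0
  | .assign _ _ => 0
  | .put _ _ _ => 0
  | .seq p q => max p.depth q.depth
  | .branch _ p q => max p.depth q.depth
  | .loop _ p => p.depth + 1

/-- Each level of nesting multiplies the bound by at most `L + 1`, and `p.time 1` depends on the
program alone, so the nesting depth is the exponent of the running time. -/
theorem Prog.time_le (L : ℕ) (p : Prog) : p.time L ≤ p.time 1 * (L + 1) ^ p.depth := by
  have hL : ∀ a b : ℕ, a ≤ b → (L + 1) ^ a ≤ (L + 1) ^ b := fun a b h =>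
    Nat.pow_le_pow_right (by omega) h
  have hp : ∀ a : ℕ, 1 ≤ (L + 1) ^ a := fun a => Nat.one_le_pow _ _ (by omega)
  induction p with
  | skip => simp [Prog.time, Prog.depth]
  | assign => simp [Prog.time, Prog.depth]
  | put => simp [Prog.time, Prog.depth]
  | seq p q hp hq =>
    simp only [Prog.time, Prog.depth, add_mul]
    have h1 := Nat.mul_le_mul_left (p.time 1) (hL _ _ (le_max_left p.depth q.depth))
    have h2 := Nat.mul_le_mul_left (q.time 1) (hL _ _ (le_max_right p.depth q.depth))
    omega
  | branch e p q hp hq =>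
    simp only [Prog.time, Prog.depth, add_mul]
    have h1 := Nat.mul_le_mul_left (p.time 1) (hL _ _ (le_max_left p.depth q.depth))
    have h2 := Nat.mul_le_mul_left (q.time 1) (hL _ _ (le_max_right p.depth q.depth))
    have h3 := Nat.mul_le_mul_left e.cost (‹∀ a : ℕ, 1 ≤ (L + 1) ^ a› (max p.depth q.depth))
    have h4 := ‹∀ a : ℕ, 1 ≤ (L + 1) ^ a› (max p.depth q.depth)
    omega
  | loop e p ih =>
    simp only [Prog.time, Prog.depth, pow_succ]
    have h4 := hp p.depth
    have h5 : (L + 1) * (e.cost + 1) ≤ (L + 1) * (e.cost + 1) * (L + 1) ^ p.depth :=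
      Nat.le_mul_of_pos_right _ h4
    have h6 := Nat.mul_le_mul_left L ih
    nlinarith [Nat.zero_le (p.time 1 * (L + 1) ^ p.depth),
      Nat.zero_le ((e.cost + 1) * ((L + 1) ^ p.depth * (L + 1)))]

/-- Whether a program contains an assignment to the variable `x`. -/
def Prog.assigns (x : ℕ) : Prog → Bool
  | .skip => false
  | .assign y _ => x == y
  | .put _ _ _ => false
  | .seq p q => p.assigns x || q.assigns x
  | .branch _ p q => p.assigns x || q.assigns x
  | .loop _ p => p.assigns x

/-- Whether a program contains an assignment to entries of the array `a`. -/
def Prog.puts (a : ℕ) : Prog → Bool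
  | .skip => false
  | .assign _ _ => false
  | .put b _ _ => a == b
  | .seq p q => p.puts a || q.puts a
  | .branch _ p q => p.puts a || q.puts a
  | .loop _ p => p.puts a

/-- The two memories agree in everything that the program `p` does not write. -/
structure Frame (p : Prog) (σ τ : Mem) : Prop where
  var : ∀ x, p.assigns x = false → τ.var x = σ.var x
  arr : ∀ a, p.puts a = false → τ.arr a = σ.arr a

theorem Frame.refl (p : Prog) (σ : Mem) : Frame p σ σ := ⟨fun _ _ => rfl, fun _ _ => rfl⟩

theorem Frame.trans {p : Prog} {σ τ ρ : Mem} (h : Frame p σ τ) (h' : Frame p τ ρ) :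
    Frame p σ ρ :=
  ⟨fun x hx => (h'.var x hx).trans (h.var x hx), fun x hx => (h'.arr x hx).trans (h.arr x hx)⟩

@[simp] theorem Mem.setVar_var (σ : Mem) (x y : ℕ) (z : ℤ) :
    (σ.setVar x z).var y = if y = x then z else σ.var y := by
  simp [Mem.setVar, Function.update_apply]

@[simp] theorem Mem.setVar_arr (σ : Mem) (x : ℕ) (z : ℤ) : (σ.setVar x z).arr = σ.arr := rfl

@[simp] theorem Mem.setArr_var (σ : Mem) (a i : ℕ) (z : ℤ) : (σ.setArr a i z).var = σ.var := rfl

theorem Mem.setArr_arr (σ : Mem) (a i b : ℕ) (z : ℤ) :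
    (σ.setArr a i z).arr b = if b = a then Function.update (σ.arr a) i z else σ.arr b := by
  simp only [Mem.setArr, Function.update_apply]

/-- Invariants need not mention variables and arrays that a program leaves alone; for concrete
programs the side conditions hold by `rfl`. -/
theorem Exec.frame {B t : ℕ} {p : Prog} {σ τ : Mem} (h : Exec B p σ t τ) : Frame p σ τ := by
  induction h with
  | skip σ => exact Frame.refl _ _
  | assign σ x e he =>
    refine ⟨fun y hy => ?_, fun _ _ => rfl⟩
    simp only [Prog.assigns, beq_eq_false_iff_ne] at hy
    simp [hy]
  | put σ a i e =>
    refine ⟨fun _ _ => rfl, fun b hb => ?_⟩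
    simp only [Prog.puts, beq_eq_false_iff_ne] at hb
    simp [Mem.setArr_arr, hb]
  | seq _ _ hp hq =>
    refine ⟨fun x hx => ?_, fun x hx => ?_⟩
    · simp only [Prog.assigns, Bool.or_eq_false_iff] at hx
      rw [hq.var x hx.2, hp.var x hx.1]
    · simp only [Prog.puts, Bool.or_eq_false_iff] at hx
      rw [hq.arr x hx.2, hp.arr x hx.1]
  | branch_pos _ _ _ hp =>
    refine ⟨fun x hx => ?_, fun x hx => ?_⟩
    · simp only [Prog.assigns, Bool.or_eq_false_iff] at hx
      exact hp.var x hx.1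
    · simp only [Prog.puts, Bool.or_eq_false_iff] at hx
      exact hp.arr x hx.1
  | branch_neg _ _ _ hp =>
    refine ⟨fun x hx => ?_, fun x hx => ?_⟩
    · simp only [Prog.assigns, Bool.or_eq_false_iff] at hx
      exact hp.var x hx.2
    · simp only [Prog.puts, Bool.or_eq_false_iff] at hx
      exact hp.arr x hx.2
  | loop_pos _ _ _ _ hp hq => exact Frame.trans ⟨hp.var, hp.arr⟩ hq
  | loop_neg => exact Frame.refl _ _

/-- Started in a memory `σ` with entries bounded by `M`, the program `p` halts with word size `B`
in a memory bounded by `M` that satisfies `Q`, within the time for at most `L` repetitions of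
every loop. -/
def Runs (B M L : ℕ) (p : Prog) (σ : Mem) (Q : Mem → Prop) : Prop :=
  2 ≤ M → M ^ 16 ≤ B → σ.Bounded M →
    ∃ t τ, Exec B p σ t τ ∧ t ≤ p.time L ∧ τ.Bounded M ∧ Q τ

section Rules

variable {B M L : ℕ} {p q : Prog} {σ : Mem} {Q R : Mem → Prop} {e i : Exp} {x a : ℕ}

theorem Runs.mono (h : Runs B M L p σ Q) (hQ : ∀ τ, Frame p σ τ → Q τ → R τ) :
    Runs B M L p σ R := by
  intro h1 h2 h3
  obtain ⟨t, τ, h4, h5, h6, h7⟩ := h h1 h2 h3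
  exact ⟨t, τ, h4, h5, h6, hQ τ h4.frame h7⟩

theorem Runs.skip (h : Q σ) : Runs B M L .skip σ Q :=
  fun _ _ hσ => ⟨1, σ, .skip σ, le_rfl, hσ, h⟩

theorem Runs.assign (v : ℤ) (hv : e.eval σ = v) (ha : e.Addr σ) (hd : e.deg ≤ 16) (hM : |v| ≤ M)
    (h : Q (σ.setVar x v)) : Runs B M L (.assign x e) σ Q := by
  subst hv
  refine fun h1 h2 hσ => ⟨_, _, .assign σ x e (e.safe_of_addr h1 h2 hσ ha hd), le_rfl, ⟨?_, hσ.arr⟩,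
    h⟩
  intro y
  rw [Mem.setVar_var]
  split_ifs
  · exact hM
  · exact hσ.var y

theorem Runs.put (j : ℕ) (v : ℤ) (hj : i.eval σ = j) (hv : e.eval σ = v) (hi : i.Addr σ)
    (hdi : i.deg ≤ 16) (ha : e.Addr σ) (hd : e.deg ≤ 16) (hM : |v| ≤ M)
    (h : Q (σ.setArr a j v)) : Runs B M L (.put a i e) σ Q := by
  subst hv
  have hj' : (i.eval σ).toNat = j := by omega
  refine fun h1 h2 hσ => ⟨_, _, .put σ a i e (i.safe_of_addr h1 h2 hσ hi hdi) (by omega)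
    (e.safe_of_addr h1 h2 hσ ha hd), le_rfl, ⟨hσ.var, ?_⟩, by rwa [hj']⟩
  intro b y
  rw [Mem.setArr_arr]
  split_ifs with hb
  · rw [Function.update_apply]
    split_ifs
    · exact hM
    · exact hσ.arr _ _
  · exact hσ.arr _ _

theorem Runs.seq (h : Runs B M L p σ (fun τ => Runs B M L q τ Q)) :
    Runs B M L (.seq p q) σ Q := by
  intro h1 h2 hσ
  obtain ⟨t, τ, h4, h5, h6, h7⟩ := h h1 h2 hσ
  obtain ⟨s, ρ, h8, h9, h10, h11⟩ := h7 h1 h2 h6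
  exact ⟨t + s, ρ, .seq h4 h8, Nat.add_le_add h5 h9, h10, h11⟩

theorem Runs.branch (ha : e.Addr σ) (hd : e.deg ≤ 16) (hp : 0 < e.eval σ → Runs B M L p σ Q)
    (hq : e.eval σ ≤ 0 → Runs B M L q σ Q) : Runs B M L (.branch e p q) σ Q := by
  intro h1 h2 hσ
  by_cases h : 0 < e.eval σ
  · obtain ⟨t, τ, h4, h5, h6, h7⟩ := hp h h1 h2 hσ
    refine ⟨_, τ, .branch_pos (e.safe_of_addr h1 h2 hσ ha hd) h h4, ?_, h6, h7⟩
    simp only [Prog.time]; omega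
  · obtain ⟨t, τ, h4, h5, h6, h7⟩ := hq (not_lt.1 h) h1 h2 hσ
    refine ⟨_, τ, .branch_neg (e.safe_of_addr h1 h2 hσ ha hd) h h4, ?_, h6, h7⟩
    simp only [Prog.time]; omega

/-- The rule for loops; `I z` is the invariant with at most `z` repetitions to go. -/
theorem Runs.loop (I : ℕ → Mem → Prop) (z : ℕ) (hz : z ≤ L) (hd : e.deg ≤ 16)
    (h : ∀ z τ, Frame p σ τ → I z τ → e.Addr τ ∧ (0 < e.eval τ → 0 < z ∧
      Runs B M L p τ (I (z - 1)))) (hI : I z σ) :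
    Runs B M L (.loop e p) σ (fun τ => (∃ z, I z τ) ∧ e.eval τ ≤ 0) := by
  intro h1 h2 hσ
  suffices H : ∀ z τ, Frame p σ τ → τ.Bounded M → I z τ → ∃ t ρ, Exec B (.loop e p) τ t ρ ∧
      t ≤ z * (e.cost + 1 + p.time L) + (e.cost + 1) ∧ ρ.Bounded M ∧
        (∃ z, I z ρ) ∧ e.eval ρ ≤ 0 by
    obtain ⟨t, ρ, h4, h5, h6, h7⟩ := H z σ (Frame.refl _ _) hσ hI
    exact ⟨t, ρ, h4, h5.trans (Nat.add_le_add_right (Nat.mul_le_mul_right _ hz) _), h6, h7⟩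
  intro z
  induction z with
  | zero =>
    intro τ hf hb hI
    obtain ⟨ha, h3⟩ := h 0 τ hf hI
    by_cases h0 : 0 < e.eval τ
    · exact absurd (h3 h0).1 (by omega)
    · exact ⟨_, τ, .loop_neg (e.safe_of_addr h1 h2 hb ha hd) h0, by omega, hb, ⟨_, hI⟩, by omega⟩
  | succ z ih =>
    intro τ hf hb hI
    obtain ⟨ha, h3⟩ := h _ τ hf hI
    by_cases h0 : 0 < e.eval τ
    · obtain ⟨-, h3⟩ := h3 h0
      obtain ⟨s, ρ, h4, h5, h6, h7⟩ := h3 h1 h2 hb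
      obtain ⟨t, π, h8, h9, h10, h11⟩ := ih ρ (hf.trans h4.frame) h6 h7
      refine ⟨_, π, .loop_pos (e.safe_of_addr h1 h2 hb ha hd) h0 h4 h8, ?_, h10, h11⟩
      rw [Nat.succ_mul]; omega
    · exact ⟨_, τ, .loop_neg (e.safe_of_addr h1 h2 hb ha hd) h0,
        Nat.le_add_left _ _, hb, ⟨_, hI⟩, by omega⟩

/-- `while (0 < e) { p; x := x + 1 }` -/
def Prog.upTo (x : ℕ) (e : Exp) (p : Prog) : Prog :=
  .loop e (.seq p (.assign x (.add (.var x) (.const 1))))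

/-- The rule for counting loops. -/
theorem Runs.upTo (I : ℕ → Mem → Prop) (lo hi : ℕ) (hlo : lo ≤ hi) (hL : hi - lo ≤ L)
    (hM : hi ≤ M) (hd : e.deg ≤ 16) (hx : p.assigns x = false) (h0 : σ.var x = lo)
    (he : ∀ z τ, Frame (.seq p (.assign x (.add (.var x) (.const 1)))) σ τ → z ≤ hi → τ.var x = z →
      e.Addr τ ∧ (0 < e.eval τ ↔ z < hi))
    (h : ∀ z τ, Frame (.seq p (.assign x (.add (.var x) (.const 1)))) σ τ → lo ≤ z → z < hi →
      τ.var x = z → I z τ →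
      Runs B M L p τ (fun ρ => I (z + 1) (ρ.setVar x ((z + 1 : ℕ) : ℤ)))) (hI : I lo σ) :
    Runs B M L (.upTo x e p) σ (fun τ => τ.var x = hi ∧ I hi τ) := by
  unfold Prog.upTo
  refine (Runs.loop (fun d τ => ∃ z : ℕ, lo ≤ z ∧ z ≤ hi ∧ d = hi - z ∧ τ.var x = z ∧ I z τ)
    (hi - lo) hL hd ?_ ⟨lo, le_rfl, hlo, rfl, h0, hI⟩).mono ?_
  · rintro d τ hf ⟨z, hz1, hz2, rfl, hz4, hz5⟩
    obtain ⟨ha, hb⟩ := he z τ hf hz2 hz4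
    refine ⟨ha, fun hc => ?_⟩
    have hz := hb.1 hc
    refine ⟨by omega, Runs.seq ((h z τ hf hz1 hz hz4 hz5).mono fun ρ hρ hI => ?_)⟩
    have hρx : ρ.var x = z := (hρ.var x hx).trans hz4
    refine Runs.assign ((z + 1 : ℕ) : ℤ) (by simp [Exp.eval, hρx]) (by simp [Exp.Addr])
      (by simp [Exp.deg]) ?_ ⟨z + 1, by omega, hz, by omega, by simp, hI⟩
    rw [abs_of_nonneg (by positivity)]
    exact_mod_cast (by omega : z + 1 ≤ M)
  · rintro τ hf ⟨⟨d, z, hz1, hz2, -, hz4, hz5⟩, he'⟩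
    have hf' : Frame (.seq p (.assign x (.add (.var x) (.const 1)))) σ τ :=
      ⟨hf.var, hf.arr⟩
    have := (he z τ hf' hz2 hz4).2
    obtain rfl : z = hi := by
      by_contra hne
      exact absurd (this.2 (by omega)) (by omega)
    exact ⟨hz4, hz5⟩

end Rules

/-! ### Invariance of polygons under cyclic shifts and rotations -/

/-- Advancing a window of length `n` by one exchanges `f s` for the equal term `f (s + n)`. -/
theorem sum_range_shift {A : Type*} [AddCommGroup A] {n : ℕ} {f : ℕ → A}
    (hf : ∀ i, f (i + n) = f i) (s : ℕ) :
    ∑ i ∈ Finset.range n, f (i + s) = ∑ i ∈ Finset.range n, f i := by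
  induction s with
  | zero => rfl
  | succ s ih =>
    have h1 := Finset.sum_range_succ (fun i => f (i + s)) n
    have h2 := Finset.sum_range_succ' (fun i => f (i + s)) n
    rw [h1] at h2
    have h3 : f (n + s) = f (0 + s) := by rw [add_comm n s, hf, zero_add]
    rw [h3] at h2
    rw [← ih, add_right_cancel h2]
    exact Finset.sum_congr rfl fun i _ => by rw [show i + (s + 1) = i + 1 + s by ring]

theorem periodic_mod {A : Type*} {n : ℕ} {f : ℕ → A} (hf : ∀ i, f (i + n) = f i) (i : ℕ) :
    f (i % n) = f i := by
  have h : ∀ j, f (i % n + n * j) = f (i % n) := by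
    intro j
    induction j with
    | zero => rfl
    | succ j ih => rw [Nat.mul_succ, ← add_assoc, hf, ih]
  rw [← h (i / n), Nat.mod_add_div]

/-! ### Cyclic shifts of polygons. -/

/-- The walk `v`, started at `v s`. -/
def shiftWalk (s : ℕ) (v : ℕ → ℤ × ℤ) : ℕ → ℤ × ℤ := fun i => v (i + s)

section Shift

variable {n : ℕ} {v : ℕ → ℤ × ℤ}

theorem shiftWalk_periodic (hv : ∀ i, v (i + n) = v i) (s i : ℕ) :
    shiftWalk s v (i + n) = shiftWalk s v i := by
  simp only [shiftWalk]
  rw [add_right_comm, hv]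

theorem edge_shiftWalk (s i : ℕ) : edge (shiftWalk s v) i = edge v (i + s) := by
  simp only [edge, shiftWalk, add_right_comm]

theorem edge_periodic (hv : ∀ i, v (i + n) = v i) (i : ℕ) : edge v (i + n) = edge v i := by
  simp only [edge, hv, add_right_comm i n 1]

theorem signedArea₂_shiftWalk (hv : ∀ i, v (i + n) = v i) (s : ℕ) :
    signedArea₂ n (shiftWalk s v) = signedArea₂ n v := by
  have := sum_range_shift (n := n)
    (f := fun i => ((v i).1 * (v (i + 1)).2 - (v (i + 1)).1 * (v i).2))
    (fun i => by simp only [hv, add_right_comm i n 1]) s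
  rw [signedArea₂, signedArea₂, ← this]
  simp only [shiftWalk, add_right_comm]

theorem crossings_eq_sum (n : ℕ) (v : ℕ → ℤ × ℤ) (c : ℤ × ℤ) :
    (crossings n v c : ℤ) = ∑ i ∈ Finset.range n, if (v i).2 = (v (i + 1)).2 ∧ (v i).2 ≤ c.2 ∧
      min (v i).1 (v (i + 1)).1 ≤ c.1 ∧ c.1 < max (v i).1 (v (i + 1)).1 then (1 : ℤ) else 0 := by
  rw [crossings, Finset.card_filter]
  push_cast
  rfl

theorem crossings_shiftWalk (hv : ∀ i, v (i + n) = v i) (s : ℕ) (c : ℤ × ℤ) :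
    crossings n (shiftWalk s v) c = crossings n v c := by
  have := sum_range_shift (n := n)
    (f := fun i => if (v i).2 = (v (i + 1)).2 ∧ (v i).2 ≤ c.2 ∧
      min (v i).1 (v (i + 1)).1 ≤ c.1 ∧ c.1 < max (v i).1 (v (i + 1)).1 then (1 : ℤ) else 0)
    (fun i => by simp only [hv, add_right_comm i n 1]) s
  zify
  rw [crossings_eq_sum, crossings_eq_sum, ← this]
  simp only [shiftWalk, add_right_comm]

theorem area_shiftWalk (hv : ∀ i, v (i + n) = v i) (s : ℕ) :
    area n (shiftWalk s v) = area n v := by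
  simp only [area, interiorCells, crossings_shiftWalk hv]

theorem cross_shiftWalk (s i : ℕ) :
    cross (shiftWalk s v i) (shiftWalk s v (i + 1)) (shiftWalk s v (i + 2)) =
      cross (v (i + s)) (v (i + s + 1)) (v (i + s + 2)) := by
  simp only [shiftWalk]
  rw [show i + 1 + s = i + s + 1 by ring, show i + 2 + s = i + s + 2 by ring]

theorem IsPolygon.shiftWalk (h : IsPolygon n v) (s : ℕ) : IsPolygon n (shiftWalk s v) where
  periodic := shiftWalk_periodic h.periodic s
  axisParallel i := by
    have := h.axisParallel (i + s)
    simpa only [RectPoly.shiftWalk, add_right_comm] using this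
  perpendicular i := by
    rw [cross_shiftWalk]
    exact h.perpendicular _
  simple i hi j hj hij h1 h2 := by
    have hn : 0 < n := by omega
    rw [edge_shiftWalk, edge_shiftWalk, ← periodic_mod (edge_periodic h.periodic) (i + s),
      ← periodic_mod (edge_periodic h.periodic) (j + s)]
    refine h.simple _ (Nat.mod_lt _ hn) _ (Nat.mod_lt _ hn) ?_ ?_ ?_
    · intro he
      have h3 : i ≡ j [MOD n] := Nat.ModEq.add_right_cancel' s he
      exact hij (by rwa [Nat.ModEq, Nat.mod_eq_of_lt hi, Nat.mod_eq_of_lt hj] at h3)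
    · intro he
      rw [Nat.mod_add_mod, add_right_comm] at he
      have h3 : i + 1 ≡ j [MOD n] := Nat.ModEq.add_right_cancel' s he
      exact h1 (by rwa [Nat.ModEq, Nat.mod_eq_of_lt hj] at h3)
    · intro he
      rw [Nat.mod_add_mod, add_right_comm] at he
      have h3 : j + 1 ≡ i [MOD n] := Nat.ModEq.add_right_cancel' s he
      exact h2 (by rwa [Nat.ModEq, Nat.mod_eq_of_lt hi] at h3)
  ccw := by
    rw [signedArea₂_shiftWalk h.periodic]
    exact h.ccw

end Shift

/-! ### Rotations by quarter turns. -/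

/-- The rotation by 90 degrees. -/
def rot (p : ℤ × ℤ) : ℤ × ℤ := (-p.2, p.1)

theorem cross_rot (p q r : ℤ × ℤ) : cross (rot p) (rot q) (rot r) = cross p q r := by
  simp only [cross, rot]; ring

theorem mem_edge {v : ℕ → ℤ × ℤ} {i : ℕ} {p : ℤ × ℤ} : p ∈ edge v i ↔
    (min (v i).1 (v (i + 1)).1 ≤ p.1 ∧ p.1 ≤ max (v i).1 (v (i + 1)).1) ∧
      (min (v i).2 (v (i + 1)).2 ≤ p.2 ∧ p.2 ≤ max (v i).2 (v (i + 1)).2) := by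
  simp only [edge, Set.uIcc, Set.mem_Icc, Prod.le_def, Prod.fst_inf, Prod.snd_inf, Prod.fst_sup,
    Prod.snd_sup]
  tauto

/-- A downward ray for `w` is a leftward ray for `v`. Together the downward and the leftward ray
from a cell centre bound a quadrant, and a closed walk crosses the boundary of a quadrant an even
number of times. -/
theorem crossings_add_even {n : ℕ} {v w : ℕ → ℤ × ℤ} (hp : v n = v 0)
    (ha : ∀ i, (v i).1 = (v (i + 1)).1 ∨ (v i).2 = (v (i + 1)).2)
    (hw : ∀ i, (w i).1 = -(v i).2 ∧ (w i).2 = (v i).1) (c : ℤ × ℤ) :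
    Even (crossings n v c + crossings n w (-c.2 - 1, c.1)) := by
  rw [← ZMod.natCast_eq_zero_iff_even, crossings, crossings, Finset.card_filter,
    Finset.card_filter]
  push_cast
  rw [← Finset.sum_add_distrib]
  -- The indicator of the lower left quadrant: modulo 2 it changes exactly on edges that cross one
  -- of the two rays, and its differences telescope around the closed walk.
  let q : ℕ → ZMod 2 := fun i => if (v i).1 ≤ c.1 ∧ (v i).2 ≤ c.2 then 1 else 0
  have hq : ∑ i ∈ Finset.range n, (q (i + 1) - q i) = 0 := by
    rw [Finset.sum_range_sub]; simp [q, hp]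
  refine Eq.trans ?_ hq
  refine Finset.sum_congr rfl fun i _ => ?_
  have hab := ha i
  have h1 := hw i
  have h2 := hw (i + 1)
  simp only [q]
  generalize v i = a at *
  generalize v (i + 1) = b at *
  generalize w i = a' at *
  generalize w (i + 1) = b' at *
  split_ifs <;> first | decide | (exfalso; omega)

/-- Interior parity does not depend on the choice of ray by `crossings_add_even`, and `(-y - 1, x)`
is the lower left corner of the rotated cell `(x, y)`, so the rotation is a bijection of interior
cells. -/
theorem area_rot {n : ℕ} {v : ℕ → ℤ × ℤ} (hp : v n = v 0)
    (ha : ∀ i, (v i).1 = (v (i + 1)).1 ∨ (v i).2 = (v (i + 1)).2) :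
    area n (fun i => rot (v i)) = area n v := by
  have hinj : Function.Injective fun c : ℤ × ℤ => ((-c.2 - 1, c.1) : ℤ × ℤ) := by
    rintro ⟨a, b⟩ ⟨c, d⟩ h
    simp only [Prod.mk.injEq] at h ⊢
    omega
  have : interiorCells n (fun i => rot (v i)) =
      (fun c : ℤ × ℤ => ((-c.2 - 1, c.1) : ℤ × ℤ)) '' interiorCells n v := by
    ext ⟨x, y⟩
    have h := Nat.even_add'.1 (crossings_add_even hp ha (fun i => ⟨rfl, rfl⟩ : ∀ i, (rot (v i)).1 = _ ∧ (rot (v i)).2 = _)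
      (y, -x - 1))
    rw [show (-(y, -x - 1).2 - 1, (y, -x - 1).1) = (x, y) by simp] at h
    simp only [interiorCells, Set.mem_image, Set.mem_ofPred_eq, ← h]
    constructor
    · exact fun hc => ⟨_, hc, by simp⟩
    · rintro ⟨⟨a, b⟩, hc, he⟩
      simp only [Prod.mk.injEq] at he
      rwa [show y = a by omega, show -x - 1 = b by omega]
  rw [area, area, this, Set.ncard_image_of_injective _ hinj]

theorem IsPolygon.rot {n : ℕ} {v : ℕ → ℤ × ℤ} (h : IsPolygon n v) :
    IsPolygon n (fun i => rot (v i)) where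
  periodic i := by rw [h.periodic]
  axisParallel i := by
    have := h.axisParallel i
    simp only [RectPoly.rot, neg_inj]
    tauto
  perpendicular i := by
    rw [cross_rot]
    exact h.perpendicular i
  simple i hi j hj hij h1 h2 := by
    have := h.simple i hi j hj hij h1 h2
    rw [Set.disjoint_left] at this ⊢
    intro p hp hp'
    rw [mem_edge] at hp hp'
    simp only [RectPoly.rot] at hp hp'
    refine @this (p.2, -p.1) (mem_edge.2 ?_) (mem_edge.2 ?_) <;> simp only <;> omega
  ccw := by
    have := h.ccw
    simp only [signedArea₂, RectPoly.rot] at this ⊢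
    refine this.trans_eq (Finset.sum_congr rfl fun i _ => ?_)
    ring

/-- Any polygon can be rotated in such a way that its first edge points downwards. -/
theorem IsPolygon.exists_down {n : ℕ} {v : ℕ → ℤ × ℤ} (h : IsPolygon n v) :
    ∃ u, IsPolygon n u ∧ area n u = area n v ∧
      (∀ i, cross (u i) (u (i + 1)) (u (i + 2)) = cross (v i) (v (i + 1)) (v (i + 2))) ∧
      (u 0).1 = (u 1).1 ∧ (u 1).2 < (u 0).2 := by
  have hr : ∀ {v : ℕ → ℤ × ℤ}, IsPolygon n v → area n (fun i => RectPoly.rot (v i)) = area n v :=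
    fun h => area_rot (by simpa using h.periodic 0) h.axisParallel
  have hc : ∀ (v : ℕ → ℤ × ℤ) (i : ℕ), cross (RectPoly.rot (v i)) (RectPoly.rot (v (i + 1)))
      (RectPoly.rot (v (i + 2))) = cross (v i) (v (i + 1)) (v (i + 2)) := fun v i => cross_rot _ _ _
  have h0 := h.perpendicular 0
  have h1 := h.axisParallel 0
  simp only [cross, zero_add] at h0 h1
  have hne : (v 0).1 ≠ (v 1).1 ∨ (v 0).2 ≠ (v 1).2 := by
    by_contra! hcon
    rw [hcon.1, hcon.2] at h0
    simp at h0
  rcases h1 with h1 | h1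
  · rcases lt_or_gt_of_ne (show (v 0).2 ≠ (v 1).2 by tauto) with h2 | h2
    · refine ⟨_, h.rot.rot, by rw [hr h.rot, hr h], fun i => ?_, ?_, ?_⟩
      · rw [cross_rot, cross_rot]
      · simp only [RectPoly.rot, h1]
      · simp only [RectPoly.rot]; omega
    · exact ⟨v, h, rfl, fun _ => rfl, h1, h2⟩
  · rcases lt_or_gt_of_ne (show (v 0).1 ≠ (v 1).1 by tauto) with h2 | h2
    · refine ⟨_, h.rot.rot.rot, by rw [hr h.rot.rot, hr h.rot, hr h], fun i => ?_, ?_, ?_⟩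
      · rw [cross_rot, cross_rot, cross_rot]
      · simp only [RectPoly.rot, h1]
      · simp only [RectPoly.rot]; omega
    · refine ⟨_, h.rot, hr h, fun i => ?_, ?_, ?_⟩
      · rw [cross_rot]
      · simp only [RectPoly.rot, h1]
      · simp only [RectPoly.rot]; omega

/-! ### Layouts of monotone polygons -/

/-- The vertices of an `x`-monotone chain with horizontal edges from `(x i, y i)` to
`(x (i + 1), y i)`, numbered from `1`. -/
def vert (x y : ℕ → ℤ) (q : ℕ) : ℤ × ℤ := (x ((q + 2) / 2), y ((q + 1) / 2))

theorem vert_odd (x y : ℕ → ℤ) (a : ℕ) : vert x y (2 * a + 1) = (x (a + 1), y (a + 1)) := by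
  simp only [vert]
  rw [show (2 * a + 1 + 2) / 2 = a + 1 by omega, show (2 * a + 1 + 1) / 2 = a + 1 by omega]

theorem vert_even (x y : ℕ → ℤ) (a : ℕ) : vert x y (2 * a) = (x (a + 1), y a) := by
  simp only [vert]
  rw [show (2 * a + 2) / 2 = a + 1 by omega, show (2 * a + 1) / 2 = a by omega]

/-- The part of an `x`-monotone polygon to the right of a vertical line: a bottom chain with
horizontal edges `i₀, …, k` and a top chain with horizontal edges `j₀, …, m`.  The signs of the
vertical edges are given by `f` and `g`. -/
structure Layout (k m : ℕ) (f g : ℕ → ℤ) (i₀ j₀ : ℕ) (xb yb xt yt : ℕ → ℤ) : Prop where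
  le_k : i₀ ≤ k
  le_m : j₀ ≤ m
  xb_lt : ∀ i, i₀ ≤ i → i ≤ k → xb i < xb (i + 1)
  xt_lt : ∀ j, j₀ ≤ j → j ≤ m → xt j < xt (j + 1)
  left : xb i₀ = xt j₀
  right : xb (k + 1) = xt (m + 1)
  yb_sign : ∀ i, i₀ ≤ i → i < k → (yb (i + 1) - yb i).sign = f (i + 1)
  yt_sign : ∀ j, j₀ ≤ j → j < m → (yt (j + 1) - yt j).sign = g (j + 1)
  below : ∀ i j, i₀ ≤ i → i ≤ k → j₀ ≤ j → j ≤ m → xb i ≤ xt (j + 1) → xt j ≤ xb (i + 1) →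
    yb i < yt j

/-- The area of a layout. -/
def layoutArea (k m i₀ j₀ : ℕ) (xb yb xt yt : ℕ → ℤ) : ℤ :=
  ∑ j ∈ Finset.Ico j₀ (m + 1), yt j * (xt (j + 1) - xt j) -
    ∑ i ∈ Finset.Ico i₀ (k + 1), yb i * (xb (i + 1) - xb i)

/-- The closed walk `u` is the boundary of the polygon given by a layout, starting with its left
edge. -/
structure Traces (k m : ℕ) (xb yb xt yt : ℕ → ℤ) (u : ℕ → ℤ × ℤ) : Prop where
  periodic : ∀ i, u (i + 2 * (k + m)) = u i
  bot : ∀ q, 1 ≤ q → q ≤ 2 * k → u q = vert xb yb q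
  top : ∀ q, 1 ≤ q → q ≤ 2 * m → u (2 * (k + m) + 1 - q) = vert xt yt q

theorem chain_lt {x : ℕ → ℤ} {i₀ k : ℕ} (hx : ∀ i, i₀ ≤ i → i ≤ k → x i < x (i + 1)) {i j : ℕ}
    (hi : i₀ ≤ i) (hij : i < j) (hj : j ≤ k + 1) : x i < x j := by
  induction j, hij using Nat.le_induction with
  | base => exact hx i hi (by omega)
  | succ j hij ih => exact (ih (by omega)).trans (hx j (by omega) (by omega))

theorem chain_le {x : ℕ → ℤ} {i₀ k : ℕ} (hx : ∀ i, i₀ ≤ i → i ≤ k → x i < x (i + 1)) {i j : ℕ}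
    (hi : i₀ ≤ i) (hij : i ≤ j) (hj : j ≤ k + 1) : x i ≤ x j := by
  rcases hij.eq_or_lt with rfl | h
  · exact le_rfl
  · exact (chain_lt hx hi h hj).le

/-! ### Columns of a layout and its area. -/

/-- The height of a chain above the column with left boundary `z`. -/
def col (k : ℕ) (x y : ℕ → ℤ) (z : ℤ) : ℤ :=
  ∑ i ∈ Finset.Ico 1 (k + 1), if x i ≤ z ∧ z < x (i + 1) then y i else 0

/-- The half-open intervals of a chain are disjoint, so just one summand survives. -/
theorem sum_col_eq {A : Type*} [AddCommMonoid A] {k : ℕ} {x : ℕ → ℤ}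
    (hx : ∀ i, 1 ≤ i → i ≤ k → x i < x (i + 1)) {z : ℤ} {i : ℕ} (h1 : 1 ≤ i) (h2 : i ≤ k)
    (h3 : x i ≤ z) (h4 : z < x (i + 1)) (y : ℕ → A) :
    (∑ i ∈ Finset.Ico 1 (k + 1), if x i ≤ z ∧ z < x (i + 1) then y i else 0) = y i := by
  rw [Finset.sum_eq_single i]
  · simp [h3, h4]
  · intro j hj hji
    rw [Finset.mem_Ico] at hj
    rw [if_neg]
    rintro ⟨h5, h6⟩
    rcases lt_or_gt_of_ne hji with h | h
    · exact absurd (chain_le hx (by omega) (show j + 1 ≤ i by omega) (by omega)) (by omega)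
    · exact absurd (chain_le hx (by omega) (show i + 1 ≤ j by omega) (by omega)) (by omega)
  · intro h; exact absurd (Finset.mem_Ico.2 ⟨h1, by omega⟩) h

theorem exists_col {k : ℕ} {x : ℕ → ℤ} {z : ℤ} (h1 : x 1 ≤ z) (h2 : z < x (k + 1)) :
    ∃ i, 1 ≤ i ∧ i ≤ k ∧ x i ≤ z ∧ z < x (i + 1) := by
  induction k with
  | zero => exact absurd h2 (by simpa using h1)
  | succ k ih =>
    by_cases h : z < x (k + 1)
    · obtain ⟨i, h3, h4, h5⟩ := ih h
      exact ⟨i, h3, by omega, h5⟩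
    · exact ⟨k + 1, by omega, le_rfl, not_lt.1 h, h2⟩

theorem sum_col {k : ℕ} {x : ℕ → ℤ} (hx : ∀ i, 1 ≤ i → i ≤ k → x i < x (i + 1)) (y : ℕ → ℤ) :
    ∑ z ∈ Finset.Ico (x 1) (x (k + 1)), col k x y z =
      ∑ i ∈ Finset.Ico 1 (k + 1), y i * (x (i + 1) - x i) := by
  simp only [col]
  rw [Finset.sum_comm]
  refine Finset.sum_congr rfl fun i hi => ?_
  rw [Finset.mem_Ico] at hi
  rw [← Finset.sum_filter]
  have h1 := chain_le hx le_rfl hi.1 (by omega)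
  have h2 := chain_le hx (i := i + 1) (j := k + 1) (by omega) (by omega) le_rfl
  have h3 := hx i hi.1 (by omega)
  have : (Finset.Ico (x 1) (x (k + 1))).filter (fun z => x i ≤ z ∧ z < x (i + 1)) =
      Finset.Ico (x i) (x (i + 1)) := by
    ext z
    simp only [Finset.mem_filter, Finset.mem_Ico]
    omega
  rw [this, Finset.sum_const, Int.card_Ico, nsmul_eq_mul, Int.toNat_of_nonneg (by omega)]
  ring

/-- Even positions are vertical edges, which contribute nothing to the sums of interest; the odd
ones are the bottom edges in order and then the top edges in reverse order. -/
theorem sum_range_odd {A : Type*} [AddCommMonoid A] {F : ℕ → A} (k m : ℕ)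
    (hF : ∀ i < k + m, F (2 * i) = 0) :
    ∑ q ∈ Finset.range (2 * (k + m)), F q = ∑ i ∈ Finset.Ico 1 (k + 1), F (2 * i - 1) +
      ∑ j ∈ Finset.Ico 1 (m + 1), F (2 * (k + m) + 1 - 2 * j) := by
  have h1 : ∀ N, (∀ i < N, F (2 * i) = 0) →
      ∑ q ∈ Finset.range (2 * N), F q = ∑ i ∈ Finset.range N, F (2 * i + 1) := by
    intro N hN
    induction N with
    | zero => simp
    | succ N ih =>
      rw [Nat.mul_succ, Finset.sum_range_succ, Finset.sum_range_succ, Finset.sum_range_succ,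
        ih fun i hi => hN i (by omega), hN N (by omega), add_zero]
  rw [h1 _ hF, Finset.sum_range_add, Finset.sum_Ico_eq_sum_range, Finset.sum_Ico_eq_sum_range]
  congr 1
  · refine Finset.sum_congr (by simp) fun i _ => ?_
    congr 1; omega
  · rw [← Finset.sum_range_reflect]
    refine Finset.sum_congr (by simp) fun i hi => ?_
    rw [Finset.mem_range] at hi
    congr 1; omega

namespace Layout

variable {k m : ℕ} {f g : ℕ → ℤ} {xb yb xt yt : ℕ → ℤ} {u : ℕ → ℤ × ℤ}

theorem col_lt (h : Layout k m f g 1 1 xb yb xt yt) {z : ℤ} (h1 : xb 1 ≤ z)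
    (h2 : z < xb (k + 1)) : col k xb yb z < col m xt yt z := by
  obtain ⟨i, hi1, hi2, hi3, hi4⟩ := exists_col h1 h2
  obtain ⟨j, hj1, hj2, hj3, hj4⟩ := exists_col (h.left ▸ h1) (h.right ▸ h2)
  rw [col, col, sum_col_eq h.xb_lt hi1 hi2 hi3 hi4, sum_col_eq h.xt_lt hj1 hj2 hj3 hj4]
  exact h.below i j hi1 hi2 hj1 hj2 (by omega) (by omega)

theorem sum_heights (h : Layout k m f g 1 1 xb yb xt yt) :
    ∑ z ∈ Finset.Ico (xb 1) (xb (k + 1)), (col m xt yt z - col k xb yb z) =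
      layoutArea k m 1 1 xb yb xt yt := by
  rw [Finset.sum_sub_distrib, layoutArea, sum_col h.xb_lt, h.left, h.right, sum_col h.xt_lt]

theorem area_pos (h : Layout k m f g 1 1 xb yb xt yt) : 0 < layoutArea k m 1 1 xb yb xt yt := by
  rw [← h.sum_heights]
  refine Finset.sum_pos (fun z hz => ?_) ?_
  · rw [Finset.mem_Ico] at hz
    exact sub_pos.2 (h.col_lt hz.1 hz.2)
  · rw [Finset.nonempty_Ico]
    exact chain_lt h.xb_lt le_rfl (by have := h.le_k; omega) le_rfl

end Layout

theorem Traces.bottom_edge {k m : ℕ} {xb yb xt yt : ℕ → ℤ} {u : ℕ → ℤ × ℤ}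
    (hu : Traces k m xb yb xt yt u) {i : ℕ} (h1 : 1 ≤ i) (h2 : i ≤ k) :
    u (2 * i - 1) = (xb i, yb i) ∧ u (2 * i - 1 + 1) = (xb (i + 1), yb i) := by
  obtain ⟨i, rfl⟩ : ∃ j, i = j + 1 := ⟨i - 1, by omega⟩
  rw [show 2 * (i + 1) - 1 = 2 * i + 1 by omega, hu.bot _ (by omega) (by omega), vert_odd,
    show 2 * i + 1 + 1 = 2 * (i + 1) by omega, hu.bot _ (by omega) (by omega), vert_even]
  exact ⟨rfl, rfl⟩

theorem Traces.top_edge {k m : ℕ} {xb yb xt yt : ℕ → ℤ} {u : ℕ → ℤ × ℤ}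
    (hu : Traces k m xb yb xt yt u) {j : ℕ} (h1 : 1 ≤ j) (h2 : j ≤ m) :
    u (2 * (k + m) + 1 - 2 * j) = (xt (j + 1), yt j) ∧
      u (2 * (k + m) + 1 - 2 * j + 1) = (xt j, yt j) := by
  obtain ⟨j, rfl⟩ : ∃ i, j = i + 1 := ⟨j - 1, by omega⟩
  rw [hu.top _ (by omega) (by omega), vert_even,
    show 2 * (k + m) + 1 - 2 * (j + 1) + 1 = 2 * (k + m) + 1 - (2 * j + 1) by omega,
    hu.top _ (by omega) (by omega), vert_odd]
  exact ⟨rfl, rfl⟩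

theorem Traces.zero {k m : ℕ} {xb yb xt yt : ℕ → ℤ} {u : ℕ → ℤ × ℤ}
    (hu : Traces k m xb yb xt yt u) (hm : 1 ≤ m) : u 0 = (xt 1, yt 1) := by
  rw [← hu.periodic, zero_add]
  exact (hu.top 1 le_rfl (by omega)).trans (vert_odd xt yt 0)

/-- The vertical edges. -/
theorem Traces.vertical {k m : ℕ} {xb yb xt yt : ℕ → ℤ} {u : ℕ → ℤ × ℤ}
    (hu : Traces k m xb yb xt yt u) (hk : 1 ≤ k) (hm : 1 ≤ m) (hl : xb 1 = xt 1)
    (hr : xb (k + 1) = xt (m + 1)) {i : ℕ} (hi : i < k + m) :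
    (u (2 * i)).1 = (u (2 * i + 1)).1 := by
  rcases Nat.eq_zero_or_pos i with rfl | h0
  · rw [mul_zero, hu.zero hm, hu.bot _ (by omega) (by omega), show 0 + 1 = 2 * 0 + 1 by rfl,
      vert_odd, zero_add, hl]
  · rcases lt_trichotomy i k with h | rfl | h
    · rw [hu.bot _ (by omega) (by omega), hu.bot _ (by omega) (by omega), vert_odd, vert_even]
    · rw [hu.bot _ (by omega) (by omega), vert_even,
        show 2 * i + 1 = 2 * (i + m) + 1 - 2 * m by omega, (hu.top_edge hm le_rfl).1, hr]
    · obtain ⟨j, rfl⟩ : ∃ j, i = k + m - j := ⟨k + m - i, by omega⟩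
      have h1 := (hu.top_edge (j := j) (by omega) (by omega)).1
      have h2 := (hu.top_edge (j := j + 1) (by omega) (by omega)).2
      rw [show 2 * (k + m) + 1 - 2 * (j + 1) + 1 = 2 * (k + m - j) by omega] at h2
      rw [h2, show 2 * (k + m - j) + 1 = 2 * (k + m) + 1 - 2 * j by omega, h1]

namespace Layout

variable {k m : ℕ} {f g : ℕ → ℤ} {xb yb xt yt : ℕ → ℤ} {u : ℕ → ℤ × ℤ}

theorem signedArea₂_eq (h : Layout k m f g 1 1 xb yb xt yt) (hu : Traces k m xb yb xt yt u) :
    signedArea₂ (2 * (k + m)) u = 2 * layoutArea k m 1 1 xb yb xt yt := by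
  -- The shoelace terms differ from the trapezoid terms by differences of `x * y`, which telescope.
  -- In the trapezoid form vertical edges contribute zero.
  have h1 : signedArea₂ (2 * (k + m)) u = ∑ q ∈ Finset.range (2 * (k + m)),
      ((u q).1 - (u (q + 1)).1) * ((u q).2 + (u (q + 1)).2) := by
    have h0 := Finset.sum_range_sub (fun q => (u q).1 * (u q).2) (2 * (k + m))
    rw [← zero_add (2 * (k + m)), hu.periodic 0, sub_self, zero_add] at h0
    have h2 : ∀ q, (u q).1 * (u (q + 1)).2 - (u (q + 1)).1 * (u q).2 =
        ((u q).1 - (u (q + 1)).1) * ((u q).2 + (u (q + 1)).2) +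
          ((u (q + 1)).1 * (u (q + 1)).2 - (u q).1 * (u q).2) := fun q => by ring
    rw [signedArea₂, Finset.sum_congr rfl fun q _ => h2 q, Finset.sum_add_distrib, h0, add_zero]
  rw [h1, sum_range_odd]
  · rw [layoutArea, mul_sub, Finset.mul_sum, Finset.mul_sum, add_comm, sub_eq_add_neg,
      ← Finset.sum_neg_distrib]
    congr 1
    · refine Finset.sum_congr rfl fun j hj => ?_
      rw [Finset.mem_Ico] at hj
      obtain ⟨h2, h3⟩ := hu.top_edge hj.1 (by omega)
      rw [h2, h3]
      ring
    · refine Finset.sum_congr rfl fun j hj => ?_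
      rw [Finset.mem_Ico] at hj
      obtain ⟨h2, h3⟩ := hu.bottom_edge hj.1 (by omega)
      rw [h2, h3]
      ring
  · intro i hi
    rw [hu.vertical h.le_k h.le_m h.left h.right hi, sub_self, zero_mul]

theorem crossings_eq (h : Layout k m f g 1 1 xb yb xt yt) (hu : Traces k m xb yb xt yt u)
    (c : ℤ × ℤ) : (crossings (2 * (k + m)) u c : ℤ) =
      (∑ i ∈ Finset.Ico 1 (k + 1), if xb i ≤ c.1 ∧ c.1 < xb (i + 1) then
        (if yb i ≤ c.2 then 1 else 0) else 0) +
      (∑ i ∈ Finset.Ico 1 (m + 1), if xt i ≤ c.1 ∧ c.1 < xt (i + 1) then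
        (if yt i ≤ c.2 then 1 else 0) else 0) := by
  rw [crossings_eq_sum, sum_range_odd]
  · congr 1
    · refine Finset.sum_congr rfl fun j hj => ?_
      rw [Finset.mem_Ico] at hj
      obtain ⟨h2, h3⟩ := hu.bottom_edge hj.1 (by omega)
      have := h.xb_lt j hj.1 (by omega)
      rw [h2, h3, ← ite_and]
      refine if_congr ?_ rfl rfl
      simp only [min_eq_left this.le, max_eq_right this.le, true_and]
      tauto
    · refine Finset.sum_congr rfl fun j hj => ?_
      rw [Finset.mem_Ico] at hj
      obtain ⟨h2, h3⟩ := hu.top_edge hj.1 (by omega)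
      have := h.xt_lt j hj.1 (by omega)
      rw [h2, h3, ← ite_and]
      refine if_congr ?_ rfl rfl
      simp only [min_eq_right this.le, max_eq_left this.le, true_and]
      tauto
  · intro i hi
    rw [if_neg]
    rw [hu.vertical h.le_k h.le_m h.left h.right hi, min_self, max_self]
    omega

/-- A downward ray in a column of the polygon can meet only one bottom edge and one higher top edge;
the parity is odd exactly when the cell lies between them. -/
theorem odd_crossings_iff (h : Layout k m f g 1 1 xb yb xt yt) (hu : Traces k m xb yb xt yt u)
    (c : ℤ × ℤ) : Odd (crossings (2 * (k + m)) u c) ↔ (xb 1 ≤ c.1 ∧ c.1 < xb (k + 1)) ∧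
      col k xb yb c.1 ≤ c.2 ∧ c.2 < col m xt yt c.1 := by
  have h1 := h.crossings_eq hu c
  by_cases hc : xb 1 ≤ c.1 ∧ c.1 < xb (k + 1)
  · have hlt := h.col_lt hc.1 hc.2
    obtain ⟨i, hi1, hi2, hi3, hi4⟩ := exists_col hc.1 hc.2
    obtain ⟨j, hj1, hj2, hj3, hj4⟩ := exists_col (h.left ▸ hc.1) (h.right ▸ hc.2)
    rw [sum_col_eq h.xb_lt hi1 hi2 hi3 hi4, sum_col_eq h.xt_lt hj1 hj2 hj3 hj4] at h1
    rw [col, col, sum_col_eq h.xb_lt hi1 hi2 hi3 hi4, sum_col_eq h.xt_lt hj1 hj2 hj3 hj4] at hlt ⊢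
    rw [Nat.odd_iff]
    split_ifs at h1 <;> omega
  · have h2 : crossings (2 * (k + m)) u c = 0 := by
      zify
      rw [h1, Finset.sum_eq_zero, Finset.sum_eq_zero, add_zero]
      · intro j hj
        rw [Finset.mem_Ico] at hj
        have h3 := chain_le h.xt_lt le_rfl hj.1 (by omega)
        have h4 := chain_le h.xt_lt (i := j + 1) (j := m + 1) (by omega) (by omega) le_rfl
        rw [h.left, h.right] at hc
        rw [if_neg (by omega)]
      · intro j hj
        rw [Finset.mem_Ico] at hj
        have h3 := chain_le h.xb_lt le_rfl hj.1 (by omega)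
        have h4 := chain_le h.xb_lt (i := j + 1) (j := k + 1) (by omega) (by omega) le_rfl
        rw [if_neg (by omega)]
    rw [h2]
    simp [hc]

theorem area_eq (h : Layout k m f g 1 1 xb yb xt yt) (hu : Traces k m xb yb xt yt u) :
    (area (2 * (k + m)) u : ℤ) = layoutArea k m 1 1 xb yb xt yt := by
  have h1 : interiorCells (2 * (k + m)) u = ((Finset.Ico (xb 1) (xb (k + 1))).biUnion fun z =>
      {z} ×ˢ Finset.Ico (col k xb yb z) (col m xt yt z) : Finset (ℤ × ℤ)) := by
    ext ⟨x, y⟩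
    simp only [interiorCells, Set.mem_ofPred_eq, h.odd_crossings_iff hu, Finset.mem_coe,
      Finset.mem_biUnion, Finset.mem_product, Finset.mem_singleton, Finset.mem_Ico]
    constructor
    · rintro ⟨h1, h2⟩
      exact ⟨x, h1, rfl, h2⟩
    · rintro ⟨z, h1, rfl, h2⟩
      exact ⟨h1, h2⟩
  rw [area, h1, Set.ncard_coe_finset, Finset.card_biUnion, ← h.sum_heights]
  · push_cast
    refine Finset.sum_congr rfl fun z hz => ?_
    rw [Finset.mem_Ico] at hz
    have := h.col_lt hz.1 hz.2
    rw [Finset.card_product, Finset.card_singleton, Int.card_Ico]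
    omega
  · intro z _ z' _ hne
    rw [Function.onFun, Finset.disjoint_left]
    rintro ⟨x, y⟩ h2 h3
    simp only [Finset.mem_product, Finset.mem_singleton] at h2 h3
    exact hne (h2.1.symm.trans h3.1)

end Layout

/-! ### Turns of a walk along a layout. -/

theorem cross_vert_odd (x y : ℕ → ℤ) (a : ℕ) :
    cross (vert x y (2 * a + 1)) (vert x y (2 * a + 2)) (vert x y (2 * a + 3)) =
      (x (a + 2) - x (a + 1)) * (y (a + 2) - y (a + 1)) := by
  rw [vert_odd, show 2 * a + 2 = 2 * (a + 1) by ring, show 2 * a + 3 = 2 * (a + 1) + 1 by ring,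
    vert_odd, vert_even, cross]
  ring

theorem cross_vert_even (x y : ℕ → ℤ) (a : ℕ) :
    cross (vert x y (2 * a)) (vert x y (2 * a + 1)) (vert x y (2 * a + 2)) =
      -((x (a + 2) - x (a + 1)) * (y (a + 1) - y a)) := by
  rw [vert_odd, show 2 * a + 2 = 2 * (a + 1) by ring, vert_even, vert_even, cross]
  ring

theorem cross_reverse (p q r : ℤ × ℤ) : cross r q p = -cross p q r := by
  simp only [cross]; ring

/-- The sign of the turn at the end of the edge `i`. -/
def turnSign (u : ℕ → ℤ × ℤ) (i : ℕ) : ℤ := (cross (u i) (u (i + 1)) (u (i + 2))).sign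

theorem sign_mul_of_pos {a b : ℤ} (ha : 0 < a) : (a * b).sign = b.sign := by
  rw [Int.sign_mul, Int.sign_eq_one_of_pos ha, one_mul]

namespace Layout

variable {k m : ℕ} {f g : ℕ → ℤ} {xb yb xt yt : ℕ → ℤ} {u : ℕ → ℤ × ℤ}

/-- Bottom edges run to the right, so the turn before a vertical edge has the sign of that edge and
the turn after it the opposite sign. -/
theorem turn_bottom (h : Layout k m f g 1 1 xb yb xt yt) (hu : Traces k m xb yb xt yt u) {a : ℕ}
    (h1 : 1 ≤ a) (h2 : a < k) : turnSign u (2 * a - 1) = f (a + 1) ∧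
      turnSign u (2 * a) = -f (a + 1) := by
  obtain ⟨a, rfl⟩ : ∃ j, a = j + 1 := ⟨a - 1, by omega⟩
  have h3 := h.xb_lt (a + 1) (by omega) (by omega)
  have h4 := h.xb_lt (a + 2) (by omega) (by omega)
  constructor
  · rw [show 2 * (a + 1) - 1 = 2 * a + 1 by omega, turnSign, hu.bot _ (by omega) (by omega),
      hu.bot _ (by omega) (by omega), hu.bot _ (by omega) (by omega), cross_vert_odd,
      sign_mul_of_pos (by linarith)]
    exact h.yb_sign (a + 1) (by omega) (by omega)
  · rw [turnSign, hu.bot _ (by omega) (by omega),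
      hu.bot _ (by omega) (by omega), hu.bot _ (by omega) (by omega), cross_vert_even, Int.sign_neg,
      sign_mul_of_pos (by linarith)]
    exact congrArg Neg.neg (h.yb_sign (a + 1) (by omega) (by omega))

/-- The top chain is traversed backwards; `cross_reverse` transfers the computation for a
left-to-right chain. -/
theorem turn_top (h : Layout k m f g 1 1 xb yb xt yt) (hu : Traces k m xb yb xt yt u) {a : ℕ}
    (h1 : 1 ≤ a) (h2 : a < m) : turnSign u (2 * (k + m) - 2 * a) = -g (a + 1) ∧
      turnSign u (2 * (k + m) - 2 * a - 1) = g (a + 1) := by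
  obtain ⟨a, rfl⟩ : ∃ j, a = j + 1 := ⟨a - 1, by omega⟩
  have h3 := h.xt_lt (a + 1) (by omega) (by omega)
  have h4 := h.xt_lt (a + 2) (by omega) (by omega)
  constructor
  · rw [turnSign, show 2 * (k + m) - 2 * (a + 1) = 2 * (k + m) + 1 - (2 * a + 3) by omega,
      show 2 * (k + m) + 1 - (2 * a + 3) + 1 = 2 * (k + m) + 1 - (2 * a + 2) by omega,
      show 2 * (k + m) + 1 - (2 * a + 3) + 2 = 2 * (k + m) + 1 - (2 * a + 1) by omega,
      hu.top _ (by omega) (by omega), hu.top _ (by omega) (by omega),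
      hu.top _ (by omega) (by omega), cross_reverse, cross_vert_odd, Int.sign_neg,
      sign_mul_of_pos (by linarith)]
    exact congrArg Neg.neg (h.yt_sign (a + 1) (by omega) (by omega))
  · rw [turnSign, show 2 * (k + m) - 2 * (a + 1) - 1 = 2 * (k + m) + 1 - (2 * (a + 1) + 2) by omega,
      show 2 * (k + m) + 1 - (2 * (a + 1) + 2) + 1 = 2 * (k + m) + 1 - (2 * (a + 1) + 1) by omega,
      show 2 * (k + m) + 1 - (2 * (a + 1) + 2) + 2 = 2 * (k + m) + 1 - (2 * (a + 1)) by omega,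
      hu.top _ (by omega) (by omega), hu.top _ (by omega) (by omega),
      hu.top _ (by omega) (by omega), cross_reverse, cross_vert_even, neg_neg,
      sign_mul_of_pos (by linarith)]
    exact h.yt_sign (a + 1) (by omega) (by omega)

theorem below_left (h : Layout k m f g 1 1 xb yb xt yt) : yb 1 < yt 1 := by
  have h1 := h.xb_lt 1 le_rfl h.le_k
  have h2 := h.xt_lt 1 le_rfl h.le_m
  exact h.below 1 1 le_rfl h.le_k le_rfl h.le_m (h.left ▸ h2.le) (h.left ▸ h1.le)

theorem below_right (h : Layout k m f g 1 1 xb yb xt yt) : yb k < yt m := by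
  have h1 := h.xb_lt k h.le_k le_rfl
  have h2 := h.xt_lt m h.le_m le_rfl
  exact h.below k m h.le_k le_rfl h.le_m le_rfl (h.right ▸ h1.le) (h.right ▸ h2.le)

theorem turn_left (h : Layout k m f g 1 1 xb yb xt yt) (hu : Traces k m xb yb xt yt u) :
    turnSign u 0 = 1 ∧ turnSign u (2 * (k + m) - 1) = 1 := by
  have h0 := hu.zero h.le_m
  obtain ⟨h1, h2⟩ := hu.bottom_edge le_rfl h.le_k
  obtain ⟨h3, h4⟩ := hu.top_edge le_rfl h.le_m
  have h5 := h.below_left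
  have h6 := h.xb_lt 1 le_rfl h.le_k
  have h7 := h.xt_lt 1 le_rfl h.le_m
  have h8 := h.left
  have h9 : u (2 * (k + m) + 1 - 2 * 1 + 2) = u 1 := by
    have := h.le_k
    rw [← hu.periodic 1]; congr 1; omega
  norm_num at h1 h2
  rw [turnSign, turnSign, show 2 * (k + m) - 1 = 2 * (k + m) + 1 - 2 * 1 by omega, h3, h4, h9, h0,
    h1, h2]
  simp only [cross]
  constructor <;> refine Int.sign_eq_one_of_pos ?_ <;> nlinarith

theorem turn_right (h : Layout k m f g 1 1 xb yb xt yt) (hu : Traces k m xb yb xt yt u) :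
    turnSign u (2 * k - 1) = 1 ∧ turnSign u (2 * k) = 1 := by
  obtain ⟨h1, h2⟩ := hu.bottom_edge h.le_k le_rfl
  obtain ⟨h3, h4⟩ := hu.top_edge h.le_m le_rfl
  have h5 := h.below_right
  have h6 := h.xb_lt k h.le_k le_rfl
  have h7 := h.xt_lt m h.le_m le_rfl
  have h8 := h.right
  have h9 := h.le_k
  rw [show 2 * (k + m) + 1 - 2 * m = 2 * k + 1 by omega] at h3 h4
  rw [show 2 * k - 1 + 1 = 2 * k by omega] at h2
  rw [turnSign, turnSign, show 2 * k - 1 + 1 = 2 * k by omega,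
    show 2 * k - 1 + 2 = 2 * k + 1 by omega, h1, h2, h3, h4]
  simp only [cross]
  constructor <;> refine Int.sign_eq_one_of_pos ?_ <;> nlinarith

end Layout

/-! ### Layouts give polygons -/

theorem mem_uIcc_prod {a b p : ℤ × ℤ} : p ∈ Set.uIcc a b ↔
    (min a.1 b.1 ≤ p.1 ∧ p.1 ≤ max a.1 b.1) ∧ (min a.2 b.2 ≤ p.2 ∧ p.2 ≤ max a.2 b.2) := by
  simp only [Set.uIcc, Set.mem_Icc, Prod.le_def, Prod.fst_inf, Prod.snd_inf, Prod.fst_sup,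
    Prod.snd_sup]
  tauto

section Chain

variable {k : ℕ} {x y : ℕ → ℤ} (hx : ∀ i, 1 ≤ i → i ≤ k → x i < x (i + 1))

include hx

theorem mem_chain_odd {a : ℕ} (ha : a < k) {p : ℤ × ℤ}
    (hp : p ∈ Set.uIcc (vert x y (2 * a + 1)) (vert x y (2 * a + 2))) :
    x (a + 1) ≤ p.1 ∧ p.1 ≤ x (a + 2) ∧ p.2 = y (a + 1) := by
  rw [vert_odd, show 2 * a + 2 = 2 * (a + 1) by ring, vert_even,
    show a + 1 + 1 = a + 2 by rfl, mem_uIcc_prod] at hp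
  have : x (a + 1) < x (a + 2) := hx (a + 1) (by omega) (by omega)
  simp only at hp
  omega

omit hx in
theorem mem_chain_even {a : ℕ} {p : ℤ × ℤ}
    (hp : p ∈ Set.uIcc (vert x y (2 * a)) (vert x y (2 * a + 1))) :
    p.1 = x (a + 1) ∧ min (y a) (y (a + 1)) ≤ p.2 ∧ p.2 ≤ max (y a) (y (a + 1)) := by
  rw [vert_odd, vert_even, mem_uIcc_prod] at hp
  simp only at hp
  omega

/-- Nonconsecutive edges of a chain are separated in the `x`-direction, except for two horizontal
edges joined by a vertical edge; these have different heights. -/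
theorem chain_disjoint (hy : ∀ i, 1 ≤ i → i < k → y i ≠ y (i + 1)) {q q' : ℕ} (h1 : 1 ≤ q)
    (h2 : q + 2 ≤ q') (h3 : q' + 1 ≤ 2 * k) :
    Disjoint (Set.uIcc (vert x y q) (vert x y (q + 1)))
      (Set.uIcc (vert x y q') (vert x y (q' + 1))) := by
  rw [Set.disjoint_left]
  intro p hp hp'
  rcases Nat.even_or_odd' q with ⟨a, rfl | rfl⟩ <;> rcases Nat.even_or_odd' q' with ⟨b, rfl | rfl⟩
  · have e1 := mem_chain_even hp
    have e2 := mem_chain_even hp'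
    have := chain_lt hx (i := a + 1) (j := b + 1) (by omega) (by omega) (by omega)
    omega
  · have e1 := mem_chain_even hp
    have e2 := mem_chain_odd hx (by omega) hp'
    have := chain_lt hx (i := a + 1) (j := b + 1) (by omega) (by omega) (by omega)
    omega
  · have e1 := mem_chain_odd hx (by omega) hp
    have e2 := mem_chain_even hp'
    have := chain_lt hx (i := a + 2) (j := b + 1) (by omega) (by omega) (by omega)
    omega
  · have e1 := mem_chain_odd hx (by omega) hp
    have e2 := mem_chain_odd hx (by omega) hp'
    rcases (show a + 1 ≤ b by omega).eq_or_lt with rfl | h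
    · have := hy (a + 1) (by omega) (by omega)
      exact this (e1.2.2.symm.trans e2.2.2)
    · have := chain_lt hx (i := a + 2) (j := b + 1) (by omega) (by omega) (by omega)
      omega

/-- A point on a chain is at the height of a horizontal edge of the chain, or between the heights
of two horizontal edges that end below or above the point. -/
theorem mem_chain {q : ℕ} (h1 : 1 ≤ q) (h2 : q + 1 ≤ 2 * k) {p : ℤ × ℤ}
    (hp : p ∈ Set.uIcc (vert x y q) (vert x y (q + 1))) :
    (∃ i, 1 ≤ i ∧ i ≤ k ∧ x i ≤ p.1 ∧ p.1 ≤ x (i + 1) ∧ p.2 ≤ y i) ∧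
    (∃ i, 1 ≤ i ∧ i ≤ k ∧ x i ≤ p.1 ∧ p.1 ≤ x (i + 1) ∧ y i ≤ p.2) ∧
    (2 ≤ q → x 1 < p.1) ∧ (q + 2 ≤ 2 * k → p.1 < x (k + 1)) := by
  rcases Nat.even_or_odd' q with ⟨a, rfl | rfl⟩
  · have e := mem_chain_even hp
    have h3 := hx a (by omega) (by omega)
    have h4 := hx (a + 1) (by omega) (by omega)
    refine ⟨?_, ?_, fun _ => ?_, fun _ => ?_⟩
    · rcases le_total (y a) (y (a + 1)) with h | h
      · exact ⟨a + 1, by omega, by omega, by omega, by omega, by omega⟩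
      · exact ⟨a, by omega, by omega, by omega, by omega, by omega⟩
    · rcases le_total (y a) (y (a + 1)) with h | h
      · exact ⟨a, by omega, by omega, by omega, by omega, by omega⟩
      · exact ⟨a + 1, by omega, by omega, by omega, by omega, by omega⟩
    · rw [e.1]; exact chain_lt hx (by omega) (by omega) (by omega)
    · rw [e.1]; exact chain_lt hx (by omega) (by omega) (by omega)
  · have e := mem_chain_odd hx (by omega) hp
    refine ⟨⟨a + 1, by omega, by omega, e.1, e.2.1, e.2.2.le⟩,
      ⟨a + 1, by omega, by omega, e.1, e.2.1, e.2.2.ge⟩, fun _ => ?_, fun _ => ?_⟩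
    · exact (chain_lt hx le_rfl (by omega) (by omega)).trans_le e.1
    · exact e.2.1.trans_lt (chain_lt hx (by omega) (by omega) (by omega))

end Chain

namespace Layout

variable {k m : ℕ} {f g : ℕ → ℤ} {xb yb xt yt : ℕ → ℤ} {u : ℕ → ℤ × ℤ}

/-- Edge `0` is the left edge and edge `2 * k` the right edge; other nonadjacent edges avoid their
vertical lines by the strict inequalities in `mem_chain`. Two edges of one chain are handled by
`chain_disjoint`, and edges of different chains by `below`. -/
theorem simple (h : Layout k m f g 1 1 xb yb xt yt) (hu : Traces k m xb yb xt yt u)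
    (hf : ∀ i, 1 < i → i ≤ k → f i ≠ 0) (hg : ∀ i, 1 < i → i ≤ m → g i ≠ 0) {i j : ℕ} (hij : i < j)
    (hj : j < 2 * (k + m)) (h1 : i + 1 ≠ j) (h2 : (j + 1) % (2 * (k + m)) ≠ i) :
    Disjoint (edge u i) (edge u j) := by
  have hk := h.le_k
  have hm := h.le_m
  have hbot : ∀ i, 1 ≤ i → i + 1 ≤ 2 * k →
      edge u i = Set.uIcc (vert xb yb i) (vert xb yb (i + 1)) := fun i h3 h4 => by
    rw [edge, hu.bot i h3 (by omega), hu.bot _ (by omega) h4]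
  have htop : ∀ i, 2 * k + 1 ≤ i → i < 2 * (k + m) → edge u i =
      Set.uIcc (vert xt yt (2 * (k + m) - i)) (vert xt yt (2 * (k + m) - i + 1)) :=
    fun i h3 h4 => by
    rw [← hu.top (2 * (k + m) - i) (by omega) (by omega), ← hu.top _ (by omega) (by omega),
      edge, Set.uIcc_comm]
    congr 2 <;> omega
  have hleft : ∀ p ∈ edge u 0, p.1 = xb 1 := fun p hp => by
    have h4 := (hu.bottom_edge le_rfl hk).1
    have h3 := hu.zero hm
    rw [edge, h3, zero_add, show u 1 = _ from h4, mem_uIcc_prod, h.left] at hp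
    simp only at hp
    rw [h.left]
    omega
  have hright : ∀ p ∈ edge u (2 * k), p.1 = xb (k + 1) := fun p hp => by
    have h4 := hu.vertical hk hm h.left h.right (i := k) (by omega)
    have h5 : (u (2 * k)).1 = xb (k + 1) := by
      rw [hu.bot _ (by omega) (by omega), vert_even]
    rw [edge, mem_uIcc_prod] at hp
    omega
  have hyb : ∀ i, 1 ≤ i → i < k → yb i ≠ yb (i + 1) := fun i h3 h4 he => by
    have h5 := h.yb_sign i h3 h4
    rw [he, sub_self] at h5
    exact hf (i + 1) (by omega) (by omega) h5.symm
  have hyt : ∀ i, 1 ≤ i → i < m → yt i ≠ yt (i + 1) := fun i h3 h4 he => by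
    have h5 := h.yt_sign i h3 h4
    rw [he, sub_self] at h5
    exact hg (i + 1) (by omega) (by omega) h5.symm
  rw [Set.disjoint_left]
  intro p hp hp'
  have hlr := chain_lt h.xb_lt le_rfl (show 1 < k + 1 by omega) le_rfl
  have hl := h.left
  have hr := h.right
  rcases Nat.eq_zero_or_pos i with rfl | hi
  · have e := hleft p hp
    rcases lt_trichotomy j (2 * k) with h3 | rfl | h3
    · rw [hbot j (by omega) (by omega)] at hp'
      have := (mem_chain h.xb_lt (by omega) (by omega) hp').2.2.1 (by omega)
      omega
    · have := hright p hp'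
      omega
    · rw [htop j (by omega) (by omega)] at hp'
      have h4 : j + 1 ≠ 2 * (k + m) := fun h4 => h2 (by rw [h4, Nat.mod_self])
      have := (mem_chain h.xt_lt (by omega) (by omega) hp').2.2.1 (by omega)
      omega
  rcases lt_trichotomy i (2 * k) with hi2 | rfl | hi2
  · rw [hbot i hi (by omega)] at hp
    rcases lt_trichotomy j (2 * k) with h3 | rfl | h3
    · rw [hbot j (by omega) (by omega)] at hp'
      exact Set.disjoint_left.1 (chain_disjoint h.xb_lt hyb hi (by omega) (by omega)) hp hp'
    · have e := hright p hp'
      have := (mem_chain h.xb_lt (by omega) (by omega) hp).2.2.2 (by omega)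
      omega
    · rw [htop j (by omega) (by omega)] at hp'
      -- A common point would be at least as high as some top edge and at most as high as some
      -- bottom edge, both of which meet its vertical line.
      obtain ⟨-, ⟨a, ha⟩, -⟩ := mem_chain h.xt_lt (by omega) (by omega) hp'
      obtain ⟨⟨b, hb⟩, -, -⟩ := mem_chain h.xb_lt (by omega) (by omega) hp
      have := h.below b a hb.1 hb.2.1 ha.1 ha.2.1 (by omega) (by omega)
      omega
  · have e := hright p hp
    rw [htop j (by omega) (by omega)] at hp'
    have := (mem_chain h.xt_lt (by omega) (by omega) hp').2.2.2 (by omega)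
    omega
  · rw [htop i (by omega) (by omega)] at hp
    rw [htop j (by omega) (by omega)] at hp'
    exact Set.disjoint_left.1 (chain_disjoint h.xt_lt hyt (by omega) (by omega) (by omega)) hp' hp

theorem isPolygon (h : Layout k m f g 1 1 xb yb xt yt) (hu : Traces k m xb yb xt yt u)
    (hf : ∀ i, 1 < i → i ≤ k → f i ≠ 0) (hg : ∀ i, 1 < i → i ≤ m → g i ≠ 0) :
    IsPolygon (2 * (k + m)) u where
  periodic := hu.periodic
  axisParallel i := by
    have hk := h.le_k
    have hmod : ∀ j, u (j % (2 * (k + m)) + 1) = u (j + 1) := fun j =>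
      periodic_mod (f := fun j => u (j + 1))
        (fun j => by rw [add_right_comm, hu.periodic]) j
    rw [← periodic_mod hu.periodic i, ← hmod]
    have hi := Nat.mod_lt i (show 0 < 2 * (k + m) by omega)
    generalize i % (2 * (k + m)) = i at hi
    rcases Nat.even_or_odd' i with ⟨a, rfl | rfl⟩
    · exact Or.inl (hu.vertical hk h.le_m h.left h.right (by omega))
    · right
      by_cases ha : a < k
      · obtain ⟨h1, h2⟩ := hu.bottom_edge (i := a + 1) (by omega) (by omega)
        rw [show 2 * (a + 1) - 1 = 2 * a + 1 by omega] at h1 h2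
        rw [h1, h2]
      · obtain ⟨h1, h2⟩ := hu.top_edge (j := k + m - a) (by omega) (by omega)
        rw [show 2 * (k + m) + 1 - 2 * (k + m - a) = 2 * a + 1 by omega] at h1 h2
        rw [h1, h2]
  perpendicular i := by
    have hk := h.le_k
    have hm := h.le_m
    suffices H : ∀ i < 2 * (k + m), turnSign u i ≠ 0 by
      have h1 := H (i % (2 * (k + m))) (Nat.mod_lt _ (by omega))
      have h2 : turnSign u (i % (2 * (k + m))) = turnSign u i :=
        periodic_mod (fun j => by
          simp only [turnSign, add_right_comm j (2 * (k + m)), hu.periodic]) i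
      rw [h2, turnSign] at h1
      intro h3
      rw [h3] at h1
      exact h1 rfl
    intro i hi
    rcases lt_or_ge i (2 * k) with h1 | h1
    · rcases Nat.even_or_odd' i with ⟨a, rfl | rfl⟩
      · rcases Nat.eq_zero_or_pos a with rfl | ha
        · rw [mul_zero, (h.turn_left hu).1]; decide
        · rw [(h.turn_bottom hu ha (by omega)).2]
          exact neg_ne_zero.2 (hf _ (by omega) (by omega))
      · rcases (show a + 1 ≤ k by omega).eq_or_lt with ha | ha
        · rw [show 2 * a + 1 = 2 * k - 1 by omega, (h.turn_right hu).1]; decide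
        · rw [show 2 * a + 1 = 2 * (a + 1) - 1 by omega, (h.turn_bottom hu (by omega) ha).1]
          exact hf _ (by omega) (by omega)
    · obtain ⟨j, rfl⟩ : ∃ j, i = 2 * (k + m) - j := ⟨2 * (k + m) - i, by omega⟩
      rcases Nat.even_or_odd' j with ⟨a, rfl | rfl⟩
      · rcases (show a ≤ m by omega).eq_or_lt with ha | ha
        · rw [show 2 * (k + m) - 2 * a = 2 * k by omega, (h.turn_right hu).2]; decide
        · rw [(h.turn_top hu (by omega) ha).1]
          exact neg_ne_zero.2 (hg _ (by omega) (by omega))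
      · rcases Nat.eq_zero_or_pos a with rfl | ha
        · rw [mul_zero, zero_add, (h.turn_left hu).2]; decide
        · rw [show 2 * (k + m) - (2 * a + 1) = 2 * (k + m) - 2 * a - 1 by omega,
            (h.turn_top hu ha (by omega)).2]
          exact hg _ (by omega) (by omega)
  simple i hi j hj hij h1 h2 := by
    rcases lt_or_gt_of_ne hij with h3 | h3
    · exact h.simple hu hf hg h3 hj (fun h4 => h1 (by rw [h4, Nat.mod_eq_of_lt hj])) h2
    · exact (h.simple hu hf hg h3 hi (fun h4 => h2 (by rw [h4, Nat.mod_eq_of_lt hi])) h1).symm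
  ccw := by
    rw [h.signedArea₂_eq hu]
    have := h.area_pos
    omega

end Layout

/-! ### Polygons give layouts -/

/-- A closed walk that starts with a vertical edge, then makes `k` steps to the right and finally
`m` steps to the left, with vertical edges in between. -/
structure Directed (k m : ℕ) (u : ℕ → ℤ × ℤ) : Prop where
  le_k : 1 ≤ k
  le_m : 1 ≤ m
  periodic : ∀ i, u (i + 2 * (k + m)) = u i
  bot : ∀ i, 1 ≤ i → i ≤ k → (u (2 * i - 1)).2 = (u (2 * i)).2 ∧ (u (2 * i - 1)).1 < (u (2 * i)).1
  top : ∀ j, 1 ≤ j → j ≤ m →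
    (u (2 * (k + m) + 1 - 2 * j)).2 = (u (2 * (k + m) + 2 - 2 * j)).2 ∧
      (u (2 * (k + m) + 2 - 2 * j)).1 < (u (2 * (k + m) + 1 - 2 * j)).1
  vert : ∀ i < k + m, (u (2 * i)).1 = (u (2 * i + 1)).1

/-- In a simple walk, the bottom chain stays below the top chain. -/
theorem Traces.layout {k m : ℕ} {xb yb xt yt : ℕ → ℤ} {u : ℕ → ℤ × ℤ}
    (hu : Traces k m xb yb xt yt u) (hk : 1 ≤ k) (hm : 1 ≤ m)
    (hxb : ∀ i, 1 ≤ i → i ≤ k → xb i < xb (i + 1)) (hxt : ∀ j, 1 ≤ j → j ≤ m → xt j < xt (j + 1))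
    (hl : xb 1 = xt 1) (hr : xb (k + 1) = xt (m + 1)) (hd : yb 1 < yt 1)
    (hs : ∀ i < 2 * (k + m), ∀ j < 2 * (k + m), i ≠ j → (i + 1) % (2 * (k + m)) ≠ j →
      (j + 1) % (2 * (k + m)) ≠ i → Disjoint (edge u i) (edge u j)) :
    Layout k m (fun i => (yb i - yb (i - 1)).sign) (fun i => (yt i - yt (i - 1)).sign) 1 1
      xb yb xt yt := by
  have hs' : ∀ i < 2 * (k + m), ∀ j < 2 * (k + m), i < j → i + 1 ≠ j →
      (0 < i ∨ j + 1 ≠ 2 * (k + m)) → ∀ p ∈ edge u i, p ∉ edge u j := by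
    intro i hi j hj hij h1 h2 p hp hp'
    refine Set.disjoint_left.1 (hs i hi j hj hij.ne ?_ ?_) hp hp'
    · rw [Nat.mod_eq_of_lt (by omega)]; exact h1
    · rcases (show j + 1 ≤ 2 * (k + m) by omega).eq_or_lt with h3 | h3
      · rw [h3, Nat.mod_self]; omega
      · rw [Nat.mod_eq_of_lt h3]; omega
  have hbot : ∀ i, 1 ≤ i → i ≤ k → ∀ p : ℤ × ℤ, xb i ≤ p.1 → p.1 ≤ xb (i + 1) → p.2 = yb i →
      p ∈ edge u (2 * i - 1) := by
    intro i h1 h2 p h3 h4 h5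
    rw [edge, (hu.bottom_edge h1 h2).1, (hu.bottom_edge h1 h2).2, mem_uIcc_prod]
    simp only
    omega
  have htop : ∀ i, 1 ≤ i → i ≤ m → ∀ p : ℤ × ℤ, xt i ≤ p.1 → p.1 ≤ xt (i + 1) → p.2 = yt i →
      p ∈ edge u (2 * (k + m) + 1 - 2 * i) := by
    intro i h1 h2 p h3 h4 h5
    rw [edge, (hu.top_edge h1 h2).1, (hu.top_edge h1 h2).2, mem_uIcc_prod]
    simp only
    omega
  have hbotv : ∀ i, 1 ≤ i → i < k → ∀ p : ℤ × ℤ, p.1 = xb (i + 1) →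
      min (yb i) (yb (i + 1)) ≤ p.2 → p.2 ≤ max (yb i) (yb (i + 1)) → p ∈ edge u (2 * i) := by
    intro i h1 h2 p h3 h4 h5
    rw [edge, hu.bot _ (by omega) (by omega), hu.bot _ (by omega) (by omega), vert_odd, vert_even,
      mem_uIcc_prod]
    simp only
    omega
  have htopv : ∀ j, 1 ≤ j → j < m → ∀ p : ℤ × ℤ, p.1 = xt (j + 1) →
      min (yt j) (yt (j + 1)) ≤ p.2 → p.2 ≤ max (yt j) (yt (j + 1)) →
      p ∈ edge u (2 * (k + m) - 2 * j) := by
    intro i h1 h2 p h3 h4 h5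
    rw [edge, show 2 * (k + m) - 2 * i + 1 = 2 * (k + m) + 1 - 2 * i by omega,
      show 2 * (k + m) - 2 * i = 2 * (k + m) + 1 - (2 * i + 1) by omega,
      hu.top _ (by omega) (by omega), hu.top _ (by omega) (by omega), vert_odd, vert_even,
      mem_uIcc_prod]
    simp only
    omega
  refine ⟨hk, hm, hxb, hxt, hl, hr, fun i _ _ => rfl, fun i _ _ => rfl, ?_⟩
  -- Induction on `i + j`: the edge that starts further right is replaced by its predecessor in the
  -- chain, which still meets the other edge in the `x`-direction.
  suffices H : ∀ s i j, i + j = s → 1 ≤ i → i ≤ k → 1 ≤ j → j ≤ m → xb i ≤ xt (j + 1) →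
      xt j ≤ xb (i + 1) → yb i < yt j from fun i j => H _ i j rfl
  intro s
  induction s with
  | zero => intro i j; omega
  | succ s ih =>
    intro i j hij h1 h2 h3 h4 h5 h6
    have hbi := hxb i h1 h2
    have htj := hxt j h3 h4
    by_cases hc : xt j ≤ xb i ∧ 1 < i
    · obtain ⟨i, rfl⟩ : ∃ a, i = a + 1 := ⟨i - 1, by omega⟩
      have h7 := hxb i (by omega) (by omega)
      have h8 := ih i j (by omega) (by omega) (by omega) h3 h4 (by omega) hc.1
      by_contra h9
      -- Otherwise the vertical edge between the bottom edges `i` and `i + 1` would pass through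
      -- height `yt j` and hit the top edge `j`.
      exact hs' (2 * i) (by omega) (2 * (k + m) + 1 - 2 * j) (by omega) (by omega) (by omega)
        (by omega) (xb (i + 1), yt j) (hbotv i (by omega) (by omega) _ rfl (by simp only; omega)
        (by simp only; omega)) (htop j h3 h4 _ hc.1 h5 rfl)
    by_cases hc' : xb i ≤ xt j ∧ 1 < j
    · obtain ⟨j, rfl⟩ : ∃ a, j = a + 1 := ⟨j - 1, by omega⟩
      have h7 := hxt j (by omega) (by omega)
      have h8 := ih i j (by omega) h1 h2 (by omega) (by omega) hc'.1 (by omega)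
      by_contra h9
      -- Symmetrically, the vertical edge between two top edges would hit the bottom edge `i`.
      exact hs' (2 * i - 1) (by omega) (2 * (k + m) - 2 * j) (by omega) (by omega) (by omega)
        (by omega) (xt (j + 1), yb i) (hbot i h1 h2 _ hc'.1 h6 rfl)
        (htopv j (by omega) (by omega) _ rfl (by simp only; omega) (by simp only; omega))
    have hi1 : i = 1 := by
      by_contra hi
      have hj : j = 1 := by omega
      subst hj
      have := chain_le hxb le_rfl h1 (by omega)
      omega
    subst hi1
    have hj1 : j = 1 := by
      by_contra hj
      have := chain_le hxt le_rfl h3 (by omega)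
      omega
    subst hj1
    exact hd

namespace Directed

variable {k m : ℕ} {u : ℕ → ℤ × ℤ}

theorem traces (h : Directed k m u) : Traces k m (fun i => (u (2 * i - 1)).1)
    (fun i => (u (2 * i - 1)).2) (fun j => (u (2 * (k + m) + 2 - 2 * j)).1)
    (fun j => (u (2 * (k + m) + 2 - 2 * j)).2) u where
  periodic := h.periodic
  bot q h1 h2 := by
    have hm := h.le_m
    rcases Nat.even_or_odd' q with ⟨a, rfl | rfl⟩
    · rw [vert_even, Prod.ext_iff]
      exact ⟨h.vert a (by omega), (h.bot a (by omega) (by omega)).1.symm⟩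
    · rw [vert_odd]
      rfl
  top q h1 h2 := by
    have hk := h.le_k
    rcases Nat.even_or_odd' q with ⟨a, rfl | rfl⟩
    · rw [vert_even, Prod.ext_iff]
      refine ⟨?_, (h.top a (by omega) (by omega)).1⟩
      have := h.vert (k + m - a) (by omega)
      rw [show 2 * (k + m) + 1 - 2 * a = 2 * (k + m - a) + 1 by omega, ← this]
      simp only
      congr 2; omega
    · rw [vert_odd, Prod.ext_iff]
      simp only
      rw [show 2 * (k + m) + 1 - (2 * a + 1) = 2 * (k + m) + 2 - 2 * (a + 1) by omega]
      exact ⟨rfl, rfl⟩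

/-- A simple closed walk that goes to the right and then to the left is given by a layout. -/
theorem exists_layout (h : Directed k m u)
    (hs : ∀ i < 2 * (k + m), ∀ j < 2 * (k + m), i ≠ j → (i + 1) % (2 * (k + m)) ≠ j →
      (j + 1) % (2 * (k + m)) ≠ i → Disjoint (edge u i) (edge u j))
    (hd : (u 1).2 < (u 0).2) :
    ∃ xb yb xt yt, Traces k m xb yb xt yt u ∧
      Layout k m (fun i => (yb i - yb (i - 1)).sign) (fun i => (yt i - yt (i - 1)).sign) 1 1
        xb yb xt yt := by
  have hk := h.le_k
  have hm := h.le_m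
  refine ⟨_, _, _, _, h.traces, ?_⟩
  have ht := h.traces
  have hxb : ∀ i, 1 ≤ i → i ≤ k → (u (2 * i - 1)).1 < (u (2 * (i + 1) - 1)).1 := by
    intro i h1 h2
    have h3 := (h.bot i h1 h2).2
    have h4 := h.vert i (by omega)
    rw [show 2 * (i + 1) - 1 = 2 * i + 1 by omega]
    omega
  have hxt : ∀ j, 1 ≤ j → j ≤ m →
      (u (2 * (k + m) + 2 - 2 * j)).1 < (u (2 * (k + m) + 2 - 2 * (j + 1))).1 := by
    intro j h1 h2
    have h3 := (h.top j h1 h2).2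
    have h4 := h.vert (k + m - j) (by omega)
    rw [show 2 * (k + m) + 2 - 2 * (j + 1) = 2 * (k + m - j) by omega]
    rw [show 2 * (k + m) + 1 - 2 * j = 2 * (k + m - j) + 1 by omega] at h3
    omega
  have hl : (u (2 * 1 - 1)).1 = (u (2 * (k + m) + 2 - 2 * 1)).1 := by
    have h1 := h.vert 0 (by omega)
    have h2 := h.periodic 0
    rw [zero_add] at h2
    rw [show 2 * (k + m) + 2 - 2 * 1 = 2 * (k + m) by omega, h2]
    exact h1.symm
  have hr : (u (2 * (k + 1) - 1)).1 = (u (2 * (k + m) + 2 - 2 * (m + 1))).1 := by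
    rw [show 2 * (k + m) + 2 - 2 * (m + 1) = 2 * k by omega, h.vert k (by omega)]
    rfl
  have hd' : (u (2 * 1 - 1)).2 < (u (2 * (k + m) + 2 - 2 * 1)).2 := by
    have h2 := h.periodic 0
    rw [zero_add] at h2
    rwa [show 2 * (k + m) + 2 - 2 * 1 = 2 * (k + m) by omega, h2]
  exact ht.layout hk hm hxb hxt hl hr hd' hs

end Directed

/-! ### Turn patterns of monotone polygons -/

/-- The pattern of turns (starting at the end of the left edge) of an `x`-monotone polygon with
`k` horizontal edges in the bottom chain and `m` horizontal edges in the top chain. -/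
structure TurnPattern (k m : ℕ) (t : ℕ → ℤ) : Prop where
  le_k : 1 ≤ k
  le_m : 1 ≤ m
  pm : ∀ i, t i = 1 ∨ t i = -1
  first : t 0 = 1
  last : t (2 * (k + m) - 1) = 1
  right_fst : t (2 * k - 1) = 1
  right_snd : t (2 * k) = 1
  vert : ∀ a, 1 ≤ a → a < k + m → a ≠ k → t (2 * a) = -t (2 * a - 1)

/-- The signs of the vertical edges of the bottom chain. -/
def botSign (t : ℕ → ℤ) (i : ℕ) : ℤ := t (2 * i - 3)

/-- The signs of the vertical edges of the top chain of a polygon with `2 * N` edges. -/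
def topSign (N : ℕ) (t : ℕ → ℤ) (j : ℕ) : ℤ := t (2 * N + 1 - 2 * j)

theorem Layout.congr {k m : ℕ} {f g f' g' : ℕ → ℤ} {i₀ j₀ : ℕ} {xb yb xt yt : ℕ → ℤ}
    (h : Layout k m f g i₀ j₀ xb yb xt yt) (hf : ∀ i, i₀ ≤ i → i < k → f (i + 1) = f' (i + 1))
    (hg : ∀ j, j₀ ≤ j → j < m → g (j + 1) = g' (j + 1)) : Layout k m f' g' i₀ j₀ xb yb xt yt :=
  { h with
    yb_sign := fun i h1 h2 => (h.yb_sign i h1 h2).trans (hf i h1 h2)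
    yt_sign := fun i h1 h2 => (h.yt_sign i h1 h2).trans (hg i h1 h2) }

theorem Layout.congr_turns {k m : ℕ} {f g : ℕ → ℤ} {xb yb xt yt : ℕ → ℤ} {u : ℕ → ℤ × ℤ}
    (h : Layout k m f g 1 1 xb yb xt yt) (hu : Traces k m xb yb xt yt u) :
    Layout k m (botSign (turnSign u)) (topSign (k + m) (turnSign u)) 1 1 xb yb xt yt := by
  refine h.congr (fun i h1 h2 => ?_) (fun j h1 h2 => ?_)
  · rw [← (h.turn_bottom hu h1 h2).1, botSign]
    congr 1
  · rw [← (h.turn_top hu h1 h2).2, topSign]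
    congr 1; omega

/-! ### Edge directions are determined by turns. -/

section Alternate

variable {n : ℕ} {u : ℕ → ℤ × ℤ} (hu : IsPolygon n u)

include hu

theorem IsPolygon.horizontal_of_vertical {i : ℕ} (h : (u i).1 = (u (i + 1)).1) :
    (u (i + 1)).2 = (u (i + 2)).2 ∧ (u (i + 1)).1 ≠ (u (i + 2)).1 ∧ (u i).2 ≠ (u (i + 1)).2 := by
  have h1 := hu.perpendicular i
  have h2 := hu.axisParallel (i + 1)
  rw [cross, h, sub_self, zero_mul, zero_sub, neg_ne_zero, mul_ne_zero_iff] at h1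
  have h3 : (u (i + 1)).1 ≠ (u (i + 2)).1 := fun h3 => h1.2 (by rw [h3, sub_self])
  exact ⟨h2.resolve_left h3, h3, fun h4 => h1.1 (by rw [h4, sub_self])⟩

theorem IsPolygon.vertical_of_horizontal {i : ℕ} (h : (u i).2 = (u (i + 1)).2) :
    (u (i + 1)).1 = (u (i + 2)).1 ∧ (u (i + 1)).2 ≠ (u (i + 2)).2 ∧ (u i).1 ≠ (u (i + 1)).1 := by
  have h1 := hu.perpendicular i
  have h2 := hu.axisParallel (i + 1)
  rw [cross, h, sub_self, zero_mul, sub_zero, mul_ne_zero_iff] at h1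
  have h3 : (u (i + 1)).2 ≠ (u (i + 2)).2 := fun h3 => h1.2 (by rw [h3, sub_self])
  exact ⟨h2.resolve_right h3, h3, fun h4 => h1.1 (by rw [h4, sub_self])⟩

theorem IsPolygon.alternate (h0 : (u 0).1 = (u 1).1) (a : ℕ) :
    (u (2 * a)).1 = (u (2 * a + 1)).1 ∧ (u (2 * a + 1)).2 = (u (2 * a + 2)).2 := by
  induction a with
  | zero => exact ⟨h0, (hu.horizontal_of_vertical h0).1⟩
  | succ a ih =>
    have h1 := (hu.vertical_of_horizontal ih.2).1
    exact ⟨h1, (hu.horizontal_of_vertical h1).1⟩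

/-- Vertical and horizontal edges alternate, so an odd period would make edge `n`, which is edge `0`
again, horizontal. -/
theorem IsPolygon.even (h0 : (u 0).1 = (u 1).1) : Even n := by
  by_contra hn
  obtain ⟨b, rfl⟩ := Nat.not_even_iff_odd.1 hn
  have h1 := (hu.horizontal_of_vertical (hu.alternate h0 b).1).2.1
  have h2 := hu.periodic 0
  have h3 := hu.periodic 1
  rw [zero_add] at h2
  rw [show 1 + (2 * b + 1) = 2 * b + 2 by ring] at h3
  rw [h2, h3] at h1
  exact h1 h0

end Alternate

/-- No monotonicity of `u` is assumed. A downward edge followed by a left turn leads to the right;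
opposite turns at a vertical edge preserve the horizontal direction, and the two left turns at the
right edge reverse it. This is why minimizing over monotone polygons minimizes over all. -/
theorem IsPolygon.directed {k m : ℕ} {u : ℕ → ℤ × ℤ} (hu : IsPolygon (2 * (k + m)) u)
    (h0 : (u 0).1 = (u 1).1) (hd : (u 1).2 < (u 0).2) (ht : TurnPattern k m (turnSign u)) :
    Directed k m u := by
  have halt := hu.alternate h0
  have h1 : ∀ a, turnSign u (2 * a) = -(((u (2 * a + 1)).2 - (u (2 * a)).2).sign *
      ((u (2 * a + 2)).1 - (u (2 * a + 1)).1).sign) := fun a => by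
    rw [turnSign, cross, (halt a).1, sub_self, zero_mul, zero_sub, Int.sign_neg, Int.sign_mul]
  have h2 : ∀ a, turnSign u (2 * a + 1) = ((u (2 * a + 2)).1 - (u (2 * a + 1)).1).sign *
      ((u (2 * a + 3)).2 - (u (2 * a + 2)).2).sign := fun a => by
    rw [turnSign, cross, (halt a).2, sub_self, zero_mul, sub_zero, Int.sign_mul]
  -- Both turns contain the sign of the intermediate vertical edge; in their product it cancels,
  -- leaving minus the product of the two horizontal directions.
  have hstep : ∀ a, ((u (2 * a + 4)).1 - (u (2 * a + 3)).1).sign =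
      -(turnSign u (2 * a + 2) * turnSign u (2 * a + 1)) *
        ((u (2 * a + 2)).1 - (u (2 * a + 1)).1).sign := fun a => by
    have e1 := h1 (a + 1)
    have e2 := h2 a
    have e3 := ht.pm (2 * a + 1)
    have e4 := ht.pm (2 * a + 2)
    rw [show 2 * (a + 1) = 2 * a + 2 by ring] at e1
    rw [e2] at e3
    rw [e1] at e4
    rw [e1, e2]
    simp only [show 2 * a + 2 + 1 = 2 * a + 3 by ring, show 2 * a + 2 + 2 = 2 * a + 4 by ring] at *
    generalize ((u (2 * a + 2)).1 - (u (2 * a + 1)).1).sign = p at *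
    generalize ((u (2 * a + 3)).2 - (u (2 * a + 2)).2).sign = q at *
    generalize ((u (2 * a + 4)).1 - (u (2 * a + 3)).1).sign = r at *
    have e5 : (p * q) * (p * q) = 1 := by rcases e3 with e | e <;> rw [e] <;> rfl
    have e6 : p ^ 2 * q ^ 2 = 1 := by linarith
    calc r = r * (p ^ 2 * q ^ 2) := by rw [e6, mul_one]
      _ = _ := by ring
  have hbot : ∀ a < k, ((u (2 * a + 2)).1 - (u (2 * a + 1)).1).sign = 1 := by
    intro a
    induction a with
    | zero =>
      intro _
      have e1 := h1 0
      rw [mul_zero, ht.first, zero_add, Int.sign_eq_neg_one_of_neg (by linarith)] at e1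
      simpa using e1.symm
    | succ a ih =>
      intro ha
      have e := ht.vert (a + 1) (by omega) (by omega) (by omega)
      rw [show 2 * (a + 1) - 1 = 2 * a + 1 by omega, show 2 * (a + 1) = 2 * a + 2 by ring] at e
      rw [show 2 * (a + 1) + 2 = 2 * a + 4 by ring, show 2 * (a + 1) + 1 = 2 * a + 3 by ring, hstep,
        ih (by omega), e]
      rcases ht.pm (2 * a + 1) with e | e <;> rw [e] <;> rfl
  have htop : ∀ a, k ≤ a → a < k + m → ((u (2 * a + 2)).1 - (u (2 * a + 1)).1).sign = -1 := by
    intro a hka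
    induction a, hka using Nat.le_induction with
    | base =>
      intro _
      obtain ⟨a, rfl⟩ : ∃ a, k = a + 1 := ⟨k - 1, by have := ht.le_k; omega⟩
      have e1 := ht.right_fst
      have e2 := ht.right_snd
      rw [show 2 * (a + 1) - 1 = 2 * a + 1 by omega] at e1
      rw [show 2 * (a + 1) = 2 * a + 2 by ring] at e2
      rw [show 2 * (a + 1) + 2 = 2 * a + 4 by ring, show 2 * (a + 1) + 1 = 2 * a + 3 by ring, hstep,
        hbot a (by omega), e1, e2]
      rfl
    | succ a hka ih =>
      intro ha
      have e := ht.vert (a + 1) (by omega) (by omega) (by omega)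
      rw [show 2 * (a + 1) - 1 = 2 * a + 1 by omega, show 2 * (a + 1) = 2 * a + 2 by ring] at e
      rw [show 2 * (a + 1) + 2 = 2 * a + 4 by ring, show 2 * (a + 1) + 1 = 2 * a + 3 by ring, hstep,
        ih (by omega), e]
      rcases ht.pm (2 * a + 1) with e | e <;> rw [e] <;> rfl
  refine ⟨ht.le_k, ht.le_m, hu.periodic, fun i e1 e2 => ?_, fun j e1 e2 => ?_,
    fun i _ => (halt i).1⟩
  · obtain ⟨a, rfl⟩ : ∃ a, i = a + 1 := ⟨i - 1, by omega⟩
    rw [show 2 * (a + 1) - 1 = 2 * a + 1 by omega, show 2 * (a + 1) = 2 * a + 2 by ring]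
    refine ⟨(halt a).2, ?_⟩
    have := Int.sign_eq_one_iff_pos.1 (hbot a (by omega))
    linarith
  · have e := Int.sign_eq_neg_one_iff_neg.1 (htop (k + m - j) (by omega) (by omega))
    rw [show 2 * (k + m) + 1 - 2 * j = 2 * (k + m - j) + 1 by omega,
      show 2 * (k + m) + 2 - 2 * j = 2 * (k + m - j) + 2 by omega]
    exact ⟨(halt _).2, by linarith⟩

/-- Every polygon with the turns of an `x`-monotone polygon is given by a layout. -/
theorem IsPolygon.exists_layout {k m : ℕ} {w : ℕ → ℤ × ℤ} (hw : IsPolygon (2 * (k + m)) w)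
    (ht : TurnPattern k m (turnSign w)) : ∃ xb yb xt yt,
      Layout k m (botSign (turnSign w)) (topSign (k + m) (turnSign w)) 1 1 xb yb xt yt ∧
        layoutArea k m 1 1 xb yb xt yt = area (2 * (k + m)) w := by
  obtain ⟨u, hu, harea, hc, h0, hd⟩ := hw.exists_down
  have htu : turnSign u = turnSign w := funext fun i => by rw [turnSign, turnSign, hc]
  rw [← htu] at ht ⊢
  obtain ⟨xb, yb, xt, yt, htr, hl⟩ := (hu.directed h0 hd ht).exists_layout hu.simple hd
  exact ⟨xb, yb, xt, yt, hl.congr_turns htr, by rw [← harea, hl.area_eq htr]⟩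

theorem Layout.turnPattern {k m : ℕ} {f g : ℕ → ℤ} {xb yb xt yt : ℕ → ℤ} {u : ℕ → ℤ × ℤ}
    (h : Layout k m f g 1 1 xb yb xt yt) (hu : Traces k m xb yb xt yt u)
    (hpm : ∀ i, turnSign u i = 1 ∨ turnSign u i = -1) : TurnPattern k m (turnSign u) where
  le_k := h.le_k
  le_m := h.le_m
  pm := hpm
  first := (h.turn_left hu).1
  last := (h.turn_left hu).2
  right_fst := (h.turn_right hu).1
  right_snd := (h.turn_right hu).2
  vert a h1 h2 h3 := by
    rcases lt_or_gt_of_ne h3 with h4 | h4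
    · rw [(h.turn_bottom hu h1 h4).1, (h.turn_bottom hu h1 h4).2]
    · have h5 := h.turn_top hu (a := k + m - a) (by omega) (by omega)
      rw [show 2 * (k + m) - 2 * (k + m - a) = 2 * a by omega] at h5
      rw [h5.1, h5.2]

/-- If the left edge pointed up, the mirror image of `u` would be given by a layout and have
positive signed area, contradicting that `u` is counterclockwise. -/
theorem Directed.turnPattern {k m : ℕ} {u : ℕ → ℤ × ℤ} (hd : Directed k m u)
    (hu : IsPolygon (2 * (k + m)) u) : TurnPattern k m (turnSign u) := by
  have hpm : ∀ i, turnSign u i = 1 ∨ turnSign u i = -1 := fun i => by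
    rcases lt_or_gt_of_ne (hu.perpendicular i) with h | h
    · exact Or.inr (Int.sign_eq_neg_one_of_neg h)
    · exact Or.inl (Int.sign_eq_one_of_pos h)
  have h0 : (u 0).1 = (u 1).1 := hd.vert 0 (by have := hd.le_k; omega)
  rcases lt_or_gt_of_ne (hu.horizontal_of_vertical h0).2.2 with h | h
  · exfalso
    let w : ℕ → ℤ × ℤ := fun i => ((u i).1, -(u i).2)
    have hdw : Directed k m w := by
      refine ⟨hd.le_k, hd.le_m, fun i => ?_, fun i h1 h2 => ?_, fun j h1 h2 => ?_, hd.vert⟩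
      · simp only [w, hd.periodic]
      · exact ⟨congrArg Neg.neg (hd.bot i h1 h2).1, (hd.bot i h1 h2).2⟩
      · exact ⟨congrArg Neg.neg (hd.top j h1 h2).1, (hd.top j h1 h2).2⟩
    obtain ⟨xb, yb, xt, yt, htr, hl⟩ := hdw.exists_layout (fun i hi j hj h1 h2 h3 => by
      have := hu.simple i hi j hj h1 h2 h3
      rw [Set.disjoint_left] at this ⊢
      intro p hp hp'
      rw [mem_edge] at hp hp'
      simp only [w] at hp hp'
      refine @this (p.1, -p.2) (mem_edge.2 ?_) (mem_edge.2 ?_) <;> simp only <;> omega)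
      (neg_lt_neg h)
    have h1 := hl.signedArea₂_eq htr
    have h2 := hl.area_pos
    have h3 := hu.ccw
    have h4 : signedArea₂ (2 * (k + m)) w = -signedArea₂ (2 * (k + m)) u := by
      rw [signedArea₂, signedArea₂, ← Finset.sum_neg_distrib]
      refine Finset.sum_congr rfl fun i _ => ?_
      simp only [w]
      ring
    omega
  · obtain ⟨xb, yb, xt, yt, htr, hl⟩ := hd.exists_layout hu.simple h
    exact hl.turnPattern htr hpm

/-- Every `x`-monotone polygon has a turn pattern. -/
theorem IsXMonotone.exists_turnPattern {n : ℕ} {v : ℕ → ℤ × ℤ} (hv : IsPolygon n v)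
    (hm : IsXMonotone n v) : ∃ s k m, n = 2 * (k + m) ∧
      TurnPattern k m (turnSign (shiftWalk s v)) := by
  obtain ⟨s, c, hc, h0, h1, h2⟩ : ∃ s c, c ≤ n ∧ (shiftWalk s v 0).1 = (shiftWalk s v 1).1 ∧
      (∀ i < c, (shiftWalk s v i).1 ≤ (shiftWalk s v (i + 1)).1) ∧
      (∀ i, c ≤ i → i < n → (shiftWalk s v (i + 1)).1 ≤ (shiftWalk s v i).1) := by
    obtain ⟨a, c, hc, h1, h2⟩ := hm
    have hn : 0 < n := by
      by_contra hn
      obtain rfl : n = 0 := by omega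
      exact absurd hv.ccw (by simp [signedArea₂])
    rcases hv.axisParallel a with h0 | h0
    · refine ⟨a, c, hc, ?_, fun i hi => ?_, fun i hi hi' => ?_⟩
      · simp only [shiftWalk, zero_add, add_comm 1 a, h0]
      · simpa only [shiftWalk, add_comm _ a, ← add_assoc] using h1 i hi
      · simpa only [shiftWalk, add_comm _ a, ← add_assoc] using h2 i hi hi'
    · have e : ∀ i, shiftWalk (a + (n - 1)) v (i + 1) = v (a + i) := fun i => by
        rw [← hv.periodic (a + i), shiftWalk]
        congr 1; omega
      have h3 := (hv.vertical_of_horizontal h0).2.2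
      have h4 : (shiftWalk (a + (n - 1)) v 0).1 = (shiftWalk (a + (n - 1)) v 1).1 := by
        refine ((hv.shiftWalk _).axisParallel 0).resolve_right fun h4 => ?_
        have h5 := ((hv.shiftWalk (a + (n - 1))).vertical_of_horizontal h4).1
        rw [e 0, e 1] at h5
        exact h3 h5
      -- Starting one edge earlier puts a vertical edge in front of the rightward chain, which may
      -- already consist of all `n` edges.
      refine ⟨a + (n - 1), min (c + 1) n, min_le_right _ _, h4, fun i hi => ?_, fun i hi hi' => ?_⟩
      · rcases Nat.eq_zero_or_pos i with rfl | h5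
        · exact h4.le
        · obtain ⟨i, rfl⟩ : ∃ j, i = j + 1 := ⟨i - 1, by omega⟩
          rw [e, e]
          exact h1 i (by omega)
      · obtain ⟨i, rfl⟩ : ∃ j, i = j + 1 := ⟨i - 1, by omega⟩
        rw [e, e]
        exact h2 i (by omega) (by omega)
  have hu := hv.shiftWalk s
  refine ⟨s, ?_⟩
  generalize shiftWalk s v = u at *
  have halt := hu.alternate h0
  obtain ⟨N, hN⟩ := even_iff_two_dvd.1 (hu.even h0)
  subst hN
  have hsum := Finset.sum_range_sub (fun i => (u i).1) (2 * N)
  rw [← zero_add (2 * N), hu.periodic 0, sub_self, zero_add] at hsum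
  have hne : ∀ a, (u (2 * a + 1)).1 ≠ (u (2 * a + 2)).1 := fun a =>
    (hu.horizontal_of_vertical (halt a).1).2.1
  have hNpos : 0 < N := by
    by_contra hn
    obtain rfl : N = 0 := by omega
    exact absurd hu.ccw (by simp [signedArea₂])
  -- The horizontal displacements of a closed walk sum to zero, so there is at least one edge to the
  -- right and, in the next step, one to the left.
  have hk : 1 ≤ c / 2 := by
    by_contra hk
    have : ∑ i ∈ Finset.range (2 * N), ((u (i + 1)).1 - (u i).1) < ∑ i ∈ Finset.range (2 * N), 0 := by
      refine Finset.sum_lt_sum (fun i hi => ?_) ⟨1, Finset.mem_range.2 (by omega), ?_⟩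
      · rw [Finset.mem_range] at hi
        rcases Nat.eq_zero_or_pos i with rfl | h5
        · simp [h0]
        · have := h2 i (by omega) hi
          omega
      · have e1 := h2 1 (by omega) (by omega)
        have e2 := hne 0
        simp only [mul_zero, zero_add, Nat.reduceAdd] at *
        omega
    simp only [Finset.sum_const_zero] at this
    omega
  have hm' : c / 2 < N := by
    by_contra hk
    have : ∑ i ∈ Finset.range (2 * N), 0 < ∑ i ∈ Finset.range (2 * N), ((u (i + 1)).1 - (u i).1) := by
      refine Finset.sum_lt_sum (fun i hi => ?_) ⟨1, Finset.mem_range.2 (by omega), ?_⟩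
      · rw [Finset.mem_range] at hi
        have := h1 i (by omega)
        omega
      · have e1 := h1 1 (by omega)
        have e2 := hne 0
        simp only [mul_zero, zero_add, Nat.reduceAdd] at *
        omega
    simp only [Finset.sum_const_zero] at this
    omega
  -- Horizontal edges have odd positions, so `c / 2` of the first `c` edges are horizontal.
  refine ⟨c / 2, N - c / 2, by omega, ?_⟩
  have hN' : c / 2 + (N - c / 2) = N := by omega
  refine Directed.turnPattern ⟨hk, by omega, by rw [hN']; exact hu.periodic, fun i e1 e2 => ?_,
    fun j e1 e2 => ?_, fun i _ => (halt i).1⟩ (by rw [hN']; exact hu)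
  · obtain ⟨a, rfl⟩ : ∃ a, i = a + 1 := ⟨i - 1, by omega⟩
    rw [show 2 * (a + 1) - 1 = 2 * a + 1 by omega, show 2 * (a + 1) = 2 * a + 2 by ring]
    refine ⟨(halt a).2, lt_of_le_of_ne (h1 _ (by omega)) (hne a)⟩
  · rw [hN', show 2 * N + 1 - 2 * j = 2 * (N - j) + 1 by omega,
      show 2 * N + 2 - 2 * j = 2 * (N - j) + 2 by omega]
    refine ⟨(halt _).2, lt_of_le_of_ne (h2 _ (by omega) (by omega)) (hne _).symm⟩

/-! ### The dynamic program -/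

/-- A column of height `h` can be followed by a column of height `h'`, if the bottom boundary moves
in direction `du` and the top boundary moves in direction `dt`. -/
def Valid (du dt h h' : ℤ) : Prop :=
  -- If the directions differ, the height must change by at least `|dt - du|` in the direction of
  -- `dt - du`. If both boundaries move the same way, both heights must be at least `2`, since the
  -- old and the new column overlap in a nonempty interval.
  (dt - du) * (dt - du) ≤ (dt - du) * (h' - h) ∧ du * dt < h ∧ du * dt < h'

theorem sign_cases (a : ℤ) : (a < 0 ∧ a.sign = -1) ∨ (a = 0 ∧ a.sign = 0) ∨ (0 < a ∧ a.sign = 1) := by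
  rcases lt_trichotomy a 0 with h | rfl | h
  · exact Or.inl ⟨h, Int.sign_eq_neg_one_of_neg h⟩
  · exact Or.inr (Or.inl ⟨rfl, rfl⟩)
  · exact Or.inr (Or.inr ⟨h, Int.sign_eq_one_of_pos h⟩)

/-- Necessity of `Valid`: the four inequalities say that the old and new columns are nonempty and
that neither boundary reaches the other at their common vertical line. -/
theorem valid_of_lt {b t b' t' : ℤ} (h1 : b < t) (h2 : b < t') (h3 : b' < t) (h4 : b' < t') :
    Valid (b' - b).sign (t' - t).sign (t - b) (t' - b') := by
  rcases sign_cases (b' - b) with ⟨h5, h6⟩ | ⟨h5, h6⟩ | ⟨h5, h6⟩ <;>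
  rcases sign_cases (t' - t) with ⟨h7, h8⟩ | ⟨h7, h8⟩ | ⟨h7, h8⟩ <;>
  rw [h6, h8] <;> refine ⟨?_, ?_, ?_⟩ <;> omega

/-- A column-by-column description of the part of a polygon up to a column of height `h` that is
bounded by the bottom edge `i` and the top edge `j`.  All columns have heights in `V`, their total
area is `c`. -/
inductive Path (f g : ℕ → ℤ) (V : Set ℤ) : ℕ → ℕ → ℤ → ℤ → Prop
  | start (h : ℤ) (hV : h ∈ V) (hpos : 0 < h) : Path f g V 1 1 h h
  | step (i j di dj : ℕ) (h h' c : ℤ) (hi : di ≤ 1) (hj : dj ≤ 1) (hij : 0 < di + dj)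
      (hp : Path f g V i j h c) (hv : Valid (di * f (i + di)) (dj * g (j + dj)) h h')
      (hV : h' ∈ V) (hpos : 0 < h') : Path f g V (i + di) (j + dj) h' (c + h')

/-! ### Bounding the heights of columns. -/

section Path

variable {f g : ℕ → ℤ} {i j : ℕ} {h c : ℤ}

theorem Path.mono {V W : Set ℤ} (hVW : V ⊆ W) (hp : Path f g V i j h c) : Path f g W i j h c := by
  induction hp with
  | start h hV hpos => exact .start h (hVW hV) hpos
  | step i j di dj h h' c hi hj hij _ hv hV hpos ih =>
    exact .step i j di dj h h' c hi hj hij ih hv (hVW hV) hpos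

/-- Every step adds at most one height and increases `i + j` by at least one. -/
theorem Path.exists_finset {V : Set ℤ} (hp : Path f g V i j h c) :
    ∃ W : Finset ℤ, h ∈ W ∧ W.card + 1 ≤ i + j ∧ Path f g W i j h c := by
  classical
  induction hp with
  | start h hV hpos => exact ⟨{h}, by simp, by simp, .start h (by simp) hpos⟩
  | step i j di dj h h' c hi hj hij _ hv hV hpos ih =>
    obtain ⟨W, h1, h2, h3⟩ := ih
    refine ⟨insert h' W, by simp, ?_, .step i j di dj h h' c hi hj hij
      (h3.mono (by simp)) hv (by simp) hpos⟩
    have := Finset.card_insert_le h' W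
    omega

/-- Cap the height `v` by twice its rank among the heights in `V`. -/
def capHeight (V : Finset ℤ) (v : ℤ) : ℤ := min v (2 * (V.filter (· ≤ v)).card)

theorem capHeight_rank {V : Finset ℤ} {v w : ℤ} (hv : v ∈ V) (hwv : w < v) :
    (V.filter (· ≤ w)).card < (V.filter (· ≤ v)).card := by
  refine Finset.card_lt_card (Finset.ssubset_iff_subset_ne.2 ⟨fun x hx => ?_, fun he => ?_⟩)
  · rw [Finset.mem_filter] at hx ⊢
    exact ⟨hx.1, hx.2.trans hwv.le⟩
  · have : v ∈ V.filter (· ≤ w) := by rw [he]; simp [hv]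
    rw [Finset.mem_filter] at this
    omega

/-- `Valid` only asks for height differences of at most `2` and for heights of at least `2`.
Distinct ranks differ by at least `1` and are positive, so doubled ranks meet these demands, and so
does the minimum with the original heights. -/
theorem Valid.capHeight {V : Finset ℤ} {du dt h h' : ℤ} (hv : Valid du dt h h') (hh : h ∈ V)
    (hh' : h' ∈ V) (hu : du = -1 ∨ du = 0 ∨ du = 1) (ht : dt = -1 ∨ dt = 0 ∨ dt = 1) :
    Valid du dt (capHeight V h) (capHeight V h') := by
  have h1 : 0 < (V.filter (· ≤ h)).card := Finset.card_pos.2 ⟨h, by simp [hh]⟩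
  have h2 : 0 < (V.filter (· ≤ h')).card := Finset.card_pos.2 ⟨h', by simp [hh']⟩
  have h3 : h < h' → (V.filter (· ≤ h)).card < (V.filter (· ≤ h')).card := capHeight_rank hh'
  have h4 : h' < h → (V.filter (· ≤ h')).card < (V.filter (· ≤ h)).card := capHeight_rank hh
  simp only [RectPoly.capHeight]
  generalize (V.filter (· ≤ h)).card = r at *
  generalize (V.filter (· ≤ h')).card = r' at *
  obtain ⟨hv1, hv2, hv3⟩ := hv
  rcases hu with rfl | rfl | rfl <;> rcases ht with rfl | rfl | rfl <;>
    refine ⟨?_, ?_, ?_⟩ <;> omega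

theorem Path.capHeight {V : Finset ℤ} (hp : Path f g V i j h c) (hf : ∀ i, f i = 1 ∨ f i = -1)
    (hg : ∀ i, g i = 1 ∨ g i = -1) :
    ∃ c' ≤ c, Path f g (Set.Icc 1 (2 * V.card : ℤ)) i j (capHeight V h) c' ∧ h ∈ V := by
  have key : ∀ h ∈ V, 0 < h → RectPoly.capHeight V h ∈ Set.Icc 1 (2 * V.card : ℤ) ∧
      0 < RectPoly.capHeight V h ∧ RectPoly.capHeight V h ≤ h := by
    intro h hV hpos
    have h1 : 0 < (V.filter (· ≤ h)).card := Finset.card_pos.2 ⟨h, by simp [hV]⟩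
    have h2 : (V.filter (· ≤ h)).card ≤ V.card := Finset.card_filter_le _ _
    rw [Set.mem_Icc, RectPoly.capHeight]
    omega
  have hs : ∀ (d : ℕ) (e : ℤ), d ≤ 1 → (e = 1 ∨ e = -1) → (d * e = -1 ∨ d * e = 0 ∨ d * e = 1) := by
    intro d e hd he
    interval_cases d <;> rcases he with rfl | rfl <;> simp
  induction hp with
  | start h hV hpos =>
    obtain ⟨h1, h2, h3⟩ := key h hV hpos
    exact ⟨_, h3, .start _ h1 h2, hV⟩
  | step i j di dj h h' c hi hj hij _ hv hV hpos ih =>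
    obtain ⟨c', h1, h2, h3⟩ := ih
    obtain ⟨h4, h5, h6⟩ := key h' hV hpos
    exact ⟨_, add_le_add h1 h6, .step i j di dj _ _ _ hi hj hij h2
      (hv.capHeight h3 hV (hs _ _ hi (hf _)) (hs _ _ hj (hg _))) h4 h5, hV⟩

/-- Heights can be bounded without increasing the area. -/
theorem Path.exists_bounded {V : Set ℤ} {n : ℕ} (hp : Path f g V i j h c)
    (hf : ∀ i, f i = 1 ∨ f i = -1) (hg : ∀ i, g i = 1 ∨ g i = -1) (hn : 2 * (i + j) ≤ n + 2) :
    ∃ h' c', c' ≤ c ∧ Path f g (Set.Icc 1 (n : ℤ)) i j h' c' := by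
  obtain ⟨W, -, h1, h2⟩ := hp.exists_finset
  obtain ⟨c', h3, h4, -⟩ := h2.capHeight hf hg
  exact ⟨_, c', h3, h4.mono (Set.Icc_subset_Icc_right (by omega))⟩

/-- There are at most `i + j - 1` columns, each of height at most `n`. -/
theorem Path.cost_le {n : ℕ} (hp : Path f g (Set.Icc 1 (n : ℤ)) i j h c) :
    c + n ≤ (i + j : ℕ) * n ∧ h ∈ Set.Icc 1 (n : ℤ) ∧ 1 ≤ i ∧ 1 ≤ j := by
  induction hp with
  | start h hV hpos =>
    refine ⟨?_, hV, le_rfl, le_rfl⟩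
    rw [Set.mem_Icc] at hV
    push_cast
    linarith
  | step i j di dj h h' c hi hj hij _ hv hV hpos ih =>
    refine ⟨?_, hV, by omega, by omega⟩
    rw [Set.mem_Icc] at hV
    have h1 : ((i + j + 1 : ℕ) : ℤ) * n ≤ ((i + di + (j + dj) : ℕ) : ℤ) * n :=
      mul_le_mul_of_nonneg_right (by exact_mod_cast (by omega)) (by positivity)
    push_cast at h1 ih ⊢
    linarith

end Path

theorem sum_Ico_add_one {F : ℤ → ℤ} {a b : ℤ} (h : a ≤ b) :
    ∑ z ∈ Finset.Ico a (b + 1), F z = ∑ z ∈ Finset.Ico a b, F z + F b := by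
  have : Finset.Ico a (b + 1) = insert b (Finset.Ico a b) := by
    ext x; simp only [Finset.mem_insert, Finset.mem_Ico]; omega
  rw [this, Finset.sum_insert (by simp), add_comm]

theorem next_column {k : ℕ} {x : ℕ → ℤ} {z : ℤ} {i : ℕ}
    (hx : ∀ i, 1 ≤ i → i ≤ k → x i < x (i + 1)) (h2 : i ≤ k) (h3 : x i ≤ z)
    (h4 : z < x (i + 1)) (h5 : z + 1 < x (k + 1)) : ∃ d ≤ 1, i + d ≤ k ∧ x (i + d) ≤ z + 1 ∧
      z + 1 < x (i + d + 1) ∧ (d = 1 → x (i + d) = z + 1) := by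
  by_cases h : z + 1 < x (i + 1)
  · exact ⟨0, by omega, by omega, by simp only [add_zero]; omega, h,
      by omega⟩
  · have h6 : x (i + 1) = z + 1 := by omega
    rcases h2.eq_or_lt with rfl | h7
    · omega
    · refine ⟨1, le_rfl, h7, h6.le, ?_, fun _ => h6⟩
      rw [← h6]
      exact hx _ (by omega) h7

/-- The columns of a polygon form a path. -/
theorem Layout.exists_path {k m : ℕ} {f g : ℕ → ℤ} {xb yb xt yt : ℕ → ℤ}
    (h : Layout k m f g 1 1 xb yb xt yt) :
    ∃ H c, c ≤ layoutArea k m 1 1 xb yb xt yt ∧ Path f g Set.univ k m H c := by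
  -- Sweep over unit columns from left to right. The cost is only bounded by the area because
  -- columns that repeat the previous pair of edges are dropped.
  have key : ∀ z, xb 1 ≤ z → z < xb (k + 1) → ∃ i j, (1 ≤ i ∧ i ≤ k ∧ xb i ≤ z ∧ z < xb (i + 1)) ∧
      (1 ≤ j ∧ j ≤ m ∧ xt j ≤ z ∧ z < xt (j + 1)) ∧
      ∃ c, c ≤ ∑ w ∈ Finset.Ico (xb 1) (z + 1), (col m xt yt w - col k xb yb w) ∧
        Path f g Set.univ i j (yt j - yb i) c := by
    intro z hz
    induction z, hz using Int.leInduction with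
    | base =>
      intro _
      have h1 := h.xb_lt 1 le_rfl h.le_k
      have h2 := h.xt_lt 1 le_rfl h.le_m
      have h3 := h.left
      have h4 := h.below_left
      refine ⟨1, 1, ⟨le_rfl, h.le_k, le_rfl, h1⟩, ⟨le_rfl, h.le_m, h3.ge, by omega⟩, _, ?_,
        .start _ trivial (by omega)⟩
      rw [sum_Ico_add_one le_rfl, Finset.Ico_self, Finset.sum_empty, zero_add, col, col,
        sum_col_eq h.xb_lt le_rfl h.le_k le_rfl h1,
        sum_col_eq h.xt_lt le_rfl h.le_m h3.ge (by omega)]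
    | succ z hz ih =>
      intro hzr
      obtain ⟨i, j, ⟨hi1, hi2, hi3, hi4⟩, ⟨hj1, hj2, hj3, hj4⟩, c, hc, hp⟩ := ih (by omega)
      have hr := h.right
      obtain ⟨di, di1, di2, di3, di4, di5⟩ := next_column h.xb_lt hi2 hi3 hi4 hzr
      obtain ⟨dj, dj1, dj2, dj3, dj4, dj5⟩ := next_column h.xt_lt hj2 hj3 hj4 (by omega)
      have b4 := h.below (i + di) (j + dj) (by omega) di2 (by omega) dj2 (by omega) (by omega)
      refine ⟨i + di, j + dj, ⟨by omega, di2, di3, di4⟩, ⟨by omega, dj2, dj3, dj4⟩, ?_⟩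
      rw [sum_Ico_add_one (by omega), col, col, sum_col_eq h.xb_lt (by omega) di2 di3 di4,
        sum_col_eq h.xt_lt (by omega) dj2 dj3 dj4]
      by_cases hd : di = 0 ∧ dj = 0
      · obtain ⟨rfl, rfl⟩ := hd
        simp only [add_zero] at *
        exact ⟨c, by linarith, hp⟩
      -- The pairs of old and new edges meet at the vertical line between the columns. Here it
      -- matters that `below` covers edges whose `x`-intervals share only an endpoint.
      · have b1 := h.below i j (by omega) (by omega) (by omega) (by omega) (by omega) (by omega)
        have b2 := h.below i (j + dj) (by omega) (by omega) (by omega) dj2 (by omega) (by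
          rcases (show dj = 0 ∨ dj = 1 by omega) with rfl | rfl
          · simp only [add_zero]; omega
          · have := dj5 rfl
            rcases (show di = 0 ∨ di = 1 by omega) with rfl | rfl
            · simp only [add_zero] at di4; omega
            · have := di5 rfl; omega)
        have b3 := h.below (i + di) j (by omega) di2 (by omega) (by omega) (by
          rcases (show di = 0 ∨ di = 1 by omega) with rfl | rfl
          · simp only [add_zero]; omega
          · have := di5 rfl
            rcases (show dj = 0 ∨ dj = 1 by omega) with rfl | rfl
            · simp only [add_zero] at dj4; omega
            · have := dj5 rfl; omega) (by omega)
        refine ⟨c + (yt (j + dj) - yb (i + di)), by linarith,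
          .step i j di dj _ _ c di1 dj1 (by omega) hp ?_ trivial (by omega)⟩
        have hv := valid_of_lt b1 b2 b3 b4
        have e1 : (yb (i + di) - yb i).sign = di * f (i + di) := by
          rcases (show di = 0 ∨ di = 1 by omega) with rfl | rfl
          · simp
          · rw [h.yb_sign i hi1 (by omega)]; simp
        have e2 : (yt (j + dj) - yt j).sign = dj * g (j + dj) := by
          rcases (show dj = 0 ∨ dj = 1 by omega) with rfl | rfl
          · simp
          · rw [h.yt_sign j hj1 (by omega)]; simp
        rwa [e1, e2] at hv
  have hlr := chain_lt h.xb_lt le_rfl (show 1 < k + 1 by have := h.le_k; omega) le_rfl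
  obtain ⟨i, j, ⟨hi1, hi2, hi3, hi4⟩, ⟨hj1, hj2, hj3, hj4⟩, c, hc, hp⟩ :=
    key (xb (k + 1) - 1) (by omega) (by omega)
  have hik : i = k := by
    by_contra hne
    have := chain_lt h.xb_lt (i := i + 1) (j := k + 1) (by omega) (by omega) le_rfl
    omega
  have hjm : j = m := by
    by_contra hne
    have := chain_lt h.xt_lt (i := j + 1) (j := m + 1) (by omega) (by omega) le_rfl
    have := h.right
    omega
  subst hik hjm
  rw [sub_add_cancel, h.sum_heights] at hc
  exact ⟨_, c, hc, hp⟩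

/-- `b` is the value of the state `(i, j, h)` in the dynamic program, computed from the values `G`
of the previous states: the largest possible difference of `n ^ 2` and the area of the columns up to
a column of height `h` at the bottom edge `i` and the top edge `j`, or `0` if there is none. -/
structure IsBest (n : ℕ) (f g : ℕ → ℤ) (G : ℕ → ℕ → ℕ → ℤ) (i j h : ℕ) (b : ℤ) : Prop where
  nonneg : 0 ≤ b
  start_le : i = 1 → j = 1 → (n : ℤ) * n - h ≤ b
  step_le : ∀ di dj h' : ℕ, di ≤ 1 → dj ≤ 1 → 0 < di + dj → 1 ≤ h' → h' ≤ n →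
    Valid (di * f i) (dj * g j) h' h → G (i - di) (j - dj) h' - h ≤ b
  attained : 0 < b → (i = 1 ∧ j = 1 ∧ b = n * n - h) ∨ ∃ di dj h' : ℕ, di ≤ 1 ∧ dj ≤ 1 ∧
    0 < di + dj ∧ 1 ≤ h' ∧ h' ≤ n ∧ Valid (di * f i) (dj * g j) h' h ∧
      b = G (i - di) (j - dj) h' - h

/-- Applied in both directions this gives uniqueness of the value of a state, so a recomputation
during the reconstruction finds the value stored in the table. -/
theorem IsBest.le {n : ℕ} {f g : ℕ → ℤ} {G : ℕ → ℕ → ℕ → ℤ} {i j h : ℕ} {b b' : ℤ}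
    (hb : IsBest n f g G i j h b) (hb' : IsBest n f g G i j h b') : b ≤ b' := by
  rcases hb.nonneg.eq_or_lt with h0 | h0
  · rw [← h0]; exact hb'.nonneg
  · rcases hb.attained h0 with ⟨h1, h2, h3⟩ | ⟨di, dj, h', h1, h2, h3, h4, h5, h6, h7⟩
    · rw [h3]; exact hb'.start_le h1 h2
    · rw [h7]; exact hb'.step_le di dj h' h1 h2 h3 h4 h5 h6

/-- The completed table of the dynamic program. -/
structure IsTable (n k m : ℕ) (f g : ℕ → ℤ) (G : ℕ → ℕ → ℕ → ℤ) : Prop where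
  zero_left : ∀ j h, j ≤ m → 1 ≤ h → h ≤ n → G 0 j h = 0
  zero_right : ∀ i h, i ≤ k → 1 ≤ h → h ≤ n → G i 0 h = 0
  best : ∀ i j h, 1 ≤ i → i ≤ k → 1 ≤ j → j ≤ m → 1 ≤ h → h ≤ n → IsBest n f g G i j h (G i j h)

/-- By induction along the path, the table does at least as well as any path of bounded heights:
each step is one of the candidates of the recursion. -/
theorem IsTable.le_of_path {n k m : ℕ} {f g : ℕ → ℤ} {G : ℕ → ℕ → ℕ → ℤ}
    (hG : IsTable n k m f g G) {i j : ℕ} {h c : ℤ} (hp : Path f g (Set.Icc 1 (n : ℤ)) i j h c)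
    (hi : i ≤ k) (hj : j ≤ m) : ∃ H : ℕ, (H : ℤ) = h ∧ (n : ℤ) * n - c ≤ G i j H := by
  induction hp with
  | start h hV hpos =>
    rw [Set.mem_Icc] at hV
    lift h to ℕ using hpos.le
    exact ⟨h, rfl, (hG.best 1 1 h le_rfl hi le_rfl hj (by omega) (by omega)).start_le rfl rfl⟩
  | step i j di dj h h' c hi1 hj1 hij hp hv hV hpos ih =>
    obtain ⟨H, rfl, hH⟩ := ih (by omega) (by omega)
    obtain ⟨-, hV', hi0, hj0⟩ := hp.cost_le
    rw [Set.mem_Icc] at hV hV'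
    lift h' to ℕ using hpos.le
    have h1 := (hG.best (i + di) (j + dj) h' (by omega) hi (by omega) hj (by omega)
      (by omega)).step_le di dj H hi1 hj1 hij (by omega) (by omega) hv
    rw [Nat.add_sub_cancel, Nat.add_sub_cancel] at h1
    exact ⟨h', rfl, by linarith⟩

/-- The change of the bottom height from a column of height `h` to one of height `h'`. -/
def bottomStep (du dt h h' : ℤ) : ℤ :=
  -- If both boundaries rise, the new bottom is put one below the old top; if both fall, the new top
  -- is put one above the old bottom. If the bottom moves and the directions differ, the top moves
  -- by exactly `dt`.
  if 0 < du * du then (if 0 < du * dt then (if 0 < du then h - 1 else 1 - h') else h - h' + dt)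
  else 0

/-- Sufficiency of `Valid`: the chosen displacement has the prescribed signs and keeps each boundary
clear of the other. It depends only on the two heights and directions, so states need not record
absolute positions. -/
theorem bottomStep_spec {du dt h h' : ℤ} (hu : du = -1 ∨ du = 0 ∨ du = 1)
    (ht : dt = -1 ∨ dt = 0 ∨ dt = 1) (h0 : 0 < h) (h0' : 0 < h') (hne : du ≠ 0 ∨ dt ≠ 0)
    (hv : Valid du dt h h') :
    (bottomStep du dt h h').sign = du ∧ (bottomStep du dt h h' + h' - h).sign = dt ∧
      bottomStep du dt h h' < h ∧ -bottomStep du dt h h' < h' := by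
  obtain ⟨h1, h2, h3⟩ := hv
  have hB : (du = 0 → bottomStep du dt h h' = 0) ∧
      (du = dt → du = 1 → bottomStep du dt h h' = h - 1) ∧
      (du = dt → du = -1 → bottomStep du dt h h' = 1 - h') ∧
      (du ≠ 0 → du ≠ dt → bottomStep du dt h h' = h - h' + dt) := by
    clear h1 h2 h3
    rcases hu with rfl | rfl | rfl <;> rcases ht with rfl | rfl | rfl <;> norm_num [bottomStep]
  generalize bottomStep du dt h h' = B at *
  rcases sign_cases B with ⟨h5, h6⟩ | ⟨h5, h6⟩ | ⟨h5, h6⟩ <;>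
  rcases sign_cases (B + h' - h) with ⟨h7, h8⟩ | ⟨h7, h8⟩ | ⟨h7, h8⟩ <;>
  rw [h6, h8] <;> clear h6 h8 <;>
  rcases hu with rfl | rfl | rfl <;> rcases ht with rfl | rfl | rfl <;> omega

/-- A unit-width column either lengthens the first edge (`d = 0`) or adds a new one (`d = 1`); both
add `b` to the weighted sum. -/
theorem chain_sum_extend {x y : ℕ → ℤ} {i k d : ℕ} {b z : ℤ} (hk : i + d ≤ k) (hd : d ≤ 1)
    (hz : x (i + d) = z) (hb : d = 0 → b = y i) :
    ∑ a ∈ Finset.Ico i (k + 1), Function.update y i b a *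
      (Function.update x i (z - 1) (a + 1) - Function.update x i (z - 1) a) =
    ∑ a ∈ Finset.Ico (i + d) (k + 1), y a * (x (a + 1) - x a) + b := by
  have h1 : ∑ a ∈ Finset.Ico (i + 1) (k + 1), Function.update y i b a *
      (Function.update x i (z - 1) (a + 1) - Function.update x i (z - 1) a) =
      ∑ a ∈ Finset.Ico (i + 1) (k + 1), y a * (x (a + 1) - x a) := by
    refine Finset.sum_congr rfl fun a ha => ?_
    rw [Finset.mem_Ico] at ha
    rw [Function.update_of_ne (by omega), Function.update_of_ne (by omega),
      Function.update_of_ne (by omega)]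
  rw [Finset.sum_eq_sum_Ico_succ_bot (by omega), h1, Function.update_self, Function.update_self,
    Function.update_of_ne (by omega)]
  rcases (show d = 0 ∨ d = 1 by omega) with rfl | rfl
  · rw [add_zero, Finset.sum_eq_sum_Ico_succ_bot (show i < k + 1 by omega), hb rfl, ← hz, add_zero]
    ring
  · rw [hz]
    ring

/-- A layout is extended by a column to the left. -/
theorem Layout.extend {k m : ℕ} {f g : ℕ → ℤ} {i j di dj : ℕ} {xb yb xt yt : ℕ → ℤ} {z b t : ℤ}
    (h : Layout k m f g (i + di) (j + dj) xb yb xt yt) (hdi : di ≤ 1) (hdj : dj ≤ 1)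
    (hz : xb (i + di) = z) (hbt : b < t) (hb : b < yt (j + dj)) (ht : yb (i + di) < t)
    (hsb : (yb (i + di) - b).sign = di * f (i + di))
    (hst : (yt (j + dj) - t).sign = dj * g (j + dj)) :
    Layout k m f g i j (Function.update xb i (z - 1)) (Function.update yb i b)
        (Function.update xt j (z - 1)) (Function.update yt j t) ∧
      layoutArea k m i j (Function.update xb i (z - 1)) (Function.update yb i b)
        (Function.update xt j (z - 1)) (Function.update yt j t) =
      layoutArea k m (i + di) (j + dj) xb yb xt yt + (t - b) := by
  have hk := h.le_k
  have hm := h.le_m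
  have hz' : xt (j + dj) = z := h.left.symm.trans hz
  have hb0 : di = 0 → b = yb i := by
    rintro rfl
    simp only [Nat.cast_zero, zero_mul, add_zero, Int.sign_eq_zero_iff_zero] at hsb
    omega
  have ht0 : dj = 0 → t = yt j := by
    rintro rfl
    simp only [Nat.cast_zero, zero_mul, add_zero, Int.sign_eq_zero_iff_zero] at hst
    omega
  constructor
  · have hxb : z - 1 < xb (i + 1) ∧ xb (i + 1) ≤ xb (i + di + 1) := by
      have := h.xb_lt _ le_rfl hk
      -- For `di = 0` the edge `i` is lengthened to the left; for `di = 1` a new edge `i` ends where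
      -- edge `i + 1` starts.
      rcases (show di = 0 ∨ di = 1 by omega) with rfl | rfl
      · rw [add_zero] at *; omega
      · omega
    have hxt : z - 1 < xt (j + 1) := by
      have := h.xt_lt _ le_rfl hm
      rcases (show dj = 0 ∨ dj = 1 by omega) with rfl | rfl
      · rw [add_zero] at *; omega
      · omega
    refine ⟨by omega, by omega, fun a h1 h2 => ?_, fun a h1 h2 => ?_, ?_, ?_, fun a h1 h2 => ?_,
      fun a h1 h2 => ?_, fun a c h1 h2 h3 h4 h5 h6 => ?_⟩
    · rw [Function.update_of_ne (show a + 1 ≠ i by omega)]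
      rcases h1.eq_or_lt with rfl | h1
      · rw [Function.update_self]; exact hxb.1
      · rw [Function.update_of_ne (by omega)]; exact h.xb_lt a (by omega) h2
    · rw [Function.update_of_ne (show a + 1 ≠ j by omega)]
      rcases h1.eq_or_lt with rfl | h1
      · rw [Function.update_self]; exact hxt
      · rw [Function.update_of_ne (by omega)]; exact h.xt_lt a (by omega) h2
    · rw [Function.update_self, Function.update_self]
    · rw [Function.update_of_ne (by omega), Function.update_of_ne (by omega), h.right]
    · rw [Function.update_of_ne (show a + 1 ≠ i by omega)]
      rcases h1.eq_or_lt with rfl | h1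
      · rw [Function.update_self]
        rcases (show di = 0 ∨ di = 1 by omega) with rfl | rfl
        · rw [hb0 rfl]; exact h.yb_sign i le_rfl h2
        · rw [hsb]; simp
      · rw [Function.update_of_ne (by omega)]; exact h.yb_sign a (by omega) h2
    · rw [Function.update_of_ne (show a + 1 ≠ j by omega)]
      rcases h1.eq_or_lt with rfl | h1
      · rw [Function.update_self]
        rcases (show dj = 0 ∨ dj = 1 by omega) with rfl | rfl
        · rw [ht0 rfl]; exact h.yt_sign j le_rfl h2
        · rw [hst]; simp
      · rw [Function.update_of_ne (by omega)]; exact h.yt_sign a (by omega) h2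
    · rw [Function.update_of_ne (show c + 1 ≠ j by omega)] at h5
      rw [Function.update_of_ne (show a + 1 ≠ i by omega)] at h6
      rcases h1.eq_or_lt with rfl | h1
      · rw [Function.update_self]
        rcases h3.eq_or_lt with rfl | h3
        · rwa [Function.update_self]
        · rw [Function.update_of_ne (by omega)] at h6 ⊢
          rcases (show di = 0 ∨ di = 1 by omega) with rfl | rfl
          · rw [hb0 rfl]
            refine h.below i c le_rfl h2 (by omega) h4 ?_ h6
            have := chain_le h.xt_lt le_rfl (show j + dj ≤ c + 1 by omega) (by omega)
            rw [add_zero] at hz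
            omega
          · rcases (show j + dj ≤ c by omega).eq_or_lt with rfl | h7
            · exact hb
            · have := chain_lt h.xt_lt le_rfl h7 (by omega)
              omega
      · rw [Function.update_of_ne (show a ≠ i by omega)] at h5 ⊢
        rcases h3.eq_or_lt with rfl | h3
        · rw [Function.update_self]
          rcases (show dj = 0 ∨ dj = 1 by omega) with rfl | rfl
          · rw [ht0 rfl]
            refine h.below a j (by omega) h2 le_rfl h4 h5 ?_
            have := chain_le h.xb_lt le_rfl (show i + di ≤ a + 1 by omega) (by omega)
            rw [add_zero] at hz'
            omega
          · rcases (show i + di ≤ a by omega).eq_or_lt with rfl | h7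
            · exact ht
            · have := chain_lt h.xb_lt le_rfl h7 (by omega)
              omega
        · rw [Function.update_of_ne (show c ≠ j by omega)] at h6 ⊢
          exact h.below a c (by omega) h2 (by omega) h4 h5 h6
  · rw [layoutArea, layoutArea, chain_sum_extend hk hdi hz hb0, chain_sum_extend hm hdj hz' ht0]
    ring

/-- The layout that consists of the rightmost column. -/
theorem Layout.column (k m : ℕ) (f g : ℕ → ℤ) {xb yb xt yt : ℕ → ℤ} (hx : xb k < xb (k + 1))
    (hl : xb k = xt m) (hr : xb (k + 1) = xt (m + 1)) (hy : yb k < yt m) :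
    Layout k m f g k m xb yb xt yt where
  le_k := le_rfl
  le_m := le_rfl
  xb_lt i h1 h2 := by obtain rfl : i = k := by omega
                      exact hx
  xt_lt i h1 h2 := by obtain rfl : i = m := by omega
                      omega
  left := hl
  right := hr
  yb_sign i h1 h2 := by omega
  yt_sign i h1 h2 := by omega
  below i j h1 h2 h3 h4 _ _ := by
    obtain rfl : i = k := by omega
    obtain rfl : j = m := by omega
    exact hy

/-- A layout of the area found by the dynamic program has minimum area. -/
theorem IsTable.area_le {n k m : ℕ} {f g : ℕ → ℤ} {G : ℕ → ℕ → ℕ → ℤ}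
    (hG : IsTable n k m f g G) (hn : n = 2 * (k + m)) (hf : ∀ i, f i = 1 ∨ f i = -1)
    (hg : ∀ i, g i = 1 ∨ g i = -1) {xb yb xt yt : ℕ → ℤ}
    (h : Layout k m f g 1 1 xb yb xt yt) :
    ∃ H : ℕ, 1 ≤ H ∧ H ≤ n ∧ 0 < G k m H ∧
      (n : ℤ) * n - G k m H ≤ layoutArea k m 1 1 xb yb xt yt := by
  obtain ⟨h', c, hc, hp⟩ := h.exists_path
  obtain ⟨h'', c', hc', hp'⟩ := hp.exists_bounded hf hg (n := n) (by omega)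
  obtain ⟨H, rfl, hH⟩ := hG.le_of_path hp' le_rfl le_rfl
  obtain ⟨h1, h2, h3, -⟩ := hp'.cost_le
  rw [Set.mem_Icc] at h2
  -- By `Path.cost_le` the cost is at most `(k + m) * n - n`, hence below `n ^ 2`; this makes the
  -- table entry positive.
  refine ⟨H, by omega, by omega, ?_, by linarith⟩
  have h4 : ((k + m : ℕ) : ℤ) * n ≤ n * n :=
    mul_le_mul_of_nonneg_right (by exact_mod_cast (by omega)) (by positivity)
  have h5 : (0 : ℤ) < n := by exact_mod_cast (by omega : 0 < n)
  linarith

/-! ### The program -/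

infixl:65 " +ₑ " => Exp.add
infixl:65 " -ₑ " => Exp.sub
infixl:70 " *ₑ " => Exp.mul
infixr:60 " ;; " => Prog.seq
infix:61 " ≔ " => Prog.assign

/-- The address of the state `(i, j, h)` in the table, where `x` holds `n`. -/
def stateExp (x i j h : Exp) : Exp := (i *ₑ x +ₑ j) *ₑ (x +ₑ .const 1) +ₑ h

/-- The address of the state `(i, j, h)` in the table. -/
def stateIndex (n i j h : ℕ) : ℕ := (i * n + j) * (n + 1) + h

/-- The value of the predecessor under consideration. -/
def predExp : Exp :=
  .get 3 (stateExp (.var 0) (.var 4 -ₑ .var 14) (.var 5 -ₑ .var 15) (.var 7)) -ₑ .var 6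

/-- Compare the best predecessor found so far with the predecessor of height `var 7`. -/
def relaxProg : Prog :=
  -- The three outer tests are the inequalities of `Valid`; the added `1` turns the weak one into
  -- positivity. The innermost test asks for an improvement.
  .branch ((.var 13 -ₑ .var 12) *ₑ (.var 6 -ₑ .var 7) -ₑ
      (.var 13 -ₑ .var 12) *ₑ (.var 13 -ₑ .var 12) +ₑ .const 1)
    (.branch (.var 7 -ₑ .var 12 *ₑ .var 13)
      (.branch (.var 6 -ₑ .var 12 *ₑ .var 13)
        (.branch (predExp -ₑ .var 8)
          (8 ≔ predExp ;; 9 ≔ .var 4 -ₑ .var 14 ;; 10 ≔ .var 5 -ₑ .var 15 ;; 11 ≔ .var 7)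
          .skip)
        .skip)
      .skip)
    .skip

/-- The sign of the vertical edge before the bottom edge `var 4`. -/
def botExp : Exp := .get 0 (.var 1 +ₑ .const 2 *ₑ .var 4 -ₑ .const 2)

/-- The sign of the vertical edge before the top edge `var 5`. -/
def topExp : Exp := .get 0 (.var 1 +ₑ .var 0 +ₑ .const 2 -ₑ .const 2 *ₑ .var 5)

/-- Try the predecessors of all heights, for a move by `var 14` and `var 15` edges. -/
def scanProg : Prog :=
  12 ≔ .var 14 *ₑ botExp ;; 13 ≔ .var 15 *ₑ topExp ;; 7 ≔ .const 1 ;;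
    .upTo 7 (.var 0 +ₑ .const 1 -ₑ .var 7) relaxProg

/-- Try the predecessors of all heights, for a move by `di` and `dj` edges. -/
def moveProg (di dj : ℕ) : Prog := 14 ≔ .const di ;; 15 ≔ .const dj ;; scanProg

/-- Compute the value of the state given by `var 4`, `var 5`, `var 6`, and its best predecessor. -/
def evalProg : Prog :=
  8 ≔ .const 0 ;;
  .branch (.const 3 -ₑ .var 4 -ₑ .var 5) (8 ≔ .var 0 *ₑ .var 0 -ₑ .var 6) .skip ;;
  moveProg 1 0 ;; moveProg 0 1 ;; moveProg 1 1

theorem Exp.eval_get {σ : Mem} {a : ℕ} {i : Exp} (z : ℕ) (h : i.eval σ = z) :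
    (Exp.get a i).eval σ = σ.arr a z := by
  simp [Exp.eval, h]

/-- Gives access to the memory bound in a proof, so that values read from memory can be written back
without a bound of their own. -/
theorem Runs.of_bounded {B M L : ℕ} {p : Prog} {σ : Mem} {Q : Mem → Prop}
    (h : σ.Bounded M → Runs B M L p σ Q) : Runs B M L p σ Q :=
  fun h1 h2 h3 => h h3 h1 h2 h3

/-- The part of the memory that is needed for computing the value of a state. -/
structure StateEnv (n a i j h : ℕ) (f g : ℕ → ℤ) (G : ℕ → ℕ → ℕ → ℤ) (σ : Mem) : Prop where
  v0 : σ.var 0 = n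
  v1 : σ.var 1 = a
  v4 : σ.var 4 = i
  v5 : σ.var 5 = j
  v6 : σ.var 6 = h
  one_le_i : 1 ≤ i
  one_le_j : 1 ≤ j
  one_le_h : 1 ≤ h
  i_le : 2 * i ≤ n
  j_le : 2 * j ≤ n
  h_le : h ≤ n
  f_eq : σ.arr 0 (a + 2 * i - 2) = f i
  g_eq : σ.arr 0 (a + n + 2 - 2 * j) = g j
  f_pm : f i = 1 ∨ f i = -1
  g_pm : g j = 1 ∨ g j = -1
  G_eq : ∀ di dj h', di ≤ 1 → dj ≤ 1 → 0 < di + dj → 1 ≤ h' → h' ≤ n →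
    σ.arr 3 (stateIndex n (i - di) (j - dj) h') = G (i - di) (j - dj) h'

theorem StateEnv.congr {n a i j h : ℕ} {f g : ℕ → ℤ} {G : ℕ → ℕ → ℕ → ℤ} {σ τ : Mem}
    (e : StateEnv n a i j h f g G σ) (h0 : τ.var 0 = σ.var 0) (h1 : τ.var 1 = σ.var 1)
    (h4 : τ.var 4 = σ.var 4) (h5 : τ.var 5 = σ.var 5) (h6 : τ.var 6 = σ.var 6)
    (ha : τ.arr 0 = σ.arr 0) (hb : τ.arr 3 = σ.arr 3) : StateEnv n a i j h f g G τ :=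
  { e with
    v0 := h0.trans e.v0
    v1 := h1.trans e.v1
    v4 := h4.trans e.v4
    v5 := h5.trans e.v5
    v6 := h6.trans e.v6
    f_eq := by rw [ha]; exact e.f_eq
    g_eq := by rw [ha]; exact e.g_eq
    G_eq := by rw [hb]; exact e.G_eq }

/-- The result of the search for the best predecessor, after the moves in `E` have been tried. -/
structure Searched (n : ℕ) (f g : ℕ → ℤ) (G : ℕ → ℕ → ℕ → ℤ) (i j h : ℕ) (E : ℕ → ℕ → ℕ → Prop)
    (b pi pj ph : ℤ) : Prop where
  nonneg : 0 ≤ b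
  start_le : i = 1 → j = 1 → (n : ℤ) * n - h ≤ b
  step_le : ∀ di dj h' : ℕ, E di dj h' → Valid (di * f i) (dj * g j) h' h →
    G (i - di) (j - dj) h' - h ≤ b
  attained : 0 < b → (i = 1 ∧ j = 1 ∧ b = n * n - h) ∨ ∃ di dj h' : ℕ, di ≤ 1 ∧ dj ≤ 1 ∧
    0 < di + dj ∧ 1 ≤ h' ∧ h' ≤ n ∧ Valid (di * f i) (dj * g j) h' h ∧
      b = G (i - di) (j - dj) h' - h ∧ pi = (i - di : ℕ) ∧ pj = (j - dj : ℕ) ∧ ph = h'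

section

variable {B M L n a i j h : ℕ} {f g : ℕ → ℤ} {G : ℕ → ℕ → ℕ → ℤ} {σ : Mem}
  {E E' : ℕ → ℕ → ℕ → Prop}

theorem Searched.mono {b pi pj ph : ℤ} (hs : Searched n f g G i j h E b pi pj ph)
    (h' : ∀ x y z, E' x y z → E x y z ∨ (Valid (x * f i) (y * g j) z h →
      G (i - x) (j - y) z - h ≤ b)) : Searched n f g G i j h E' b pi pj ph :=
  { hs with
    step_le := fun x y z hE hv => by
      rcases h' x y z hE with h1 | h1
      · exact hs.step_le x y z h1 hv
      · exact h1 hv }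

/-- If a test of `Valid` fails, the candidate is irrelevant; if the last test fails, the best value
so far already dominates it. In all these cases memory stays as it is. -/
theorem runs_relaxProg (e : StateEnv n a i j h f g G σ) (hM : 4 * n * n ≤ M) {di dj z : ℕ}
    (hdi : di ≤ 1) (hdj : dj ≤ 1) (hd : 0 < di + dj) (hz : 1 ≤ z) (hz' : z ≤ n)
    (h7 : σ.var 7 = z) (h12 : σ.var 12 = di * f i) (h13 : σ.var 13 = dj * g j)
    (h14 : σ.var 14 = di) (h15 : σ.var 15 = dj)
    (hs : Searched n f g G i j h E (σ.var 8) (σ.var 9) (σ.var 10) (σ.var 11)) :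
    Runs B M L relaxProg σ (fun τ => Searched n f g G i j h
      (fun x y w => E x y w ∨ (x = di ∧ y = dj ∧ w = z)) (τ.var 8) (τ.var 9) (τ.var 10)
        (τ.var 11)) := by
  have hskip : (Valid (di * f i) (dj * g j) z h → G (i - di) (j - dj) z - h ≤ σ.var 8) →
      Searched n f g G i j h (fun x y w => E x y w ∨ (x = di ∧ y = dj ∧ w = z)) (σ.var 8)
        (σ.var 9) (σ.var 10) (σ.var 11) := fun h1 => hs.mono fun x y w hE => by
    rcases hE with hE | ⟨rfl, rfl, rfl⟩
    · exact Or.inl hE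
    · exact Or.inr h1
  have hi := e.one_le_i
  have hj := e.one_le_j
  have hidx : (stateExp (.var 0) (.var 4 -ₑ .var 14) (.var 5 -ₑ .var 15) (.var 7)).eval σ =
      (stateIndex n (i - di) (j - dj) z : ℕ) := by
    simp only [stateExp, stateIndex, Exp.eval, e.v0, e.v4, e.v5, h14, h15, h7]
    rw [Nat.cast_add, Nat.cast_mul, Nat.cast_add, Nat.cast_mul, Nat.cast_sub (by omega),
      Nat.cast_sub (by omega)]
    push_cast
    ring
  have hpred : predExp.eval σ = G (i - di) (j - dj) z - h := by
    rw [predExp, Exp.eval, Exp.eval_get _ hidx, e.G_eq di dj z hdi hdj hd hz hz', Exp.eval, e.v6]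
  have hpaddr : predExp.Addr σ :=
    ⟨⟨by simp [stateExp, Exp.Addr], by rw [hidx]; positivity⟩, trivial⟩
  have hnM : (n : ℤ) ≤ M := by
    have : n ≤ 4 * n * n := by nlinarith [Nat.zero_le n]
    exact_mod_cast this.trans hM
  refine Runs.of_bounded fun hbd => ?_
  refine Runs.branch (by simp [Exp.Addr]) (by simp [Exp.deg]) (fun c1 => ?_)
    (fun c1 => Runs.skip (hskip fun hv => ?_))
  swap
  · simp only [Exp.eval, h7, h12, h13, e.v6] at c1
    have := hv.1
    linarith
  refine Runs.branch (by simp [Exp.Addr]) (by simp [Exp.deg]) (fun c2 => ?_)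
    (fun c2 => Runs.skip (hskip fun hv => ?_))
  swap
  · simp only [Exp.eval, h7, h12, h13] at c2
    have := hv.2.1
    linarith
  refine Runs.branch (by simp [Exp.Addr]) (by simp [Exp.deg]) (fun c3 => ?_)
    (fun c3 => Runs.skip (hskip fun hv => ?_))
  swap
  · simp only [Exp.eval, e.v6, h12, h13] at c3
    have := hv.2.2
    linarith
  refine Runs.branch ⟨hpaddr, trivial⟩ (by simp [predExp, stateExp, Exp.deg]) (fun c4 => ?_)
    (fun c4 => Runs.skip (hskip fun hv => ?_))
  swap
  · rw [Exp.eval, hpred, Exp.eval] at c4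
    linarith
  rw [Exp.eval, hpred, Exp.eval] at c4
  simp only [Exp.eval, h7, h12, h13, e.v6] at c1 c2 c3
  have hv : Valid (di * f i) (dj * g j) z h := ⟨by linarith, by linarith, by linarith⟩
  -- The difference exceeds the nonnegative current value and is at most the table entry, which is
  -- in memory and thus bounded.
  have hval : |G (i - di) (j - dj) z - h| ≤ M := by
    have h1 := hbd.arr 3 (stateIndex n (i - di) (j - dj) z)
    rw [e.G_eq di dj z hdi hdj hd hz hz', abs_le] at h1
    have := hs.nonneg
    rw [abs_le]
    omega
  have hi' := e.i_le
  have hj' := e.j_le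
  refine Runs.seq (Runs.assign _ hpred hpaddr (by simp [predExp, stateExp, Exp.deg]) hval ?_)
  refine Runs.seq (Runs.assign ((i - di : ℕ) : ℤ) ?_ (by simp [Exp.Addr]) (by simp [Exp.deg]) ?_ ?_)
  · simp only [Exp.eval, Mem.setVar_var, e.v4, h14, Nat.reduceEqDiff, if_false]
    omega
  · rw [abs_of_nonneg (by positivity)]; omega
  refine Runs.seq (Runs.assign ((j - dj : ℕ) : ℤ) ?_ (by simp [Exp.Addr]) (by simp [Exp.deg]) ?_ ?_)
  · simp only [Exp.eval, Mem.setVar_var, e.v5, h15, Nat.reduceEqDiff, if_false]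
    omega
  · rw [abs_of_nonneg (by positivity)]; omega
  refine Runs.assign (z : ℤ) ?_ (by simp [Exp.Addr]) (by simp [Exp.deg]) ?_ ?_
  · simp [Exp.eval, h7]
  · rw [abs_of_nonneg (by positivity)]; omega
  simp only [Mem.setVar_var, Nat.reduceEqDiff, if_false, if_true]
  refine ⟨?_, fun h1 h2 => ?_, fun x y w hE hv' => ?_, fun _ => Or.inr ⟨di, dj, z, hdi, hdj, hd, hz,
    hz', hv, rfl, rfl, rfl, rfl⟩⟩
  · have := hs.nonneg; linarith
  · have := hs.start_le h1 h2; linarith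
  · rcases hE with hE | ⟨rfl, rfl, rfl⟩
    · have := hs.step_le x y w hE hv'; linarith
    · exact le_rfl

theorem runs_scanProg (e : StateEnv n a i j h f g G σ) (hM : 4 * n * n ≤ M) (hL : n ≤ L)
    {di dj : ℕ} (hdi : di ≤ 1) (hdj : dj ≤ 1) (hd : 0 < di + dj) (h14 : σ.var 14 = di)
    (h15 : σ.var 15 = dj)
    (hs : Searched n f g G i j h E (σ.var 8) (σ.var 9) (σ.var 10) (σ.var 11)) :
    Runs B M L scanProg σ (fun τ => Searched n f g G i j h
      (fun x y w => E x y w ∨ (x = di ∧ y = dj ∧ 1 ≤ w ∧ w ≤ n)) (τ.var 8) (τ.var 9) (τ.var 10)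
        (τ.var 11)) := by
  have hi := e.one_le_i
  have hj := e.one_le_j
  have hi' := e.i_le
  have hj' := e.j_le
  have hnM : 2 * n ≤ M := by nlinarith
  have hpm : ∀ (d : ℕ) (x : ℤ), d ≤ 1 → (x = 1 ∨ x = -1) → |d * x| ≤ M := by
    intro d x h1 h2
    rw [abs_le]
    interval_cases d <;> rcases h2 with rfl | rfl <;> constructor <;> push_cast <;> omega
  have hbi : (Exp.var 1 +ₑ .const 2 *ₑ .var 4 -ₑ .const 2).eval σ = (a + 2 * i - 2 : ℕ) := by
    simp only [Exp.eval, e.v1, e.v4]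
    omega
  have hti : ∀ z, (Exp.var 1 +ₑ .var 0 +ₑ .const 2 -ₑ .const 2 *ₑ .var 5).eval (σ.setVar 12 z) =
      (a + n + 2 - 2 * j : ℕ) := fun z => by
    simp only [Exp.eval, Mem.setVar_var, Nat.reduceEqDiff, if_false, e.v1, e.v0, e.v5]
    omega
  unfold scanProg
  refine Runs.seq (Runs.assign (di * f i) ?_ ⟨trivial, by simp [Exp.Addr], by rw [hbi]; positivity⟩
    (by simp [botExp, Exp.deg]) (hpm _ _ hdi e.f_pm) ?_)
  · rw [Exp.eval, botExp, Exp.eval_get _ hbi, e.f_eq, Exp.eval, h14]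
  refine Runs.seq (Runs.assign (dj * g j) ?_
    ⟨trivial, by simp [Exp.Addr], by rw [hti]; positivity⟩
    (by simp [topExp, Exp.deg]) (hpm _ _ hdj e.g_pm) ?_)
  · rw [Exp.eval, topExp, Exp.eval_get _ (hti _), Mem.setVar_arr, e.g_eq, Exp.eval]
    simp [h15]
  refine Runs.seq (Runs.assign 1 rfl trivial (by simp [Exp.deg]) (by simp; omega) ?_)
  refine (Runs.upTo (fun z τ => Searched n f g G i j h
      (fun x y w => E x y w ∨ (x = di ∧ y = dj ∧ 1 ≤ w ∧ w < z)) (τ.var 8) (τ.var 9) (τ.var 10)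
        (τ.var 11)) 1 (n + 1) (by omega) (by omega) (by omega) (by simp [Exp.deg]) rfl (by simp)
        ?_ ?_ ?_).mono ?_
  · intro z τ hF hz hz'
    have h0 : τ.var 0 = n := by rw [hF.var 0 rfl]; simp [e.v0]
    refine ⟨by simp [Exp.Addr], ?_⟩
    simp only [Exp.eval, h0, hz']
    omega
  · intro z τ hF hz1 hz2 hz hI
    refine (runs_relaxProg (e.congr ?_ ?_ ?_ ?_ ?_ ?_ ?_) hM hdi hdj hd hz1 (by omega) hz ?_ ?_ ?_ ?_
      hI).mono ?_
    any_goals rw [hF.var _ rfl]; simp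
    any_goals rw [hF.arr _ rfl]; simp
    · exact h14
    · exact h15
    · intro ρ _ hρ
      simp only [Mem.setVar_var, Nat.reduceEqDiff, if_false]
      refine hρ.mono fun x y w hE => Or.inl ?_
      rcases hE with hE | ⟨h1, h2, h3, h4⟩
      · exact Or.inl (Or.inl hE)
      · rcases (show w ≤ z by omega).eq_or_lt with h5 | h5
        · exact Or.inr ⟨h1, h2, h5⟩
        · exact Or.inl (Or.inr ⟨h1, h2, h3, h5⟩)
  · simp only [Mem.setVar_var, Nat.reduceEqDiff, if_false]
    refine hs.mono fun x y w hE => Or.inl ?_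
    rcases hE with hE | hE
    · exact hE
    · omega
  · intro τ _ hτ
    refine hτ.2.mono fun x y w hE => Or.inl ?_
    rcases hE with hE | ⟨h1, h2, h3, h4⟩
    · exact Or.inl hE
    · exact Or.inr ⟨h1, h2, h3, by omega⟩

theorem Frame.stateEnv {p : Prog} {τ : Mem} (hF : Frame p σ τ) (e : StateEnv n a i j h f g G σ)
    (hp : (p.assigns 0 || p.assigns 1 || p.assigns 4 || p.assigns 5 || p.assigns 6 || p.puts 0 ||
      p.puts 3) = false) : StateEnv n a i j h f g G τ := by
  simp only [Bool.or_eq_false_iff] at hp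
  obtain ⟨⟨⟨⟨⟨⟨h0, h1⟩, h4⟩, h5⟩, h6⟩, ha⟩, hb⟩ := hp
  exact e.congr (hF.var _ h0) (hF.var _ h1) (hF.var _ h4) (hF.var _ h5) (hF.var _ h6)
    (hF.arr _ ha) (hF.arr _ hb)

theorem StateEnv.setVar (e : StateEnv n a i j h f g G σ) {x : ℕ} {z : ℤ}
    (hx : x ≠ 0 ∧ x ≠ 1 ∧ x ≠ 4 ∧ x ≠ 5 ∧ x ≠ 6) : StateEnv n a i j h f g G (σ.setVar x z) := by
  obtain ⟨h0, h1, h4, h5, h6⟩ := hx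
  refine e.congr ?_ ?_ ?_ ?_ ?_ rfl rfl <;> rw [Mem.setVar_var, if_neg (Ne.symm ‹_›)]

theorem runs_moveProg (e : StateEnv n a i j h f g G σ) (hM : 4 * n * n ≤ M) (hL : n ≤ L)
    {di dj : ℕ} (hdi : di ≤ 1) (hdj : dj ≤ 1) (hd : 0 < di + dj)
    (hs : Searched n f g G i j h E (σ.var 8) (σ.var 9) (σ.var 10) (σ.var 11)) :
    Runs B M L (moveProg di dj) σ (fun τ => Searched n f g G i j h
      (fun x y w => E x y w ∨ (x = di ∧ y = dj ∧ 1 ≤ w ∧ w ≤ n)) (τ.var 8) (τ.var 9) (τ.var 10)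
        (τ.var 11)) := by
  have hM1 : 1 ≤ M := by nlinarith [e.one_le_i, e.i_le]
  unfold moveProg
  refine Runs.seq (Runs.assign di rfl trivial (by simp [Exp.deg]; omega) ?_ ?_)
  · rw [abs_of_nonneg (by positivity)]; omega
  refine Runs.seq (Runs.assign dj rfl trivial (by simp [Exp.deg]; omega) ?_ ?_)
  · rw [abs_of_nonneg (by positivity)]; omega
  replace e := (e.setVar (x := 14) (z := di) (by decide)).setVar (x := 15) (z := dj) (by decide)
  exact runs_scanProg e hM hL hdi hdj hd (by simp) (by simp) (by simpa using hs)

theorem runs_evalProg (e : StateEnv n a i j h f g G σ) (hM : 4 * n * n ≤ M) (hL : n ≤ L) :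
    Runs B M L evalProg σ (fun τ => Searched n f g G i j h
      (fun x y w => x ≤ 1 ∧ y ≤ 1 ∧ 0 < x + y ∧ 1 ≤ w ∧ w ≤ n) (τ.var 8) (τ.var 9) (τ.var 10)
        (τ.var 11)) := by
  have hi := e.one_le_i
  have hj := e.one_le_j
  have hi' := e.i_le
  have hh := e.one_le_h
  have hh' := e.h_le
  have hM1 : 1 ≤ M := by nlinarith
  have hnn : h ≤ n * n := by nlinarith
  unfold evalProg
  refine Runs.seq (Runs.assign 0 rfl trivial (by simp [Exp.deg]) (by simp) ?_)
  replace e := e.setVar (x := 8) (z := 0) (by decide)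
  have h8 : (σ.setVar 8 0).var 8 = 0 := by simp
  generalize σ.setVar 8 0 = σ at *
  have hstart : Runs B M L (.branch (.const 3 -ₑ .var 4 -ₑ .var 5)
      (8 ≔ .var 0 *ₑ .var 0 -ₑ .var 6) .skip) σ (fun τ =>
      Searched n f g G i j h (fun _ _ _ => False) (τ.var 8) (τ.var 9) (τ.var 10) (τ.var 11)) := by
    -- As `i` and `j` are positive, `3 - i - j` is positive only for `i = j = 1`.
    refine Runs.branch (by simp [Exp.Addr]) (by simp [Exp.deg]) (fun hc => ?_) (fun hc => ?_)
    · simp only [Exp.eval, e.v4, e.v5] at hc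
      refine Runs.assign ((n : ℤ) * n - h) ?_ (by simp [Exp.Addr]) (by simp [Exp.deg]) ?_ ?_
      · simp only [Exp.eval, e.v0, e.v6]
      · zify at hnn hM
        rw [abs_le]
        constructor <;> nlinarith
      · simp only [Mem.setVar_var, Nat.reduceEqDiff, if_false, if_true]
        refine ⟨?_, fun _ _ => le_rfl, fun _ _ _ h => h.elim, fun _ => Or.inl ⟨by omega, by omega,
          rfl⟩⟩
        zify at hnn
        linarith
    · simp only [Exp.eval, e.v4, e.v5] at hc
      refine Runs.skip ⟨h8.ge, fun _ _ => by omega, fun _ _ _ h => h.elim, fun h => ?_⟩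
      omega
  refine Runs.seq (hstart.mono fun τ hF hs => ?_)
  replace e := hF.stateEnv e rfl
  refine Runs.seq ((runs_moveProg e hM hL (by omega) (by omega) (by omega) hs).mono
    fun τ hF hs => ?_)
  replace e := hF.stateEnv e rfl
  refine Runs.seq ((runs_moveProg e hM hL (by omega) (by omega) (by omega) hs).mono
    fun τ hF hs => ?_)
  replace e := hF.stateEnv e rfl
  refine (runs_moveProg e hM hL (by omega) (by omega) (by omega) hs).mono fun τ hF hs => ?_
  exact hs.mono fun x y w hE => Or.inl (by omega)

end

/-! ### Filling the table. -/

/-- Compute the table of the dynamic program. -/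
def tableProg : Prog :=
  4 ≔ .const 1 ;; .upTo 4 (.var 2 +ₑ .const 1 -ₑ .var 4)
    (5 ≔ .const 1 ;; .upTo 5 (.var 3 +ₑ .const 1 -ₑ .var 5)
      (6 ≔ .const 1 ;; .upTo 6 (.var 0 +ₑ .const 1 -ₑ .var 6)
        (evalProg ;; .put 3 (stateExp (.var 0) (.var 4) (.var 5) (.var 6)) (.var 8))))

/-- The parameters of the dynamic program: `var 1` is the start of the left edge in the cyclic
sequence of turns, `var 2` and `var 3` are the numbers of horizontal edges in the bottom chain and
the top chain. -/
structure ProgEnv (n a k m : ℕ) (f g : ℕ → ℤ) (σ : Mem) : Prop where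
  v0 : σ.var 0 = n
  v1 : σ.var 1 = a
  v2 : σ.var 2 = k
  v3 : σ.var 3 = m
  n_eq : n = 2 * (k + m)
  one_le_k : 1 ≤ k
  one_le_m : 1 ≤ m
  a_lt : a < n
  f_pm : ∀ i, f i = 1 ∨ f i = -1
  g_pm : ∀ j, g j = 1 ∨ g j = -1
  f_eq : ∀ i, 1 ≤ i → i ≤ k → σ.arr 0 (a + 2 * i - 2) = f i
  g_eq : ∀ j, 1 ≤ j → j ≤ m → σ.arr 0 (a + n + 2 - 2 * j) = g j

theorem Frame.progEnv {n a k m : ℕ} {f g : ℕ → ℤ} {p : Prog} {σ τ : Mem} (hF : Frame p σ τ)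
    (e : ProgEnv n a k m f g σ) (hp : (p.assigns 0 || p.assigns 1 || p.assigns 2 || p.assigns 3 ||
      p.puts 0) = false) : ProgEnv n a k m f g τ := by
  simp only [Bool.or_eq_false_iff] at hp
  obtain ⟨⟨⟨⟨h0, h1⟩, h2⟩, h3⟩, ha⟩ := hp
  exact { e with
    v0 := (hF.var _ h0).trans e.v0
    v1 := (hF.var _ h1).trans e.v1
    v2 := (hF.var _ h2).trans e.v2
    v3 := (hF.var _ h3).trans e.v3
    f_eq := by rw [hF.arr _ ha]; exact e.f_eq
    g_eq := by rw [hF.arr _ ha]; exact e.g_eq }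

/-- The table stored in an array. -/
def tableOf (n : ℕ) (A : ℕ → ℤ) (i j h : ℕ) : ℤ := A (stateIndex n i j h)

/-- Mixed radix notation with digits `j < n` and `h ≤ n`. -/
theorem stateIndex_inj {n i j h i' j' h' : ℕ} (hj : j < n) (hh : h ≤ n) (hj' : j' < n)
    (hh' : h' ≤ n) (he : stateIndex n i j h = stateIndex n i' j' h') :
    i = i' ∧ j = j' ∧ h = h' := by
  have key : ∀ {a b c d N : ℕ}, b < N → d < N → a * N + b = c * N + d → a = c ∧ b = d := by
    intro a b c d N hb hd he
    have h1 : a = c := by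
      have h2 := congrArg (· / N) he
      have hN : 0 < N := by omega
      simp only [Nat.add_comm (_ * N), Nat.add_mul_div_right _ _ hN, Nat.div_eq_of_lt hb,
        Nat.div_eq_of_lt hd] at h2
      omega
    subst h1
    exact ⟨rfl, by omega⟩
  obtain ⟨h1, h2⟩ := key (by omega) (by omega) he
  obtain ⟨h3, h4⟩ := key hj hj' h1
  exact ⟨h3, h4, h2⟩

/-- The table has been computed for all states before `(i, j, h)` in the lexicographic order. -/
structure TableUpTo (n k m : ℕ) (f g : ℕ → ℤ) (i j h : ℕ) (A : ℕ → ℤ) : Prop where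
  zero : ∀ i' j' h', i' ≤ k → j' ≤ m → 1 ≤ h' → h' ≤ n → i' = 0 ∨ j' = 0 → tableOf n A i' j' h' = 0
  best : ∀ i' j' h', 1 ≤ i' → i' ≤ k → 1 ≤ j' → j' ≤ m → 1 ≤ h' → h' ≤ n →
    i' < i ∨ (i' = i ∧ (j' < j ∨ (j' = j ∧ h' < h))) →
    IsBest n f g (tableOf n A) i' j' h' (tableOf n A i' j' h')

section

variable {B M L n a k m i j h : ℕ} {f g : ℕ → ℤ} {A : ℕ → ℤ} {σ : Mem}

theorem IsBest.congr {G G' : ℕ → ℕ → ℕ → ℤ} {b : ℤ} (hb : IsBest n f g G i j h b)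
    (hG : ∀ di dj h', di ≤ 1 → dj ≤ 1 → 0 < di + dj → 1 ≤ h' → h' ≤ n →
      G' (i - di) (j - dj) h' = G (i - di) (j - dj) h') : IsBest n f g G' i j h b where
  nonneg := hb.nonneg
  start_le := hb.start_le
  step_le di dj h' h1 h2 h3 h4 h5 hv := by
    rw [hG di dj h' h1 h2 h3 h4 h5]
    exact hb.step_le di dj h' h1 h2 h3 h4 h5 hv
  attained h0 := by
    rcases hb.attained h0 with h1 | ⟨di, dj, h', h1, h2, h3, h4, h5, hv, he⟩
    · exact Or.inl h1
    · exact Or.inr ⟨di, dj, h', h1, h2, h3, h4, h5, hv, by rwa [hG di dj h' h1 h2 h3 h4 h5]⟩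

/-- Predecessors have a strictly smaller pair `(i, j)`, so overwriting the current entry affects no
value that the already computed states or this state rely on. -/
theorem TableUpTo.update (hA : TableUpTo n k m f g i j h A) (hn : m < n) (hi : 1 ≤ i)
    (hj : 1 ≤ j) (hjm : j ≤ m) (hh : h ≤ n) {b : ℤ}
    (hb : IsBest n f g (tableOf n A) i j h b) :
    TableUpTo n k m f g i j (h + 1) (Function.update A (stateIndex n i j h) b) := by
  have hne : ∀ i' j' h', j' ≤ m → h' ≤ n → ¬(i' = i ∧ j' = j ∧ h' = h) →
      tableOf n (Function.update A (stateIndex n i j h) b) i' j' h' = tableOf n A i' j' h' := by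
    intro i' j' h' h2 h3 h4
    rw [tableOf, Function.update_of_ne, tableOf]
    exact fun he => h4 (stateIndex_inj (by omega) h3 (by omega) hh he)
  refine ⟨fun i' j' h' h1 h2 h3 h4 h5 => ?_, fun i' j' h' h1 h2 h3 h4 h5 h6 h7 => ?_⟩
  · rw [hne i' j' h' h2 h4 (by omega)]
    exact hA.zero i' j' h' h1 h2 h3 h4 h5
  · have hpred : ∀ di dj h'', di ≤ 1 → dj ≤ 1 → 0 < di + dj → 1 ≤ h'' → h'' ≤ n →
        tableOf n (Function.update A (stateIndex n i j h) b) (i' - di) (j' - dj) h'' =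
          tableOf n A (i' - di) (j' - dj) h'' := fun di dj h'' _ _ _ _ h8 =>
      hne _ _ _ (by omega) h8 (by omega)
    by_cases hc : i' = i ∧ j' = j ∧ h' = h
    · obtain ⟨rfl, rfl, rfl⟩ := hc
      refine IsBest.congr ?_ hpred
      rwa [tableOf, Function.update_self]
    · rw [hne i' j' h' h4 h6 hc]
      exact (hA.best i' j' h' h1 h2 h3 h4 h5 h6 (by omega)).congr hpred

theorem TableUpTo.isTable (hA : TableUpTo n k m f g (k + 1) 1 1 A) :
    IsTable n k m f g (tableOf n A) where
  zero_left j h h1 h2 h3 := hA.zero 0 j h (by omega) h1 h2 h3 (Or.inl rfl)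
  zero_right i h h1 h2 h3 := hA.zero i 0 h h1 (by omega) h2 h3 (Or.inr rfl)
  best i j h h1 h2 h3 h4 h5 h6 := hA.best i j h h1 h2 h3 h4 h5 h6 (Or.inl (by omega))

theorem TableUpTo.mono (hA : TableUpTo n k m f g i j h A) {i' j' h' : ℕ}
    (H : ∀ x y z, 1 ≤ x → x ≤ k → 1 ≤ y → y ≤ m → 1 ≤ z → z ≤ n →
      x < i' ∨ (x = i' ∧ (y < j' ∨ (y = j' ∧ z < h'))) →
      x < i ∨ (x = i ∧ (y < j ∨ (y = j ∧ z < h)))) : TableUpTo n k m f g i' j' h' A where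
  zero := hA.zero
  best x y z h1 h2 h3 h4 h5 h6 h7 := hA.best x y z h1 h2 h3 h4 h5 h6 (H x y z h1 h2 h3 h4 h5 h6 h7)

theorem Searched.isBest {G : ℕ → ℕ → ℕ → ℤ} {b pi pj ph : ℤ}
    (hs : Searched n f g G i j h (fun x y w => x ≤ 1 ∧ y ≤ 1 ∧ 0 < x + y ∧ 1 ≤ w ∧ w ≤ n)
      b pi pj ph) : IsBest n f g G i j h b where
  nonneg := hs.nonneg
  start_le := hs.start_le
  step_le di dj h' h1 h2 h3 h4 h5 hv := hs.step_le di dj h' ⟨h1, h2, h3, h4, h5⟩ hv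
  attained h0 := by
    rcases hs.attained h0 with h1 | ⟨di, dj, h', h1, h2, h3, h4, h5, hv, he, -⟩
    · exact Or.inl h1
    · exact Or.inr ⟨di, dj, h', h1, h2, h3, h4, h5, hv, he⟩

theorem ProgEnv.stateEnv (e : ProgEnv n a k m f g σ) (h4 : σ.var 4 = i) (h5 : σ.var 5 = j)
    (h6 : σ.var 6 = h) (hi : 1 ≤ i) (hik : i ≤ k) (hj : 1 ≤ j) (hjm : j ≤ m) (hh : 1 ≤ h)
    (hhn : h ≤ n) : StateEnv n a i j h f g (tableOf n (σ.arr 3)) σ where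
  v0 := e.v0
  v1 := e.v1
  v4 := h4
  v5 := h5
  v6 := h6
  one_le_i := hi
  one_le_j := hj
  one_le_h := hh
  i_le := by have := e.n_eq; omega
  j_le := by have := e.n_eq; omega
  h_le := hhn
  f_eq := e.f_eq i hi hik
  g_eq := e.g_eq j hj hjm
  f_pm := e.f_pm i
  g_pm := e.g_pm j
  G_eq _ _ _ _ _ _ _ _ := rfl

theorem eval_stateExp (h0 : σ.var 0 = n) {x y z : Exp} (hx : x.eval σ = i) (hy : y.eval σ = j)
    (hz : z.eval σ = h) : (stateExp (.var 0) x y z).eval σ = (stateIndex n i j h : ℕ) := by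
  simp only [stateExp, stateIndex, Exp.eval, h0, hx, hy, hz]
  push_cast
  ring

theorem runs_tableProg (e : ProgEnv n a k m f g σ) (hM : 4 * n * n ≤ M) (hL : n ≤ L)
    (h3 : ∀ x, σ.arr 3 x = 0) :
    Runs B M L tableProg σ (fun τ => IsTable n k m f g (tableOf n (τ.arr 3))) := by
  have hn := e.n_eq
  have hk := e.one_le_k
  have hnM : 2 * n ≤ M := by nlinarith
  unfold tableProg
  refine Runs.seq (Runs.assign 1 rfl trivial (by simp [Exp.deg]) (by simp; omega) ?_)
  refine (Runs.upTo (fun i τ => TableUpTo n k m f g i 1 1 (τ.arr 3)) 1 (k + 1) (by omega) (by omega)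
    (by omega) (by simp [Exp.deg]) rfl (by simp) ?_ ?_ ?_).mono fun τ _ hτ => hτ.2.isTable
  · intro i τ hF hi hi'
    have h2 : τ.var 2 = k := by rw [hF.var 2 rfl]; simp [e.v2]
    refine ⟨by simp [Exp.Addr], ?_⟩
    simp only [Exp.eval, h2, hi']
    omega
  · intro i τ hF hi1 hi2 hvi hI
    have e1 : ProgEnv n a k m f g (σ.setVar 4 1) := { e with }
    have e := hF.progEnv e1 rfl
    clear e1 hF
    refine Runs.seq (Runs.assign 1 rfl trivial (by simp [Exp.deg]) (by simp; omega) ?_)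
    refine (Runs.upTo (fun j τ => TableUpTo n k m f g i j 1 (τ.arr 3)) 1 (m + 1) (by omega)
      (by omega) (by omega) (by simp [Exp.deg]) rfl (by simp) ?_ ?_ ?_).mono
      fun τ _ hτ => hτ.2.mono (by omega)
    · intro j τ' hF hj hj'
      have h2 : τ'.var 3 = m := by rw [hF.var 3 rfl]; simp [e.v3]
      refine ⟨by simp [Exp.Addr], ?_⟩
      simp only [Exp.eval, h2, hj']
      omega
    · intro j τ' hF hj1 hj2 hvj hI
      replace hvi : τ'.var 4 = i := by rw [hF.var 4 rfl]; simp [hvi]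
      have e1 : ProgEnv n a k m f g (τ.setVar 5 1) := { e with }
      have e := hF.progEnv e1 rfl
      clear e1 hF
      refine Runs.seq (Runs.assign 1 rfl trivial (by simp [Exp.deg]) (by simp; omega) ?_)
      refine (Runs.upTo (fun h τ => TableUpTo n k m f g i j h (τ.arr 3)) 1 (n + 1) (by omega)
        (by omega) (by omega) (by simp [Exp.deg]) rfl (by simp) ?_ ?_ ?_).mono
        fun τ _ hτ => hτ.2.mono (by omega)
      · intro h τ hF hh hh'
        have h2 : τ.var 0 = n := by rw [hF.var 0 rfl]; simp [e.v0]
        refine ⟨by simp [Exp.Addr], ?_⟩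
        simp only [Exp.eval, h2, hh']
        omega
      · intro h τ hF hh1 hh2 hvh hI
        replace hvi : τ.var 4 = i := by rw [hF.var 4 rfl]; simp [hvi]
        replace hvj : τ.var 5 = j := by rw [hF.var 5 rfl]; simp [hvj]
        have e1 : ProgEnv n a k m f g (τ'.setVar 6 1) := { e with }
        have e := hF.progEnv e1 rfl
        clear e1 hF
        have es := e.stateEnv hvi hvj hvh hi1 (by omega) hj1 (by omega) hh1 (by omega)
        refine Runs.seq ((runs_evalProg es hM hL).mono fun ρ hF hs => ?_)
        have es' := hF.stateEnv es rfl
        refine Runs.of_bounded fun hbd => Runs.put (stateIndex n i j h) (ρ.var 8)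
          (eval_stateExp es'.v0 es'.v4 es'.v5 es'.v6) rfl (by simp [stateExp, Exp.Addr])
          (by simp [stateExp, Exp.deg]) trivial (by simp [Exp.deg]) (hbd.var 8) ?_
        simp only [Mem.setVar_arr, Mem.setArr_arr, if_true]
        rw [hF.arr 3 rfl]
        exact hI.update (by omega) hi1 hj1 (by omega) (by omega) hs.isBest
      · exact hI
    · exact hI
  -- No state precedes `(1, 1, 1)`, and the entries for `i = 0` or `j = 0` are never written: they
  -- keep their initial value `0`.
  · refine ⟨fun i j h _ _ _ _ _ => h3 _, fun i j h _ _ _ _ _ _ _ => ?_⟩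
    omega

/-- Find the height of the rightmost column. -/
def selectProg : Prog :=
  8 ≔ .const 0 ;; 4 ≔ .var 2 ;; 5 ≔ .var 3 ;; 7 ≔ .const 1 ;;
    .upTo 7 (.var 0 +ₑ .const 1 -ₑ .var 7)
      (.branch (.get 3 (stateExp (.var 0) (.var 4) (.var 5) (.var 7)) -ₑ .var 8)
        (8 ≔ .get 3 (stateExp (.var 0) (.var 4) (.var 5) (.var 7)) ;; 6 ≔ .var 7)
        .skip)

theorem runs_selectProg (e : ProgEnv n a k m f g σ) (hM : 4 * n * n ≤ M) (hL : n ≤ L) :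
    Runs B M L selectProg σ (fun τ => τ.var 4 = k ∧ τ.var 5 = m ∧
      (∀ h, 1 ≤ h → h ≤ n → tableOf n (σ.arr 3) k m h ≤ τ.var 8) ∧
      (0 < τ.var 8 → ∃ H : ℕ, 1 ≤ H ∧ H ≤ n ∧ τ.var 6 = H ∧
        tableOf n (σ.arr 3) k m H = τ.var 8)) := by
  have hn := e.n_eq
  have hk := e.one_le_k
  have hnM : 2 * n ≤ M := by nlinarith
  unfold selectProg
  refine Runs.seq (Runs.assign 0 rfl trivial (by simp [Exp.deg]) (by simp) ?_)
  refine Runs.seq (Runs.assign k (by simp [Exp.eval, e.v2]) trivial (by simp [Exp.deg])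
    (by rw [abs_of_nonneg (by positivity)]; omega) ?_)
  refine Runs.seq (Runs.assign m (by simp [Exp.eval, e.v3]) trivial (by simp [Exp.deg])
    (by rw [abs_of_nonneg (by positivity)]; omega) ?_)
  refine Runs.seq (Runs.assign 1 rfl trivial (by simp [Exp.deg]) (by simp; omega) ?_)
  refine (Runs.upTo (fun z τ => (∀ h, 1 ≤ h → h < z → tableOf n (σ.arr 3) k m h ≤ τ.var 8) ∧
      (0 < τ.var 8 → ∃ H : ℕ, 1 ≤ H ∧ H ≤ n ∧ τ.var 6 = H ∧
        tableOf n (σ.arr 3) k m H = τ.var 8)) 1 (n + 1) (by omega)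
    (by omega) (by omega) (by simp [Exp.deg]) rfl (by simp) ?_ ?_ ?_).mono ?_
  · intro z τ hF hz hz'
    have h2 : τ.var 0 = n := by rw [hF.var 0 rfl]; simp [e.v0]
    refine ⟨by simp [Exp.Addr], ?_⟩
    simp only [Exp.eval, h2, hz']
    omega
  · intro z τ hF hz1 hz2 hvz hI
    have h0 : τ.var 0 = n := by rw [hF.var 0 rfl]; simp [e.v0]
    have h4 : τ.var 4 = k := by rw [hF.var 4 rfl]; simp
    have h5 : τ.var 5 = m := by rw [hF.var 5 rfl]; simp
    have h3 : τ.arr 3 = σ.arr 3 := by rw [hF.arr 3 rfl]; simp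
    have hidx := eval_stateExp (σ := τ) h0 (x := .var 4) (y := .var 5) (z := .var 7) h4 h5 hvz
    have hval : (Exp.get 3 (stateExp (.var 0) (.var 4) (.var 5) (.var 7))).eval τ =
        tableOf n (σ.arr 3) k m z := by
      rw [Exp.eval_get _ hidx, h3, tableOf]
    have haddr : (Exp.get 3 (stateExp (.var 0) (.var 4) (.var 5) (.var 7))).Addr τ :=
      ⟨by simp [stateExp, Exp.Addr], by rw [hidx]; positivity⟩
    refine Runs.of_bounded fun hbd => Runs.branch ⟨haddr, trivial⟩ (by simp [stateExp, Exp.deg])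
      (fun hc => ?_) (fun hc => Runs.skip ?_)
    · rw [Exp.eval, hval, Exp.eval] at hc
      refine Runs.seq (Runs.assign _ hval haddr (by simp [stateExp, Exp.deg]) ?_ ?_)
      · rw [tableOf, ← h3]; exact hbd.arr _ _
      refine Runs.assign z (by simp [Exp.eval, hvz]) trivial (by simp [Exp.deg])
        (by rw [abs_of_nonneg (by positivity)]; omega) ?_
      simp only [Mem.setVar_var, Nat.reduceEqDiff, if_false, if_true]
      refine ⟨fun h h6 h7 => ?_, fun _ => ⟨z, hz1, by omega, rfl, rfl⟩⟩
      rcases (show h ≤ z by omega).eq_or_lt with rfl | h8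
      · exact le_rfl
      · have := hI.1 h h6 h8
        linarith
    · rw [Exp.eval, hval, Exp.eval] at hc
      simp only [Mem.setVar_var, Nat.reduceEqDiff, if_false]
      refine ⟨fun h h6 h7 => ?_, hI.2⟩
      rcases (show h ≤ z by omega).eq_or_lt with rfl | h8
      · linarith
      · exact hI.1 h h6 h8
  · simp only [Mem.setVar_var, Nat.reduceEqDiff, if_false, if_true]
    refine ⟨fun h h1 h2 => by omega, fun h => by omega⟩
  · intro τ hF hτ
    refine ⟨?_, ?_, fun h h1 h2 => hτ.2.1 h h1 (by omega), hτ.2.2⟩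
    · rw [hF.var 4 rfl]; simp
    · rw [hF.var 5 rfl]; simp

end

/-! ### Reconstructing an optimal layout. -/

/-- One step of the reconstruction of the polygon: place the column of the current state, and move
on to the best predecessor of the state. -/
def stepProg : Prog :=
  17 ≔ .var 17 -ₑ .const 1 ;;
  .put 4 (.var 4) (.var 17) ;; .put 5 (.var 4) (.var 16) ;;
  .put 6 (.var 5) (.var 17) ;; .put 7 (.var 5) (.var 16 +ₑ .var 6) ;;
  evalProg ;;
  .branch (.const 3 -ₑ .var 4 -ₑ .var 5) (4 ≔ .const 0)
    (12 ≔ (.var 4 -ₑ .var 9) *ₑ botExp ;; 13 ≔ (.var 5 -ₑ .var 10) *ₑ topExp ;;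
      .branch (.var 12 *ₑ .var 12)
        (.branch (.var 12 *ₑ .var 13)
          (.branch (.var 12) (16 ≔ .var 16 -ₑ (.var 11 -ₑ .const 1))
            (16 ≔ .var 16 -ₑ (.const 1 -ₑ .var 6)))
          (16 ≔ .var 16 -ₑ (.var 11 -ₑ .var 6 +ₑ .var 13)))
        .skip ;;
      4 ≔ .var 9 ;; 5 ≔ .var 10 ;; 6 ≔ .var 11)

/-- Reconstruct the polygon from right to left. -/
def backProg : Prog :=
  selectProg ;; 16 ≔ .const 0 ;; 17 ≔ .const 0 ;;
    .put 4 (.var 2 +ₑ .const 1) (.const 0) ;; .put 6 (.var 3 +ₑ .const 1) (.const 0) ;;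
    .loop (.var 4) stepProg

/-- The invariant of the reconstruction at the state `(i, j, h)`: together with a column of this
state, the columns that have been placed are a layout of area `G i j h + h - b`, where `b` is the
optimal value. -/
structure BackEnv (n k m : ℕ) (f g : ℕ → ℤ) (b : ℤ) (i j h : ℕ) (σ : Mem) : Prop where
  v4 : σ.var 4 = i
  v5 : σ.var 5 = j
  v6 : σ.var 6 = h
  one_le_i : 1 ≤ i
  one_le_j : 1 ≤ j
  one_le_h : 1 ≤ h
  h_le : h ≤ n
  pos : 0 < tableOf n (σ.arr 3) i j h
  height_le : |σ.var 16| ≤ n * (k + m - i - j)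
  left_le : |σ.var 17| ≤ k + m - i - j
  layout : Layout k m f g i j (Function.update (σ.arr 4) i (σ.var 17 - 1))
    (Function.update (σ.arr 5) i (σ.var 16)) (Function.update (σ.arr 6) j (σ.var 17 - 1))
    (Function.update (σ.arr 7) j (σ.var 16 + h))
  area_eq : layoutArea k m i j (Function.update (σ.arr 4) i (σ.var 17 - 1))
    (Function.update (σ.arr 5) i (σ.var 16)) (Function.update (σ.arr 6) j (σ.var 17 - 1))
    (Function.update (σ.arr 7) j (σ.var 16 + h)) = tableOf n (σ.arr 3) i j h + h - b

/-- The arrays `4`, …, `7` hold a layout of area `n ^ 2 - b`. -/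
structure BackDone (n k m : ℕ) (f g : ℕ → ℤ) (b : ℤ) (σ : Mem) : Prop where
  layout : Layout k m f g 1 1 (σ.arr 4) (σ.arr 5) (σ.arr 6) (σ.arr 7)
  area_eq : layoutArea k m 1 1 (σ.arr 4) (σ.arr 5) (σ.arr 6) (σ.arr 7) = n * n - b

theorem Searched.attained_of_ne {n i j h : ℕ} {f g : ℕ → ℤ} {G : ℕ → ℕ → ℕ → ℤ}
    {E : ℕ → ℕ → ℕ → Prop} {b pi pj ph : ℤ} (hs : Searched n f g G i j h E b pi pj ph) (hb : 0 < b)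
    (hij : 2 < i + j) : ∃ di dj h' : ℕ, di ≤ 1 ∧ dj ≤ 1 ∧
    0 < di + dj ∧ 1 ≤ h' ∧ h' ≤ n ∧ Valid (di * f i) (dj * g j) h' h ∧
      b = G (i - di) (j - dj) h' - h ∧ pi = (i - di : ℕ) ∧ pj = (j - dj : ℕ) ∧ ph = h' := by
  rcases hs.attained hb with ⟨h1, h2, -⟩ | h
  · omega
  · exact h

section

variable {B M L n a k m i j h : ℕ} {f g : ℕ → ℤ} {b : ℤ} {σ : Mem}

/-- Predecessors are not stored but recomputed, at linear cost for each column. Prepending the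
predecessor's column adds its height to the area, which matches the recursion for the table, so the
invariant on the area is preserved. -/
theorem runs_stepProg (e : ProgEnv n a k m f g σ) (hM : 4 * n * n ≤ M) (hL : n ≤ L)
    (hG : IsTable n k m f g (tableOf n (σ.arr 3))) (hb : BackEnv n k m f g b i j h σ) :
    Runs B M L stepProg σ (fun τ => (τ.var 4 = 0 ∧ BackDone n k m f g b τ) ∨
      ∃ i' j' h', i' + j' < i + j ∧ BackEnv n k m f g b i' j' h' τ) := by
  have hn := e.n_eq
  have hk := e.one_le_k
  have hm := e.one_le_m
  have hnM : 2 * n ≤ M := by nlinarith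
  have hik := hb.layout.le_k
  have hjm := hb.layout.le_m
  have hi := hb.one_le_i
  have hj := hb.one_le_j
  have hh := hb.one_le_h
  have hhn := hb.h_le
  have h16 := hb.height_le
  have h17 := hb.left_le
  have h16' : |σ.var 16| ≤ n * n := by
    refine h16.trans (mul_le_mul_of_nonneg_left ?_ (by positivity))
    push_cast [hn]
    linarith
  have hnn : ((n : ℤ)) ≤ n * n := by
    have : n ≤ n * n := Nat.le_mul_of_pos_left n (by omega)
    exact_mod_cast this
  have hMz : (4 : ℤ) * n * n ≤ M := by exact_mod_cast hM
  unfold stepProg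
  refine Runs.seq (Runs.assign (σ.var 17 - 1) (by simp [Exp.eval]) (by simp [Exp.Addr])
    (by simp [Exp.deg]) (by rw [abs_le] at h17 ⊢; constructor <;> linarith) ?_)
  refine Runs.seq (Runs.put i (σ.var 17 - 1) (by simp [Exp.eval, hb.v4]) (by simp [Exp.eval])
    trivial (by simp [Exp.deg]) trivial (by simp [Exp.deg])
    (by rw [abs_le] at h17 ⊢; constructor <;> linarith) ?_)
  refine Runs.seq (Runs.put i (σ.var 16) (by simp [Exp.eval, hb.v4]) (by simp [Exp.eval])
    trivial (by simp [Exp.deg]) trivial (by simp [Exp.deg]) (by linarith) ?_)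
  refine Runs.seq (Runs.put j (σ.var 17 - 1) (by simp [Exp.eval, hb.v5]) (by simp [Exp.eval])
    trivial (by simp [Exp.deg]) trivial (by simp [Exp.deg])
    (by rw [abs_le] at h17 ⊢; constructor <;> linarith) ?_)
  refine Runs.seq (Runs.put j (σ.var 16 + h) (by simp [Exp.eval, hb.v5]) (by simp [Exp.eval, hb.v6])
    trivial (by simp [Exp.deg]) (by simp [Exp.Addr]) (by simp [Exp.deg])
    (by rw [abs_le] at h16' ⊢; constructor <;> linarith) ?_)
  set σ' := ((((σ.setVar 17 (σ.var 17 - 1)).setArr 4 i (σ.var 17 - 1)).setArr 5 i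
    (σ.var 16)).setArr 6 j (σ.var 17 - 1)).setArr 7 j (σ.var 16 + h) with hσ'
  have a0 : σ'.arr 0 = σ.arr 0 := by simp [hσ', Mem.setArr_arr]
  have a3 : σ'.arr 3 = σ.arr 3 := by simp [hσ', Mem.setArr_arr]
  have a4 : σ'.arr 4 = Function.update (σ.arr 4) i (σ.var 17 - 1) := by simp [hσ', Mem.setArr_arr]
  have a5 : σ'.arr 5 = Function.update (σ.arr 5) i (σ.var 16) := by simp [hσ', Mem.setArr_arr]
  have a6 : σ'.arr 6 = Function.update (σ.arr 6) j (σ.var 17 - 1) := by simp [hσ', Mem.setArr_arr]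
  have a7 : σ'.arr 7 = Function.update (σ.arr 7) j (σ.var 16 + h) := by simp [hσ', Mem.setArr_arr]
  have v17 : σ'.var 17 = σ.var 17 - 1 := by simp [hσ']
  have hv : ∀ x, x ≠ 17 → σ'.var x = σ.var x := fun x hx => by simp [hσ', hx]
  clear_value σ'
  have hlay := hb.layout
  have harea := hb.area_eq
  rw [← a4, ← a5, ← a6, ← a7] at hlay harea
  have htab := hb.pos
  rw [← a3] at htab harea hG
  have e' : ProgEnv n a k m f g σ' := { e with
    v0 := (hv 0 (by decide)).trans e.v0
    v1 := (hv 1 (by decide)).trans e.v1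
    v2 := (hv 2 (by decide)).trans e.v2
    v3 := (hv 3 (by decide)).trans e.v3
    f_eq := by rw [a0]; exact e.f_eq
    g_eq := by rw [a0]; exact e.g_eq }
  have es := e'.stateEnv ((hv 4 (by decide)).trans hb.v4) ((hv 5 (by decide)).trans hb.v5)
    ((hv 6 (by decide)).trans hb.v6) hi hik hj hjm hh hhn
  have y4 : σ'.arr 4 i = σ'.var 17 := by rw [a4, Function.update_self, v17]
  have y5 : σ'.arr 5 i = σ'.var 16 := by rw [a5, Function.update_self, hv 16 (by decide)]
  have y7 : σ'.arr 7 j = σ'.var 16 + h := by rw [a7, Function.update_self, hv 16 (by decide)]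
  rw [← hv 16 (by decide)] at h16 h16'
  replace h17 : |σ'.var 17| ≤ k + m - i - j + 1 := by
    rw [v17]
    rw [abs_le] at h17 ⊢
    constructor <;> linarith
  clear a4 a5 a6 a7 a0 a3 hv v17 hb e
  refine Runs.seq ((runs_evalProg es hM hL).mono fun τ hF hs => ?_)
  have es' := hF.stateEnv es rfl
  -- The recomputed value equals the stored one, so the predecessor found attains the table entry.
  have hbest : tableOf n (σ'.arr 3) i j h ≤ τ.var 8 :=
    (hG.best i j h hi hik hj hjm hh hhn).le hs.isBest
  have hbest' : τ.var 8 ≤ tableOf n (σ'.arr 3) i j h :=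
    hs.isBest.le (hG.best i j h hi hik hj hjm hh hhn)
  have t3 : τ.arr 3 = σ'.arr 3 := hF.arr 3 rfl
  have t16 : τ.var 16 = σ'.var 16 := hF.var 16 rfl
  have t17 : τ.var 17 = σ'.var 17 := hF.var 17 rfl
  have t4 : τ.arr 4 = σ'.arr 4 := hF.arr 4 rfl
  have t5 : τ.arr 5 = σ'.arr 5 := hF.arr 5 rfl
  have t6 : τ.arr 6 = σ'.arr 6 := hF.arr 6 rfl
  have t7 : τ.arr 7 = σ'.arr 7 := hF.arr 7 rfl
  rw [← t4, ← t5, ← t6, ← t7] at hlay harea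
  rw [← t4, ← t17] at y4
  rw [← t5, ← t16] at y5
  rw [← t7, ← t16] at y7
  rw [← t16] at h16 h16'
  rw [← t17] at h17
  rw [← t3] at hG hs hbest hbest' htab harea
  clear t3 t4 t5 t6 t7 t16 t17 es e' hF hσ'
  refine Runs.branch (by simp [Exp.Addr]) (by simp [Exp.deg]) (fun hc => ?_) (fun hc => ?_)
  · simp only [Exp.eval, es'.v4, es'.v5] at hc
    obtain rfl : i = 1 := by omega
    obtain rfl : j = 1 := by omega
    refine Runs.assign 0 rfl trivial (by simp [Exp.deg]) (by simp)
      (Or.inl ⟨by simp, ⟨hlay, ?_⟩⟩)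
    have hval : tableOf n (τ.arr 3) 1 1 h = n * n - h := by
      rcases (hG.best 1 1 h hi hik hj hjm hh hhn).attained htab with ⟨-, -, h1⟩ |
        ⟨di, dj, h', h1, h2, h3, h4, h5, -, h6⟩
      · exact h1
      -- A predecessor of `(1, 1)` has index `0` and value `0`, which would make the entry negative.
      · exfalso
        have : tableOf n (τ.arr 3) (1 - di) (1 - dj) h' = 0 := by
          rcases (show di = 1 ∨ dj = 1 by omega) with rfl | rfl
          · exact hG.zero_left _ _ (by omega) h4 h5
          · exact hG.zero_right _ _ (by omega) h4 h5
        rw [this] at h6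
        omega
    simp only [Mem.setVar_arr]
    rw [harea, hval]
    ring
  simp only [Exp.eval, es'.v4, es'.v5] at hc
  obtain ⟨di, dj, h', hdi, hdj, hd, h1, h2, hval, hG', p9, p10, p11⟩ :=
    hs.attained_of_ne (by linarith) (by omega)
  have hGpos : 0 < tableOf n (τ.arr 3) (i - di) (j - dj) h' := by linarith
  -- A positive value rules out predecessors on the zero border of the table.
  have hidi : di < i := by
    by_contra hcon
    have h0 := hG.zero_left (j - dj) h' (by omega) h1 h2
    rw [show i - di = 0 by omega, h0] at hGpos
    exact lt_irrefl _ hGpos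
  have hjdj : dj < j := by
    by_contra hcon
    have h0 := hG.zero_right (i - di) h' (by omega) h1 h2
    rw [show j - dj = 0 by omega, h0] at hGpos
    exact lt_irrefl _ hGpos
  have hpm : ∀ (d : ℕ) (x : ℤ), d ≤ 1 → (x = 1 ∨ x = -1) →
      (d * x = -1 ∨ d * x = 0 ∨ d * x = 1) ∧ (d ≠ 0 → d * x ≠ 0) := by
    intro d x h1 h2
    interval_cases d <;> rcases h2 with rfl | rfl <;> simp
  have hdu := hpm di _ hdi es'.f_pm
  have hdt := hpm dj _ hdj es'.g_pm
  obtain ⟨s1, s2, s3, s4⟩ := bottomStep_spec hdu.1 hdt.1 (by omega) (by omega) (by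
    rcases Nat.eq_zero_or_pos di with h0 | h0
    · exact Or.inr (hdt.2 (by omega))
    · exact Or.inl (hdu.2 (by omega))) hval
  have hbi : (Exp.var 1 +ₑ .const 2 *ₑ .var 4 -ₑ .const 2).eval τ = (a + 2 * i - 2 : ℕ) := by
    simp only [Exp.eval, es'.v1, es'.v4]
    omega
  have hjn := es'.j_le
  have hti : ∀ z, (Exp.var 1 +ₑ .var 0 +ₑ .const 2 -ₑ .const 2 *ₑ .var 5).eval (τ.setVar 12 z) =
      (a + n + 2 - 2 * j : ℕ) := fun z => by
    simp only [Exp.eval, Mem.setVar_var, Nat.reduceEqDiff, if_false, es'.v1, es'.v0, es'.v5]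
    omega
  have habs : ∀ x : ℤ, (x = -1 ∨ x = 0 ∨ x = 1) → |x| ≤ M := by
    intro x hx
    rw [abs_le]
    omega
  refine Runs.seq (Runs.assign (di * f i) ?_ ⟨by simp [Exp.Addr], by simp [Exp.Addr],
    by rw [hbi]; positivity⟩ (by simp [botExp, Exp.deg]) (habs _ hdu.1) ?_)
  · rw [Exp.eval, botExp, Exp.eval_get _ hbi, es'.f_eq, Exp.eval, Exp.eval, Exp.eval, es'.v4, p9]
    congr 1
    omega
  refine Runs.seq (Runs.assign (dj * g j) ?_ ⟨by simp [Exp.Addr], by simp [Exp.Addr],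
    by rw [hti]; positivity⟩ (by simp [topExp, Exp.deg]) (habs _ hdt.1) ?_)
  · rw [Exp.eval, topExp, Exp.eval_get _ (hti _), Mem.setVar_arr, es'.g_eq]
    simp only [Exp.eval, Mem.setVar_var, Nat.reduceEqDiff, if_false, es'.v5, p10]
    congr 1
    omega
  set ρ := (τ.setVar 12 (di * f i)).setVar 13 (dj * g j) with hρ
  have r12 : ρ.var 12 = di * f i := by simp [hρ]
  have r13 : ρ.var 13 = dj * g j := by simp [hρ]
  have rv : ∀ x, x ≠ 12 → x ≠ 13 → ρ.var x = τ.var x := fun x h1 h2 => by simp [hρ, h1, h2]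
  have ra : ρ.arr = τ.arr := rfl
  clear_value ρ
  set δ := bottomStep (di * f i) (dj * g j) h' h with hδ
  -- The bottom moves by less than one of the two column heights, hence by less than `n`, while `i +
  -- j` drops by at least one. This keeps coordinates quadratic in `n`.
  have hbound : |τ.var 16 - δ| ≤ n * (k + m - (i - di : ℕ) - (j - dj : ℕ)) := by
    rw [Nat.cast_sub hidi.le, Nat.cast_sub hjdj.le]
    have h3 : (n : ℤ) * (k + m - i - j) + n ≤ n * (k + m - (i - di) - (j - dj)) := by
      have : (n : ℤ) * (k + m - i - j + 1) ≤ n * (k + m - (i - di) - (j - dj)) := by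
        refine mul_le_mul_of_nonneg_left ?_ (by positivity)
        omega
      linarith
    rw [abs_le] at h16 ⊢
    constructor <;> linarith
  have hbound' : |τ.var 16 - δ| ≤ M := by
    rw [abs_le] at h16' ⊢
    constructor <;> linarith
  have hstep : Runs B M L (.branch (.var 12 *ₑ .var 12)
        (.branch (.var 12 *ₑ .var 13)
          (.branch (.var 12) (16 ≔ .var 16 -ₑ (.var 11 -ₑ .const 1))
            (16 ≔ .var 16 -ₑ (.const 1 -ₑ .var 6)))
          (16 ≔ .var 16 -ₑ (.var 11 -ₑ .var 6 +ₑ .var 13)))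
        .skip) ρ (fun π => π.var 16 = τ.var 16 - δ) := by
    have r6 : ρ.var 6 = h := (rv 6 (by decide) (by decide)).trans es'.v6
    have r11 : ρ.var 11 = h' := (rv 11 (by decide) (by decide)).trans p11
    have r16 : ρ.var 16 = τ.var 16 := rv 16 (by decide) (by decide)
    refine Runs.branch (by simp [Exp.Addr]) (by simp [Exp.deg]) (fun c1 => ?_) (fun c1 => ?_)
    · simp only [Exp.eval, r12] at c1
      refine Runs.branch (by simp [Exp.Addr]) (by simp [Exp.deg]) (fun c2 => ?_) (fun c2 => ?_)
      · simp only [Exp.eval, r12, r13] at c2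
        refine Runs.branch (by simp [Exp.Addr]) (by simp [Exp.deg]) (fun c3 => ?_) (fun c3 => ?_)
        · simp only [Exp.eval, r12] at c3
          refine Runs.assign _ ?_ (by simp [Exp.Addr]) (by simp [Exp.deg]) hbound' (by simp)
          rw [hδ, bottomStep, if_pos c1, if_pos c2, if_pos c3]
          simp only [Exp.eval, r16, r11]
        · simp only [Exp.eval, r12] at c3
          refine Runs.assign _ ?_ (by simp [Exp.Addr]) (by simp [Exp.deg]) hbound' (by simp)
          rw [hδ, bottomStep, if_pos c1, if_pos c2, if_neg c3.not_gt]
          simp only [Exp.eval, r16, r6]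
      · simp only [Exp.eval, r12, r13] at c2
        refine Runs.assign _ ?_ (by simp [Exp.Addr]) (by simp [Exp.deg]) hbound' (by simp)
        rw [hδ, bottomStep, if_pos c1, if_neg c2.not_gt]
        simp only [Exp.eval, r16, r6, r11, r13]
    · simp only [Exp.eval, r12] at c1
      refine Runs.skip ?_
      rw [hδ, bottomStep, if_neg c1.not_gt, r16, sub_zero]
  refine Runs.seq (hstep.mono fun π hF h16π => ?_)
  have πv : ∀ x, x ≠ 12 → x ≠ 13 → x ≠ 16 → π.var x = τ.var x := fun x x1 x2 x3 => by
    rw [hF.var x (by simp [Prog.assigns, x3]), rv x x1 x2]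
  have πa : π.arr = τ.arr := by
    rw [← ra]
    exact funext fun x => hF.arr x rfl
  have q9 := (πv 9 (by decide) (by decide) (by decide)).trans p9
  have q10 := (πv 10 (by decide) (by decide) (by decide)).trans p10
  have q11 := (πv 11 (by decide) (by decide) (by decide)).trans p11
  have q17 := πv 17 (by decide) (by decide) (by decide)
  clear_value δ
  refine Runs.seq (Runs.assign ((i - di : ℕ) : ℤ) q9 trivial (by simp [Exp.deg])
    (by rw [abs_of_nonneg (by positivity)]; omega) ?_)
  refine Runs.seq (Runs.assign ((j - dj : ℕ) : ℤ) (by simpa [Exp.eval] using q10) trivial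
    (by simp [Exp.deg]) (by rw [abs_of_nonneg (by positivity)]; omega) ?_)
  refine Runs.assign (h' : ℤ) (by simpa [Exp.eval] using q11) trivial
    (by simp [Exp.deg]) (by rw [abs_of_nonneg (by positivity)]; omega) ?_
  refine Or.inr ⟨i - di, j - dj, h', by omega, ?_⟩
  have hi0 : i - di + di = i := by omega
  have hj0 : j - dj + dj = j := by omega
  have hlay' : Layout k m f g (i - di + di) (j - dj + dj) (τ.arr 4) (τ.arr 5) (τ.arr 6)
      (τ.arr 7) := by
    rw [hi0, hj0]
    exact hlay
  obtain ⟨hlay₂, harea₂⟩ := hlay'.extend (z := τ.var 17) (b := τ.var 16 - δ)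
    (t := τ.var 16 - δ + h') hdi hdj (by rw [hi0, y4]) (by omega) (by rw [hj0, y7]; omega)
    (by rw [hi0, y5]; omega) (by rw [hi0, y5, ← s1]; congr 1; ring)
    (by rw [hj0, y7, ← s2]; congr 1; ring)
  rw [hi0, hj0, harea] at harea₂
  have u16 : (((π.setVar 4 ((i - di : ℕ) : ℤ)).setVar 5 ((j - dj : ℕ) : ℤ)).setVar 6 h').var 16 =
      τ.var 16 - δ := by simp [h16π]
  have u17 : (((π.setVar 4 ((i - di : ℕ) : ℤ)).setVar 5 ((j - dj : ℕ) : ℤ)).setVar 6 h').var 17 =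
      τ.var 17 := by simp [q17]
  have ua : (((π.setVar 4 ((i - di : ℕ) : ℤ)).setVar 5 ((j - dj : ℕ) : ℤ)).setVar 6 h').arr =
      τ.arr := πa
  refine ⟨by simp, by simp, by simp, by omega, by omega, h1, h2, by rwa [ua], by rwa [u16], ?_,
    by rwa [u16, u17, ua], ?_⟩
  · rw [u17]
    push_cast [hidi.le, hjdj.le]
    rw [abs_le] at h17 ⊢
    omega
  · rw [u16, u17, ua, harea₂]
    linarith

theorem runs_backProg (e : ProgEnv n a k m f g σ) (hM : 4 * n * n ≤ M) (hL : n ≤ L)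
    (hG : IsTable n k m f g (tableOf n (σ.arr 3)))
    (hpos : ∃ H, 1 ≤ H ∧ H ≤ n ∧ 0 < tableOf n (σ.arr 3) k m H) :
    Runs B M L backProg σ (fun τ => ∃ b, BackDone n k m f g b τ ∧
      ∀ h, 1 ≤ h → h ≤ n → tableOf n (σ.arr 3) k m h ≤ b) := by
  have hn := e.n_eq
  have hk := e.one_le_k
  have hm := e.one_le_m
  have hnM : 2 * n ≤ M := by nlinarith
  unfold backProg
  refine Runs.seq ((runs_selectProg e hM hL).mono fun τ hF hs => ?_)
  obtain ⟨v4, v5, hle, hatt⟩ := hs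
  obtain ⟨H₀, h1, h2, h3⟩ := hpos
  obtain ⟨H, h4, h5, v6, hH⟩ := hatt (h3.trans_le (hle H₀ h1 h2))
  have hHpos : 0 < tableOf n (σ.arr 3) k m H := by rw [hH]; exact h3.trans_le (hle H₀ h1 h2)
  have e := hF.progEnv e rfl
  have t3 : τ.arr 3 = σ.arr 3 := hF.arr 3 rfl
  rw [← t3] at hle hH hHpos hG
  rw [← t3]
  clear hF h3 hatt t3
  refine Runs.seq (Runs.assign 0 rfl trivial (by simp [Exp.deg]) (by simp) ?_)
  refine Runs.seq (Runs.assign 0 rfl trivial (by simp [Exp.deg]) (by simp) ?_)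
  refine Runs.seq (Runs.put (k + 1) 0 (by simp [Exp.eval, e.v2]) rfl (by simp [Exp.Addr])
    (by simp [Exp.deg]) trivial (by simp [Exp.deg]) (by simp) ?_)
  refine Runs.seq (Runs.put (m + 1) 0 (by simp [Exp.eval, e.v3]) rfl (by simp [Exp.Addr])
    (by simp [Exp.deg]) trivial (by simp [Exp.deg]) (by simp) ?_)
  set ρ := (((τ.setVar 16 0).setVar 17 0).setArr 4 (k + 1) 0).setArr 6 (m + 1) 0 with hρ
  have r3 : ρ.arr 3 = τ.arr 3 := by simp [hρ, Mem.setArr_arr]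
  have r4 : ρ.arr 4 = Function.update (τ.arr 4) (k + 1) 0 := by simp [hρ, Mem.setArr_arr]
  have r6 : ρ.arr 6 = Function.update (τ.arr 6) (m + 1) 0 := by simp [hρ, Mem.setArr_arr]
  have r16 : ρ.var 16 = 0 := by simp [hρ]
  have r17 : ρ.var 17 = 0 := by simp [hρ]
  have rv : ∀ x, x ≠ 16 → x ≠ 17 → ρ.var x = τ.var x := fun x h1 h2 => by simp [hρ, h1, h2]
  have r0 : ρ.arr 0 = τ.arr 0 := by simp [hρ, Mem.setArr_arr]
  clear_value ρ
  have e' : ProgEnv n a k m f g ρ := { e with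
    v0 := (rv 0 (by decide) (by decide)).trans e.v0
    v1 := (rv 1 (by decide) (by decide)).trans e.v1
    v2 := (rv 2 (by decide) (by decide)).trans e.v2
    v3 := (rv 3 (by decide) (by decide)).trans e.v3
    f_eq := by rw [r0]; exact e.f_eq
    g_eq := by rw [r0]; exact e.g_eq }
  have hstart : BackEnv n k m f g (τ.var 8) k m H ρ := by
    refine ⟨(rv 4 (by decide) (by decide)).trans v4, (rv 5 (by decide) (by decide)).trans v5,
      (rv 6 (by decide) (by decide)).trans v6, hk, hm, h4, h5, by rwa [r3], by simp [r16],
      by simp [r17], ?_, ?_⟩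
    · refine Layout.column k m f g ?_ ?_ ?_ ?_ <;>
        simp [r4, r6, r16, r17]
      omega
    · simp [layoutArea, r4, r6, r16, r17, r3, hH]
  -- The sum `i + j` decreases in every repetition; setting `var 4` to `0` ends the loop.
  refine (Runs.loop (fun z π => (π.var 4 = 0 ∧ BackDone n k m f g (τ.var 8) π) ∨
    ∃ i j h, i + j ≤ z ∧ BackEnv n k m f g (τ.var 8) i j h π) (k + m) (by omega)
    (by simp [Exp.deg]) ?_ (Or.inr ⟨k, m, H, le_rfl, hstart⟩)).mono ?_
  · intro z π hF hI
    have eπ := hF.progEnv e' rfl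
    have π3 : π.arr 3 = τ.arr 3 := (hF.arr 3 rfl).trans r3
    refine ⟨trivial, fun hc => ?_⟩
    rcases hI with ⟨hI, -⟩ | ⟨i, j, h, hij, hI⟩
    · rw [Exp.eval, hI] at hc
      exact absurd hc (lt_irrefl _)
    refine ⟨by have := hI.one_le_i; omega, (runs_stepProg eπ hM hL (by rwa [π3]) hI).mono ?_⟩
    rintro π' - (h | ⟨i', j', h', hij', h⟩)
    · exact Or.inl h
    · exact Or.inr ⟨i', j', h', by omega, h⟩
  · rintro π - ⟨⟨z, hI⟩, hc⟩
    refine ⟨τ.var 8, ?_, hle⟩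
    rcases hI with ⟨-, hI⟩ | ⟨i, j, h, -, hI⟩
    · exact hI
    · have := hI.one_le_i
      rw [Exp.eval, hI.v4] at hc
      omega

end

/-! ### Reading the input -/

/-- The sum of the turns at the ends of the horizontal edge that starts at position `a + 2 * i`. -/
def pairSum (s : ℕ → ℤ) (a i : ℕ) : ℤ := s (a + 2 * i) + s (a + 2 * i + 1)

/-- The edge at position `a` can be the left edge. -/
def IsLeft (N : ℕ) (s : ℕ → ℤ) (a : ℕ) : Prop :=
  2 ≤ pairSum s a 0 ∧ ∀ i < N, 0 ≤ pairSum s a i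

theorem sum_pairSum (s : ℕ → ℤ) (a N : ℕ) :
    ∑ i ∈ Finset.range N, pairSum s a i = ∑ q ∈ Finset.range (2 * N), s (q + a) := by
  induction N with
  | zero => rfl
  | succ N ih =>
    rw [Finset.sum_range_succ, ih, show 2 * (N + 1) = 2 * N + 1 + 1 by ring, Finset.sum_range_succ,
      Finset.sum_range_succ, pairSum, show 2 * N + 1 + a = a + 2 * N + 1 by ring, add_comm a]
    ring

section

variable {k m a : ℕ} {s : ℕ → ℤ}

theorem TurnPattern.pairSum_zero (h : TurnPattern k m fun q => s (a + 1 + q))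
    (hs : ∀ q, s (q + 2 * (k + m)) = s q) : pairSum s a 0 = 2 := by
  have hk := h.le_k
  have h1 := h.first
  have h2 := h.last
  simp only [show a + 1 + (2 * (k + m) - 1) = a + 2 * (k + m) by omega, hs] at h2
  simp only [pairSum, mul_zero, add_zero] at h1 ⊢
  rw [h1, h2]
  rfl

theorem TurnPattern.pairSum_right (h : TurnPattern k m fun q => s (a + 1 + q)) :
    pairSum s a k = 2 := by
  have hk := h.le_k
  have h1 := h.right_fst
  have h2 := h.right_snd
  simp only [show a + 1 + (2 * k - 1) = a + 2 * k by omega] at h1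
  simp only [show a + 1 + 2 * k = a + 2 * k + 1 by omega] at h2
  rw [pairSum, h1, h2]
  rfl

theorem TurnPattern.pairSum_eq_zero (h : TurnPattern k m fun q => s (a + 1 + q)) {i : ℕ}
    (h1 : 1 ≤ i) (h2 : i ≠ k) (h3 : i < k + m) : pairSum s a i = 0 := by
  have h4 := h.vert i h1 h3 h2
  simp only [show a + 1 + (2 * i - 1) = a + 2 * i by omega,
    show a + 1 + 2 * i = a + 2 * i + 1 by omega] at h4
  rw [pairSum, h4]
  ring

theorem TurnPattern.isLeft (h : TurnPattern k m fun q => s (a + 1 + q))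
    (hs : ∀ q, s (q + 2 * (k + m)) = s q) : IsLeft (k + m) s a := by
  refine ⟨(h.pairSum_zero hs).ge, fun i hi => ?_⟩
  rcases Nat.eq_zero_or_pos i with rfl | h0
  · rw [h.pairSum_zero hs]; norm_num
  · by_cases h1 : i = k
    · rw [h1, h.pairSum_right]; norm_num
    · exact (h.pairSum_eq_zero h0 h1 hi).ge

/-- The left and the right edge contribute `2` each and all other vertical edges cancel. This total
is what lets the right edge be recovered from any admissible left edge. -/
theorem TurnPattern.sum_eq (h : TurnPattern k m fun q => s (a + 1 + q))
    (hs : ∀ q, s (q + 2 * (k + m)) = s q) : ∑ q ∈ Finset.range (2 * (k + m)), s q = 4 := by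
  have hk := h.le_k
  have hm := h.le_m
  rw [← sum_range_shift hs a, ← sum_pairSum]
  have h1 : ∑ i ∈ Finset.range (k + m), pairSum s a i =
      ∑ i ∈ Finset.range (k + m), ((if i = 0 then 2 else 0) + if i = k then 2 else 0) := by
    refine Finset.sum_congr rfl fun i hi => ?_
    rw [Finset.mem_range] at hi
    by_cases h0 : i = 0
    · rw [if_pos h0, if_neg (by omega), h0, h.pairSum_zero hs]; rfl
    · by_cases h1 : i = k
      · rw [if_neg h0, if_pos h1, h1, h.pairSum_right]; rfl
      · rw [if_neg h0, if_neg h1, h.pairSum_eq_zero (by omega) h1 hi]; rfl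
  rw [h1, Finset.sum_add_distrib, Finset.sum_ite_eq', Finset.sum_ite_eq', if_pos, if_pos]
  · norm_num
  all_goals rw [Finset.mem_range]; omega

/-- If a left edge is guessed correctly, the right edge is determined. -/
theorem IsLeft.exists_turnPattern {N : ℕ} (h : IsLeft N s a) (hN : 0 < N)
    (hs : ∀ q, s (q + 2 * N) = s q) (hpm : ∀ q, s q = 1 ∨ s q = -1)
    (hsum : ∑ q ∈ Finset.range (2 * N), s q = 4) :
    ∃ k, k < N ∧ TurnPattern k (N - k) fun q => s (a + 1 + q) := by
  rw [← sum_range_shift hs a, ← sum_pairSum] at hsum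
  -- A nonnegative sum of two signs is `0` or `2`.
  have hQ : ∀ i < N, pairSum s a i = 0 ∨ pairSum s a i = 2 := fun i hi => by
    have h1 := h.2 i hi
    unfold pairSum at h1 ⊢
    have h2 := hpm (a + 2 * i)
    have h3 := hpm (a + 2 * i + 1)
    omega
  obtain ⟨N, rfl⟩ : ∃ M, N = M + 1 := ⟨N - 1, by omega⟩
  have h0 : pairSum s a 0 = 2 := by
    have := h.1
    have := hQ 0 hN
    omega
  rw [Finset.sum_range_succ', h0] at hsum
  -- The total is `4` and the left edge accounts for `2`, so exactly one further pair has sum `2`: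
  -- the right edge.
  obtain ⟨k, hk, hk2⟩ : ∃ k < N, pairSum s a (k + 1) = 2 := by
    by_contra! hcon
    rw [Finset.sum_eq_zero] at hsum
    · omega
    · intro i hi
      rw [Finset.mem_range] at hi
      exact (hQ (i + 1) (by omega)).resolve_right (hcon i hi)
  rw [← Finset.add_sum_erase _ _ (Finset.mem_range.2 hk), hk2] at hsum
  have hz := (Finset.sum_eq_zero_iff_of_nonneg (s := (Finset.range N).erase k)
    (f := fun i => pairSum s a (i + 1)) fun i hi => h.2 _ (by
      have := Finset.mem_range.1 (Finset.mem_of_mem_erase hi)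
      omega)).1 (by linarith)
  have htwo : ∀ i, pairSum s a i = 2 → s (a + 2 * i) = 1 ∧ s (a + 2 * i + 1) = 1 := fun i hi => by
    unfold pairSum at hi
    have h2 := hpm (a + 2 * i)
    have h3 := hpm (a + 2 * i + 1)
    omega
  have e0 := htwo 0 h0
  have ek := htwo _ hk2
  refine ⟨k + 1, by omega, by omega, by omega, fun i => hpm _, e0.2, ?_, ?_, ?_, ?_⟩
  · have := e0.1
    rw [mul_zero, add_zero, ← hs] at this
    rw [← this]
    congr 1
    omega
  · rw [← ek.1]
    congr 1
    omega
  · rw [← ek.2]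
    congr 1
    omega
  · intro i h1 h2 h3
    have h4 := hz (i - 1) (Finset.mem_erase.2 ⟨by omega, Finset.mem_range.2 (by omega)⟩)
    simp only [show i - 1 + 1 = i by omega, pairSum] at h4
    simp only [show a + 1 + (2 * i - 1) = a + 2 * i by omega,
      show a + 1 + 2 * i = a + 2 * i + 1 by omega]
    linarith

end

/-! ### Programs for reading the turns, which store two periods to avoid cyclic indices. -/

/-- Duplicate the sequence of turns. -/
def extendProg : Prog :=
  4 ≔ .const 0 ;; .upTo 4 (.var 0 -ₑ .var 4) (.put 0 (.var 0 +ₑ .var 4) (.get 0 (.var 4)))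

/-- The sum of the turns at the ends of the horizontal edge that starts at `x + 2 * var 4`. -/
def pairExp (x : ℕ) : Exp :=
  .get 0 (.var x +ₑ .const 2 *ₑ .var 4) +ₑ .get 0 (.var x +ₑ .const 2 *ₑ .var 4 +ₑ .const 1)

/-- Test whether the edge at position `var 5` can be the left edge; `var 7` is `0` if it can be. -/
def testProg : Prog :=
  4 ≔ .const 0 ;;
  .branch (.const 2 -ₑ pairExp 5) (7 ≔ .const 1) (7 ≔ .const 0) ;;
  .upTo 4 (.var 0 -ₑ .const 2 *ₑ .var 4) (.branch (.const 0 -ₑ pairExp 5) (7 ≔ .const 1) .skip)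

/-- Find the left edge. -/
def findProg : Prog :=
  5 ≔ .const 0 ;; .upTo 5 (.var 0 -ₑ .var 5)
    (testProg ;; .branch (.const 1 -ₑ .var 7) (1 ≔ .var 5) .skip)

/-- Find the right edge. -/
def chainProg : Prog :=
  4 ≔ .const 1 ;; .upTo 4 (.var 0 -ₑ .const 2 *ₑ .var 4)
    (.branch (pairExp 1 -ₑ .const 1) (2 ≔ .var 4) .skip) ;;
  3 ≔ .var 4 -ₑ .var 2

/-- Find the parameters of the dynamic program. -/
def parseProg : Prog := extendProg ;; findProg ;; chainProg

section

variable {B M L n N a : ℕ} {s : ℕ → ℤ} {σ : Mem}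

theorem runs_extendProg (hn : 0 < n) (hM : 2 * n ≤ M) (hL : n ≤ L) (hs : ∀ q, s (q + n) = s q)
    (h0 : σ.var 0 = n) (hσ : ∀ q < n, σ.arr 0 q = s q) :
    Runs B M L extendProg σ (fun τ => ∀ q < 2 * n, τ.arr 0 q = s q) := by
  unfold extendProg
  refine Runs.seq (Runs.assign 0 rfl trivial (by simp [Exp.deg]) (by simp) ?_)
  refine (Runs.upTo (fun z τ => ∀ q < n + z, τ.arr 0 q = s q) 0 n (by omega) (by omega) (by omega)
    (by simp [Exp.deg]) rfl (by simp) ?_ ?_ (by simpa using hσ)).mono fun τ _ hτ q hq => hτ.2 q (by omega)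
  · intro z τ hF hz hz'
    have h0 : τ.var 0 = n := by rw [hF.var 0 rfl]; simp [h0]
    refine ⟨by simp [Exp.Addr], ?_⟩
    simp only [Exp.eval, h0, hz']
    omega
  · intro z τ hF hz1 hz2 hz hI
    have h0 : τ.var 0 = n := by rw [hF.var 0 rfl]; simp [h0]
    have hg : (Exp.get 0 (.var 4)).eval τ = s z := by
      rw [Exp.eval_get (i := .var 4) z hz, hI z (by omega)]
    refine Runs.of_bounded fun hb => Runs.put (n + z) (s z) (by simp [Exp.eval, h0, hz]) hg
      (by simp [Exp.Addr]) (by simp [Exp.deg]) ⟨trivial, by simp [Exp.eval, hz]⟩ (by simp [Exp.deg])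
      ?_ fun q hq => ?_
    · rw [← hI z (by omega)]; exact hb.arr _ _
    · simp only [Mem.setVar_arr, Mem.setArr_arr, if_true, Function.update_apply]
      split_ifs with hc
      · rw [hc, add_comm, hs]
      · exact hI q (by omega)

theorem deg_pairExp (x : ℕ) : (pairExp x).deg ≤ 8 := by simp [pairExp, Exp.deg]

theorem eval_pairExp {τ : Mem} {x i : ℕ} (hx : τ.var x = a) (h4 : τ.var 4 = i)
    (hτ : ∀ q < 4 * N, τ.arr 0 q = s q) (ha : a < 2 * N) (hi : i < N) :
    (pairExp x).Addr τ ∧ (pairExp x).eval τ = pairSum s a i := by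
  have h1 : (Exp.var x +ₑ .const 2 *ₑ .var 4).eval τ = (a + 2 * i : ℕ) := by
    simp [Exp.eval, hx, h4]
  have h2 : (Exp.var x +ₑ .const 2 *ₑ .var 4 +ₑ .const 1).eval τ = (a + 2 * i + 1 : ℕ) := by
    simp [Exp.eval, hx, h4]
  refine ⟨⟨⟨by simp [Exp.Addr], by rw [h1]; positivity⟩, ⟨by simp [Exp.Addr], ?_⟩⟩, ?_⟩
  · rw [h2]; positivity
  · rw [pairExp, Exp.eval, Exp.eval_get _ h1, Exp.eval_get _ h2, hτ _ (by omega), hτ _ (by omega),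
      pairSum]

theorem runs_testProg (hM : 2 * N ≤ M) (hL : 2 * N ≤ L) (h0 : σ.var 0 = (2 * N : ℕ))
    (h5 : σ.var 5 = a) (ha : a < 2 * N) (hσ : ∀ q < 4 * N, σ.arr 0 q = s q) :
    Runs B M L testProg σ (fun τ => (τ.var 7 = 0 ∨ τ.var 7 = 1) ∧
      (τ.var 7 = 0 ↔ IsLeft N s a)) := by
  unfold testProg
  refine Runs.seq (Runs.assign 0 rfl trivial (by simp [Exp.deg]) (by simp) ?_)
  obtain ⟨p1, p2⟩ := eval_pairExp (τ := σ.setVar 4 0) (x := 5) (i := 0) (by simpa using h5)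
    (by simp) hσ ha (by omega)
  have hd := deg_pairExp 5
  have hd' : ∀ c : ℤ, c.natAbs ≤ 2 → (Exp.const c -ₑ pairExp 5).deg ≤ 16 := fun c hc => by
    simp only [Exp.deg]
    omega
  refine Runs.seq ((?_ : Runs B M L _ (σ.setVar 4 0) (fun τ => (τ.var 7 = 0 ∨ τ.var 7 = 1) ∧
    (τ.var 7 = 0 ↔ 2 ≤ pairSum s a 0))).mono fun τ hF h7 => ?_)
  · refine Runs.branch ⟨trivial, p1⟩ (hd' _ (by norm_num)) (fun hc => ?_) (fun hc => ?_)
    · rw [Exp.eval, Exp.eval, p2] at hc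
      refine Runs.assign 1 rfl trivial (by simp [Exp.deg]) (by simp; omega) ?_
      simp only [Mem.setVar_var, if_true]
      simp
      omega
    · rw [Exp.eval, Exp.eval, p2] at hc
      refine Runs.assign 0 rfl trivial (by simp [Exp.deg]) (by simp) ?_
      simp only [Mem.setVar_var, if_true]
      simp
      omega
  have t0 : τ.var 0 = (2 * N : ℕ) := by rw [hF.var 0 rfl]; simpa using h0
  have t5 : τ.var 5 = a := by rw [hF.var 5 rfl]; simpa using h5
  have t4 : τ.var 4 = 0 := by rw [hF.var 4 rfl]; simp
  have ta : τ.arr 0 = σ.arr 0 := hF.arr 0 rfl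
  refine (Runs.upTo (fun z τ => (τ.var 7 = 0 ∨ τ.var 7 = 1) ∧
    (τ.var 7 = 0 ↔ 2 ≤ pairSum s a 0 ∧ ∀ i < z, 0 ≤ pairSum s a i)) 0 N (by omega) (by omega)
    (by omega) (by simp [Exp.deg]) rfl (by simpa using t4) ?_ ?_ (by simpa using h7)).mono
    fun τ _ hτ => hτ.2
  · intro z ρ hF hz hz'
    have r0 : ρ.var 0 = (2 * N : ℕ) := by rw [hF.var 0 rfl, t0]
    refine ⟨by simp [Exp.Addr], ?_⟩
    simp only [Exp.eval, r0, hz']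
    omega
  · intro z ρ hF hz1 hz2 hz hI
    have r5 : ρ.var 5 = a := by rw [hF.var 5 rfl, t5]
    have ra : ρ.arr 0 = σ.arr 0 := by rw [hF.arr 0 rfl, ta]
    obtain ⟨p1, p2⟩ := eval_pairExp r5 hz (by rwa [ra]) ha hz2
    refine Runs.branch ⟨trivial, p1⟩ (hd' _ (by norm_num)) (fun hc => ?_)
      (fun hc => Runs.skip ?_)
    · rw [Exp.eval, Exp.eval, p2] at hc
      refine Runs.assign 1 rfl trivial (by simp [Exp.deg]) (by simp; omega) ?_
      simp only [Mem.setVar_var, Nat.reduceEqDiff, if_false, if_true]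
      refine ⟨Or.inr (by simp), fun h => absurd h one_ne_zero, fun h => ?_⟩
      have := h.2 z (by omega)
      omega
    · rw [Exp.eval, Exp.eval, p2] at hc
      simp only [Mem.setVar_var, Nat.reduceEqDiff, if_false]
      refine ⟨hI.1, hI.2.trans ⟨fun h => ⟨h.1, fun i hi => ?_⟩, fun h => ⟨h.1, fun i hi =>
        h.2 i (by omega)⟩⟩⟩
      rcases (show i ≤ z by omega).eq_or_lt with rfl | h1
      · omega
      · exact h.2 i h1

theorem runs_findProg (hM : 2 * N ≤ M) (hL : 2 * N ≤ L) (h0 : σ.var 0 = (2 * N : ℕ))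
    (hσ : ∀ q < 4 * N, σ.arr 0 q = s q) (hex : ∃ a < 2 * N, IsLeft N s a) :
    Runs B M L findProg σ (fun τ => ∃ a : ℕ, a < 2 * N ∧ τ.var 1 = a ∧ IsLeft N s a) := by
  unfold findProg
  refine Runs.seq (Runs.assign 0 rfl trivial (by simp [Exp.deg]) (by simp) ?_)
  refine (Runs.upTo (fun z τ => (∃ a < z, IsLeft N s a) →
    ∃ a : ℕ, a < 2 * N ∧ τ.var 1 = a ∧ IsLeft N s a) 0 (2 * N) (by omega) (by omega) (by omega)
    (by simp [Exp.deg]) rfl (by simp) ?_ ?_ (by simp)).mono fun τ _ hτ => hτ.2 hex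
  · intro z τ hF hz hz'
    have h0 : τ.var 0 = (2 * N : ℕ) := by rw [hF.var 0 rfl]; simpa using h0
    refine ⟨by simp [Exp.Addr], ?_⟩
    simp only [Exp.eval, h0, hz']
    omega
  · intro z τ hF hz1 hz2 hz hI
    have h0 : τ.var 0 = (2 * N : ℕ) := by rw [hF.var 0 rfl]; simpa using h0
    have ha : τ.arr 0 = σ.arr 0 := hF.arr 0 rfl
    refine Runs.seq ((runs_testProg hM hL h0 hz hz2 (by rwa [ha])).mono fun ρ hF h7 => ?_)
    have r1 : ρ.var 1 = τ.var 1 := hF.var 1 rfl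
    have r5 : ρ.var 5 = z := by rw [hF.var 5 rfl, hz]
    refine Runs.branch (by simp [Exp.Addr]) (by simp [Exp.deg]) (fun hc => ?_)
      (fun hc => Runs.skip ?_)
    · simp only [Exp.eval] at hc
      refine Runs.assign z (by simp [Exp.eval, r5]) trivial (by simp [Exp.deg])
        (by rw [abs_of_nonneg (by positivity)]; omega) fun _ => ?_
      exact ⟨z, hz2, by simp, h7.2.1 (by omega)⟩
    · simp only [Exp.eval] at hc
      rintro ⟨b, hb, hb'⟩
      simp only [Mem.setVar_var, Nat.reduceEqDiff, if_false, r1]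
      refine hI ⟨b, ?_, hb'⟩
      rcases (show b ≤ z by omega).eq_or_lt with rfl | h1
      · have := h7.2.2 hb'
        omega
      · exact h1

theorem runs_chainProg {k : ℕ} (hM : 2 * N ≤ M) (hL : 2 * N ≤ L) (h0 : σ.var 0 = (2 * N : ℕ))
    (h1 : σ.var 1 = a) (ha : a < 2 * N) (hσ : ∀ q < 4 * N, σ.arr 0 q = s q) (hk : k < N)
    (h : TurnPattern k (N - k) fun q => s (a + 1 + q)) :
    Runs B M L chainProg σ (fun τ => τ.var 2 = k ∧ τ.var 3 = (N - k : ℕ)) := by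
  have hk1 := h.le_k
  unfold chainProg
  refine Runs.seq (Runs.assign 1 rfl trivial (by simp [Exp.deg]) (by simp; omega) ?_)
  refine Runs.seq ((Runs.upTo (fun z τ => k < z → τ.var 2 = k) 1 N (by omega)
    (by omega) (by omega) (by simp [Exp.deg]) rfl (by simp) ?_ ?_ (by omega)).mono
    fun τ _ hτ => ?_)
  · intro z τ hF hz hz'
    have h0 : τ.var 0 = (2 * N : ℕ) := by rw [hF.var 0 rfl]; simpa using h0
    refine ⟨by simp [Exp.Addr], ?_⟩
    simp only [Exp.eval, h0, hz']
    omega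
  · intro z τ hF hz1 hz2 hz hI
    have h1 : τ.var 1 = a := by rw [hF.var 1 rfl]; simpa using h1
    have hτ : τ.arr 0 = σ.arr 0 := hF.arr 0 rfl
    obtain ⟨p1, p2⟩ := eval_pairExp h1 hz (by rwa [hτ]) ha hz2
    refine Runs.branch ⟨p1, trivial⟩ (by have := deg_pairExp 1; simp only [Exp.deg]; omega)
      (fun hc => ?_) (fun hc => Runs.skip ?_)
    · rw [Exp.eval, Exp.eval, p2] at hc
      refine Runs.assign z (by simp [Exp.eval, hz]) trivial (by simp [Exp.deg])
        (by rw [abs_of_nonneg (by positivity)]; omega) fun hkz => ?_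
      simp only [Mem.setVar_var, Nat.reduceEqDiff, if_false, if_true]
      by_contra hne
      rw [h.pairSum_eq_zero hz1 (by omega) (by omega)] at hc
      omega
    · rw [Exp.eval, Exp.eval, p2] at hc
      intro hkz
      simp only [Mem.setVar_var, Nat.reduceEqDiff, if_false]
      refine hI ((show k ≤ z by omega).lt_of_ne ?_)
      rintro rfl
      rw [h.pairSum_right] at hc
      omega
  · have h2 := hτ.2 hk
    refine Runs.assign ((N - k : ℕ) : ℤ) ?_ (by simp [Exp.Addr]) (by simp [Exp.deg])
      (by rw [abs_of_nonneg (by positivity)]; omega) ⟨by simpa using h2, by simp⟩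
    simp only [Exp.eval, hτ.1, h2]
    omega

/-- The left edge found need not be that of the witness polygon. Any admissible choice yields a turn
pattern, and by `IsPolygon.exists_layout` every polygon with these turns has a layout for that
pattern. -/
theorem runs_parseProg (hn : n = 2 * N) (hM : 2 * n ≤ M) (hL : n ≤ L) (h0 : σ.var 0 = n)
    (hs : ∀ q, s (q + n) = s q) (hpm : ∀ q, s q = 1 ∨ s q = -1)
    (hσ : ∀ q < n, σ.arr 0 q = s q)
    (hex : ∃ a k m, k + m = N ∧ TurnPattern k m fun q => s (a + 1 + q)) :
    Runs B M L parseProg σ (fun τ => ∃ a k m, ∃ t : ℕ → ℤ, (∀ q, t q = s (q + (a + 1))) ∧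
      ProgEnv n a k m (botSign t) (topSign (k + m) t) τ ∧ TurnPattern k m t) := by
  subst hn
  obtain ⟨a₀, k₀, m₀, rfl, ht₀⟩ := hex
  have hk₀ := ht₀.le_k
  have hsum := ht₀.sum_eq hs
  have hmod : ∀ i, pairSum s (a₀ % (2 * (k₀ + m₀))) i = pairSum s a₀ i := fun i => by
    have h1 : ∀ j, s (a₀ % (2 * (k₀ + m₀)) + j) = s (a₀ + j) :=
      fun j => periodic_mod (f := fun q => s (q + j)) (fun q => by rw [add_right_comm, hs]) a₀
    simp only [pairSum, add_assoc, h1]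
  have hleft := ht₀.isLeft hs
  generalize hN : k₀ + m₀ = N at *
  have hleft' : ∃ a < 2 * N, IsLeft N s a := by
    refine ⟨a₀ % (2 * N), Nat.mod_lt _ (by omega), ?_, fun i hi => ?_⟩
    · rw [hmod]; exact hleft.1
    · rw [hmod]; exact hleft.2 i hi
  unfold parseProg
  refine Runs.seq ((runs_extendProg (by omega) (by omega) hL hs h0 hσ).mono fun τ hF hτ => ?_)
  have t0 : τ.var 0 = (2 * N : ℕ) := by rw [hF.var 0 rfl, h0]
  replace hτ : ∀ q < 4 * N, τ.arr 0 q = s q := fun q hq => hτ q (by omega)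
  refine Runs.seq ((runs_findProg (by omega) hL t0 hτ hleft').mono fun ρ hF h1 => ?_)
  obtain ⟨a, ha, r1, hl⟩ := h1
  have r0 : ρ.var 0 = (2 * N : ℕ) := by rw [hF.var 0 rfl, t0]
  have ra : ∀ q < 4 * N, ρ.arr 0 q = s q := by rwa [hF.arr 0 rfl]
  obtain ⟨k, hk, ht⟩ := hl.exists_turnPattern (by omega) hs hpm hsum
  refine (runs_chainProg (by omega) hL r0 r1 ha ra hk ht).mono fun π hF hp => ?_
  have pa : ∀ q < 4 * N, π.arr 0 q = s q := by rwa [hF.arr 0 rfl]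
  have hk1 := ht.le_k
  refine ⟨a, k, N - k, fun q => s (a + 1 + q), fun q => by rw [add_comm q], ⟨by rw [hF.var 0 rfl, r0],
    by rw [hF.var 1 rfl, r1], hp.1, hp.2, by omega, hk1, ht.le_m, ha, fun i => hpm _,
    fun j => hpm _, fun i h1 h2 => ?_, fun j h1 h2 => ?_⟩, ht⟩
  · rw [pa _ (by omega), botSign]
    -- For `i = 1` the index `2 * 1 - 3` truncates to `0`, so `botSign` reads the turn after the
    -- left edge while the program reads the turn before it; both are left turns.
    rcases h1.eq_or_lt with rfl | h3
    · have e1 := hpm a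
      have e2 := hpm (a + 1)
      have e3 := hl.1
      simp only [pairSum, mul_zero, add_zero] at e3
      rw [show a + 2 * 1 - 2 = a by omega, show a + 1 + (2 * 1 - 3) = a + 1 by omega]
      omega
    · congr 1
      omega
  · rw [pa _ (by omega), topSign]
    congr 1
    omega

end

/-! ### Writing the output -/

/-- The entries of the arrays `1` and `2` at an address. -/
def Mem.point (σ : Mem) (p : ℕ) : ℤ × ℤ := (σ.arr 1 p, σ.arr 2 p)

/-- Write a vertex, given by entries of the arrays `b` and `c`, at the address `p`. -/
def pointProg (p : Exp) (b : ℕ) (x : Exp) (c : ℕ) (y : Exp) : Prog :=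
  .put 1 p (.get b x) ;; .put 2 p (.get c y)

/-- Write the vertices of the bottom chain. -/
def bottomProg : Prog :=
  4 ≔ .const 1 ;; .upTo 4 (.var 2 +ₑ .const 1 -ₑ .var 4)
    (pointProg (.var 1 +ₑ .const 2 *ₑ .var 4) 4 (.var 4) 5 (.var 4) ;;
      pointProg (.var 1 +ₑ .const 2 *ₑ .var 4 +ₑ .const 1) 4 (.var 4 +ₑ .const 1) 5 (.var 4))

/-- Write the vertices of the top chain. -/
def topProg : Prog :=
  4 ≔ .const 1 ;; .upTo 4 (.var 3 +ₑ .const 1 -ₑ .var 4)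
    (pointProg (.var 1 +ₑ .var 0 +ₑ .const 3 -ₑ .const 2 *ₑ .var 4) 6 (.var 4) 7 (.var 4) ;;
      pointProg (.var 1 +ₑ .var 0 +ₑ .const 2 -ₑ .const 2 *ₑ .var 4) 6 (.var 4 +ₑ .const 1) 7
        (.var 4))

/-- Copy the vertices at the addresses `n`, …, `n + var 1 + 1` to the first addresses. -/
def wrapProg : Prog :=
  4 ≔ .const 0 ;; .upTo 4 (.var 1 +ₑ .const 2 -ₑ .var 4)
    (pointProg (.var 1 +ₑ .const 1 -ₑ .var 4) 1 (.var 1 +ₑ .const 1 -ₑ .var 4 +ₑ .var 0) 2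
      (.var 1 +ₑ .const 1 -ₑ .var 4 +ₑ .var 0))

/-- Write the vertices of the polygon. -/
def outProg : Prog := bottomProg ;; topProg ;; wrapProg

section

variable {B M L n k m a : ℕ} {xb yb xt yt : ℕ → ℤ} {σ : Mem}

/-- The addresses are evaluated again after the first write, hence the hypotheses for all memories
with the same variables; `c ≠ 1` keeps the second source intact. -/
theorem runs_pointProg {p x y : Exp} {b c P X Y : ℕ}
    (hp : ∀ τ : Mem, τ.var = σ.var → p.Addr τ ∧ p.eval τ = P)
    (hx : ∀ τ : Mem, τ.var = σ.var → x.Addr τ ∧ x.eval τ = X)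
    (hy : ∀ τ : Mem, τ.var = σ.var → y.Addr τ ∧ y.eval τ = Y)
    (hpd : p.deg ≤ 16) (hxd : x.deg ≤ 16) (hyd : y.deg ≤ 16) (hc : c ≠ 1) {Q : Mem → Prop}
    (h : ∀ τ, Frame (pointProg p b x c y) σ τ →
      τ.point = Function.update σ.point P (σ.arr b X, σ.arr c Y) → Q τ) :
    Runs B M L (pointProg p b x c y) σ Q := by
  refine Runs.mono (Q := fun τ => τ.point = Function.update σ.point P (σ.arr b X, σ.arr c Y)) ?_
    fun τ hF hτ => h τ hF hτ
  refine Runs.of_bounded fun hb => Runs.seq (Runs.put P (σ.arr b X) (hp σ rfl).2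
    (Exp.eval_get _ (hx σ rfl).2) (hp σ rfl).1 hpd
    ⟨(hx σ rfl).1, by rw [(hx σ rfl).2]; positivity⟩ hxd (hb.arr _ _) ?_)
  have hy' := hy (σ.setArr 1 P (σ.arr b X)) rfl
  have hp' := hp (σ.setArr 1 P (σ.arr b X)) rfl
  refine Runs.put P (σ.arr c Y) hp'.2 ?_ hp'.1 hpd
    ⟨hy'.1, by rw [hy'.2]; positivity⟩ hyd (hb.arr _ _) ?_
  · rw [Exp.eval_get _ hy'.2, Mem.setArr_arr, if_neg hc]
  · funext q
    simp only [Mem.point, Mem.setArr_arr, Nat.reduceEqDiff, if_false, if_true,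
      Function.update_apply]
    split_ifs <;> rfl

theorem runs_bottomProg (h1 : σ.var 1 = a) (h2 : σ.var 2 = k) (hL : k ≤ L) (hM : k + 1 ≤ M) :
    Runs B M L bottomProg σ (fun τ => ∀ q, 1 ≤ q → q ≤ 2 * k →
      τ.point (a + 1 + q) = vert (σ.arr 4) (σ.arr 5) q) := by
  unfold bottomProg
  refine Runs.seq (Runs.assign 1 rfl trivial (by simp [Exp.deg]) (by simp; omega) ?_)
  refine (Runs.upTo (fun z τ => ∀ q, 1 ≤ q → q + 1 < 2 * z →
    τ.point (a + 1 + q) = vert (σ.arr 4) (σ.arr 5) q) 1 (k + 1) (by omega) (by omega) (by omega)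
    (by simp [Exp.deg]) rfl (by simp) ?_ ?_ (fun q _ _ => by omega)).mono
    fun τ _ hτ q hq1 hq2 => hτ.2 q hq1 (by omega)
  · intro z τ hF hz hz'
    have h2 : τ.var 2 = k := by rw [hF.var 2 rfl]; simpa using h2
    refine ⟨by simp [Exp.Addr], ?_⟩
    simp only [Exp.eval, h2, hz']
    omega
  · intro z τ hF hz1 hz2 hz hI
    have v1 : τ.var 1 = a := by rw [hF.var 1 rfl]; simpa using h1
    have a4 : τ.arr 4 = σ.arr 4 := hF.arr 4 rfl
    have a5 : τ.arr 5 = σ.arr 5 := hF.arr 5 rfl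
    refine Runs.seq (runs_pointProg (P := a + 2 * z) (X := z) (Y := z)
      (fun ρ h => ⟨by simp [Exp.Addr], by simp [Exp.eval, h, v1, hz]⟩)
      (fun ρ h => ⟨by simp [Exp.Addr], by simp [Exp.eval, h, hz]⟩)
      (fun ρ h => ⟨by simp [Exp.Addr], by simp [Exp.eval, h, hz]⟩)
      (by simp [Exp.deg]) (by simp [Exp.deg]) (by simp [Exp.deg]) (by decide) fun ρ hF hρ => ?_)
    have r1 : ρ.var 1 = a := by rw [hF.var 1 rfl, v1]
    have r4 : ρ.var 4 = z := by rw [hF.var 4 rfl, hz]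
    have s4 : ρ.arr 4 = σ.arr 4 := by rw [hF.arr 4 rfl, a4]
    have s5 : ρ.arr 5 = σ.arr 5 := by rw [hF.arr 5 rfl, a5]
    refine runs_pointProg (P := a + 2 * z + 1) (X := z + 1) (Y := z)
      (fun ρ h => ⟨by simp [Exp.Addr], by simp [Exp.eval, h, r1, r4]⟩)
      (fun ρ h => ⟨by simp [Exp.Addr], by simp [Exp.eval, h, r4]⟩)
      (fun ρ h => ⟨by simp [Exp.Addr], by simp [Exp.eval, h, r4]⟩)
      (by simp [Exp.deg]) (by simp [Exp.deg]) (by simp [Exp.deg]) (by decide)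
      fun π _ hπ q hq1 hq2 => ?_
    change π.point _ = _
    rw [hπ, hρ, s4, s5, a4, a5, Function.update_apply, Function.update_apply]
    split_ifs with c1 c2
    · obtain rfl : q = 2 * z := by omega
      rw [vert_even]
    · obtain ⟨y, rfl⟩ : ∃ y, z = y + 1 := ⟨z - 1, by omega⟩
      obtain rfl : q = 2 * y + 1 := by omega
      rw [vert_odd]
    · exact hI q hq1 (by omega)

theorem runs_topProg (h0 : σ.var 0 = n) (h1 : σ.var 1 = a) (h3 : σ.var 3 = m)
    (hn : n = 2 * (k + m)) (hL : m ≤ L) (hM : m + 1 ≤ M) (hσ : ∀ q, 1 ≤ q → q ≤ 2 * k →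
      σ.point (a + 1 + q) = vert xb yb q) :
    Runs B M L topProg σ (fun τ => (∀ q, 1 ≤ q → q ≤ 2 * k →
      τ.point (a + 1 + q) = vert xb yb q) ∧ ∀ q, 1 ≤ q → q ≤ 2 * m →
        τ.point (a + n + 2 - q) = vert (σ.arr 6) (σ.arr 7) q) := by
  unfold topProg
  refine Runs.seq (Runs.assign 1 rfl trivial (by simp [Exp.deg]) (by simp; omega) ?_)
  refine (Runs.upTo (fun z τ => (∀ q, 1 ≤ q → q ≤ 2 * k →
    τ.point (a + 1 + q) = vert xb yb q) ∧ ∀ q, 1 ≤ q → q + 1 < 2 * z →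
    τ.point (a + n + 2 - q) = vert (σ.arr 6) (σ.arr 7) q) 1 (m + 1) (by omega) (by omega) (by omega)
    (by simp [Exp.deg]) rfl (by simp) ?_ ?_ ?_).mono
    fun τ _ hτ => ⟨hτ.2.1, fun q hq1 hq2 => hτ.2.2 q hq1 (by omega)⟩
  · intro z τ hF hz hz'
    have h3 : τ.var 3 = m := by rw [hF.var 3 rfl]; simpa using h3
    refine ⟨by simp [Exp.Addr], ?_⟩
    simp only [Exp.eval, h3, hz']
    omega
  · intro z τ hF hz1 hz2 hz hI
    have v0 : τ.var 0 = n := by rw [hF.var 0 rfl]; simpa using h0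
    have v1 : τ.var 1 = a := by rw [hF.var 1 rfl]; simpa using h1
    have a6 : τ.arr 6 = σ.arr 6 := hF.arr 6 rfl
    have a7 : τ.arr 7 = σ.arr 7 := hF.arr 7 rfl
    refine Runs.seq (runs_pointProg (P := a + n + 3 - 2 * z) (X := z) (Y := z)
      (fun ρ h => ⟨by simp [Exp.Addr], by simp only [Exp.eval, h, v0, v1, hz]; omega⟩)
      (fun ρ h => ⟨by simp [Exp.Addr], by simp [Exp.eval, h, hz]⟩)
      (fun ρ h => ⟨by simp [Exp.Addr], by simp [Exp.eval, h, hz]⟩)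
      (by simp [Exp.deg]) (by simp [Exp.deg]) (by simp [Exp.deg]) (by decide) fun ρ hF hρ => ?_)
    have r0 : ρ.var 0 = n := by rw [hF.var 0 rfl, v0]
    have r1 : ρ.var 1 = a := by rw [hF.var 1 rfl, v1]
    have r4 : ρ.var 4 = z := by rw [hF.var 4 rfl, hz]
    have s6 : ρ.arr 6 = σ.arr 6 := by rw [hF.arr 6 rfl, a6]
    have s7 : ρ.arr 7 = σ.arr 7 := by rw [hF.arr 7 rfl, a7]
    refine runs_pointProg (P := a + n + 2 - 2 * z) (X := z + 1) (Y := z)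
      (fun ρ h => ⟨by simp [Exp.Addr], by simp only [Exp.eval, h, r0, r1, r4]; omega⟩)
      (fun ρ h => ⟨by simp [Exp.Addr], by simp [Exp.eval, h, r4]⟩)
      (fun ρ h => ⟨by simp [Exp.Addr], by simp [Exp.eval, h, r4]⟩)
      (by simp [Exp.deg]) (by simp [Exp.deg]) (by simp [Exp.deg]) (by decide)
      fun π _ hπ => ?_
    have hpt : ∀ w, (π.setVar 4 w).point = π.point := fun _ => rfl
    simp only [hpt, hπ, hρ, s6, s7, a6, a7, Function.update_apply]
    refine ⟨fun q hq1 hq2 => ?_, fun q hq1 hq2 => ?_⟩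
    · rw [if_neg (by omega), if_neg (by omega), hI.1 q hq1 hq2]
    · split_ifs with c1 c2
      · obtain rfl : q = 2 * z := by omega
        rw [vert_even]
      · obtain ⟨y, rfl⟩ : ∃ y, z = y + 1 := ⟨z - 1, by omega⟩
        obtain rfl : q = 2 * y + 1 := by omega
        rw [vert_odd]
      · exact hI.2 q hq1 (by omega)
  · exact ⟨hσ, fun q _ _ => by omega⟩

/-- Copying by descending address ensures that each source holds its final value, even when it was
itself copied in an earlier repetition. -/
theorem runs_wrapProg (h0 : σ.var 0 = n) (h1 : σ.var 1 = a) (ha : a < n) (hL : n + 1 ≤ L)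
    (hM : n + 1 ≤ M) {w : ℕ → ℤ × ℤ} (hw : ∀ p, w (p + n) = w p)
    (hσ : ∀ p, a + 1 < p → p ≤ a + 1 + n → σ.point p = w p) :
    Runs B M L wrapProg σ (fun τ => outputWalk n τ = w) := by
  unfold wrapProg
  refine Runs.seq (Runs.assign 0 rfl trivial (by simp [Exp.deg]) (by simp) ?_)
  refine (Runs.upTo (fun z τ => ∀ p, a + 1 < p + z → p ≤ a + 1 + n → τ.point p = w p) 0 (a + 2)
    (by omega) (by omega) (by omega) (by simp [Exp.deg]) rfl (by simp) ?_ ?_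
    ?_).mono fun τ _ hτ => ?_
  · intro z τ hF hz hz'
    have h1 : τ.var 1 = a := by rw [hF.var 1 rfl]; simpa using h1
    refine ⟨by simp [Exp.Addr], ?_⟩
    simp only [Exp.eval, h1, hz']
    omega
  · intro z τ hF hz1 hz2 hz hI
    have v0 : τ.var 0 = n := by rw [hF.var 0 rfl]; simpa using h0
    have v1 : τ.var 1 = a := by rw [hF.var 1 rfl]; simpa using h1
    have he : ∀ ρ : Mem, ρ.var = τ.var →
        (Exp.var 1 +ₑ .const 1 -ₑ .var 4 +ₑ .var 0).Addr ρ ∧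
          (Exp.var 1 +ₑ .const 1 -ₑ .var 4 +ₑ .var 0).eval ρ = (a + 1 - z + n : ℕ) := fun ρ h =>
      ⟨by simp [Exp.Addr], by simp only [Exp.eval, h, v0, v1, hz]; omega⟩
    refine runs_pointProg (P := a + 1 - z) (X := a + 1 - z + n) (Y := a + 1 - z + n)
      (fun ρ h => ⟨by simp [Exp.Addr], by simp only [Exp.eval, h, v1, hz]; omega⟩) he he
      (by simp [Exp.deg]) (by simp [Exp.deg]) (by simp [Exp.deg]) (by decide)
      fun π _ hπ p hp1 hp2 => ?_
    change π.point _ = _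
    rw [hπ, Function.update_apply]
    split_ifs with c
    · rw [c, ← hw]
      exact hI _ (by omega) (by omega)
    · exact hI p (by omega) hp2
  · exact fun p => hσ p
  · funext p
    have hp := Nat.mod_lt p (by omega : 0 < n)
    rw [← periodic_mod hw]
    exact hτ.2 (p % n) (by omega) (by omega)

theorem runs_outProg (h0 : σ.var 0 = n) (h1 : σ.var 1 = a) (h2 : σ.var 2 = k) (h3 : σ.var 3 = m)
    (hn : n = 2 * (k + m)) (ha : a < n) (hL : n + 1 ≤ L) (hM : n + 1 ≤ M) :
    Runs B M L outProg σ (fun τ => Traces k m (σ.arr 4) (σ.arr 5) (σ.arr 6) (σ.arr 7)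
      (shiftWalk (a + 1) (outputWalk n τ))) := by
  unfold outProg
  refine Runs.seq ((runs_bottomProg h1 h2 (by omega) (by omega)).mono fun τ hF hτ => ?_)
  have t0 : τ.var 0 = n := by rw [hF.var 0 rfl, h0]
  have t1 : τ.var 1 = a := by rw [hF.var 1 rfl, h1]
  have t3 : τ.var 3 = m := by rw [hF.var 3 rfl, h3]
  have t6 : τ.arr 6 = σ.arr 6 := hF.arr 6 rfl
  have t7 : τ.arr 7 = σ.arr 7 := hF.arr 7 rfl
  refine Runs.seq ((runs_topProg t0 t1 t3 hn (by omega) (by omega) hτ).mono fun ρ hF hρ => ?_)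
  have r0 : ρ.var 0 = n := by rw [hF.var 0 rfl, t0]
  have r1 : ρ.var 1 = a := by rw [hF.var 1 rfl, t1]
  rw [t6, t7] at hρ
  obtain ⟨w, hw, hwρ⟩ : ∃ w : ℕ → ℤ × ℤ, (∀ p, w (p + n) = w p) ∧
      ∀ p, a + 1 < p → p ≤ a + 1 + n → ρ.point p = w p := by
    -- The periodic extension of the `n` written vertices; adding `(n - 1) * (a + 2)` amounts to
    -- subtracting `a + 2` modulo `n`.
    refine ⟨fun p => ρ.point (a + 2 + (p + (n - 1) * (a + 2)) % n), fun p => ?_, fun p h4 h5 => ?_⟩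
    · simp only [add_right_comm p n, Nat.add_mod_right]
    · obtain ⟨r, rfl⟩ : ∃ r, p = a + 2 + r := ⟨p - (a + 2), by omega⟩
      have h6 : a + 2 + r + (n - 1) * (a + 2) = r + n * (a + 2) := by
        obtain ⟨n', rfl⟩ : ∃ n', n = n' + 1 := ⟨n - 1, by omega⟩
        rw [Nat.add_sub_cancel]
        ring
      simp only [h6, Nat.add_mul_mod_self_left]
      rw [Nat.mod_eq_of_lt (by omega)]
  refine (runs_wrapProg r0 r1 ha hL hM hw hwρ).mono fun π _ hπ => ?_
  rw [hπ]
  subst hn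
  refine ⟨shiftWalk_periodic hw _, fun q hq1 hq2 => ?_, fun q hq1 hq2 => ?_⟩
  · rw [shiftWalk, ← hwρ _ (by omega) (by omega), add_comm, hρ.1 q hq1 hq2]
  · rw [shiftWalk, ← hwρ _ (by omega) (by omega), ← hρ.2 q hq1 hq2]
    congr 1
    omega

end

/-! ### The algorithm -/

/-- The program for minimum-area polygons. -/
def mainProg : Prog := parseProg ;; tableProg ;; backProg ;; outProg

theorem turnSign_shiftWalk (c : ℕ) (v : ℕ → ℤ × ℤ) (q : ℕ) :
    turnSign (shiftWalk c v) q = turnSign v (q + c) := by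
  rw [turnSign, cross_shiftWalk, turnSign]

theorem turnSign_periodic {n : ℕ} {v : ℕ → ℤ × ℤ} (hv : ∀ i, v (i + n) = v i) (q : ℕ) :
    turnSign v (q + n) = turnSign v q := by
  simp only [turnSign, add_right_comm q n, hv]

theorem IsPolygon.turnSign_eq {n : ℕ} {v : ℕ → ℤ × ℤ} (hv : IsPolygon n v) (q : ℕ) :
    turnSign v q = 1 ∨ turnSign v q = -1 := by
  rcases lt_or_gt_of_ne (hv.perpendicular q) with h | h
  · exact Or.inr (Int.sign_eq_neg_one_of_neg h)
  · exact Or.inl (Int.sign_eq_one_of_pos h)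

/-- The turns of a polygon with a given layout. -/
theorem Layout.turnSign_eq {k m : ℕ} {t : ℕ → ℤ} {xb yb xt yt : ℕ → ℤ} {u : ℕ → ℤ × ℤ}
    (h : Layout k m (botSign t) (topSign (k + m) t) 1 1 xb yb xt yt)
    (hu : Traces k m xb yb xt yt u) (ht : TurnPattern k m t) {q : ℕ} (hq : q < 2 * (k + m)) :
    turnSign u q = t q := by
  have hk := h.le_k
  have hm := h.le_m
  have hl := h.turn_left hu
  have hr := h.turn_right hu
  have key : ∀ i, 1 ≤ i → i < k + m → turnSign u (2 * i - 1) = t (2 * i - 1) ∧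
      turnSign u (2 * i) = t (2 * i) := by
    intro i h1 h2
    rcases lt_trichotomy i k with h3 | rfl | h3
    · obtain ⟨e1, e2⟩ := h.turn_bottom hu h1 h3
      have e3 : botSign t (i + 1) = t (2 * i - 1) := by
        rw [botSign]
        congr 1
      rw [e1, e2, ht.vert i h1 h2 h3.ne, e3]
      exact ⟨rfl, rfl⟩
    · rw [ht.right_fst, ht.right_snd]
      exact hr
    · obtain ⟨e1, e2⟩ := h.turn_top hu (a := k + m - i) (by omega) (by omega)
      have e3 : topSign (k + m) t (k + m - i + 1) = t (2 * i - 1) := by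
        rw [topSign]
        congr 1
        omega
      rw [show 2 * (k + m) - 2 * (k + m - i) = 2 * i by omega] at e1 e2
      rw [e1, e2, ht.vert i h1 h2 h3.ne', e3]
      exact ⟨rfl, rfl⟩
  rcases Nat.eq_zero_or_pos q with rfl | h0
  · rw [ht.first, hl.1]
  by_cases h1 : q = 2 * (k + m) - 1
  · rw [h1, ht.last, hl.2]
  rcases Nat.even_or_odd' q with ⟨i, rfl | rfl⟩
  · exact (key i (by omega) (by omega)).2
  · exact (key (i + 1) (by omega) (by omega)).1

/-- `4 * n * n` bounds table entries, coordinates and addresses held in variables; `2 * n`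
repetitions cover every loop, including the at most `n + 1` copies of `wrapProg`. -/
theorem runs_mainProg {n : ℕ} {S : Fin n → Turn} (hS : IsXMonotoneSeq S) {B : ℕ} :
    Runs B (4 * n * n) (2 * n) mainProg (inputMem S)
      (fun τ => IsMinAreaRealization S (outputWalk n τ)) := by
  obtain ⟨v, hv, hvm, hvS⟩ := hS
  obtain ⟨c, k₀, m₀, hn, ht₀⟩ := hvm.exists_turnPattern hv
  have hk₀ := ht₀.le_k
  have hm₀ := ht₀.le_m
  set s := turnSign v with hs
  have hsp : ∀ q, s (q + n) = s q := turnSign_periodic hv.periodic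
  have hreal : ∀ w : ℕ → ℤ × ℤ, IsPolygon n w → Realizes w S → turnSign w = s := by
    intro w hw hwS
    funext q
    rw [← periodic_mod (turnSign_periodic hw.periodic) q, ← periodic_mod hsp q]
    have hq := Nat.mod_lt q (by omega : 0 < n)
    exact (hwS ⟨q % n, hq⟩).trans (hvS ⟨q % n, hq⟩).symm
  have hMn : 4 * n ≤ 4 * n * n := Nat.le_mul_of_pos_right _ (by omega)
  unfold mainProg
  refine Runs.seq ((runs_parseProg (s := s) hn (by omega) (by omega) (by
    simp [inputMem]) hsp (fun q => hv.turnSign_eq q) (fun q hq => ?_) ?_).mono fun τ hF hτ => ?_)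
  · simp only [inputMem, hq, and_true, dif_pos]
    exact (hvS ⟨q, hq⟩).symm
  -- Adding `n - 1` subtracts one modulo the period, since the pattern starts at position `a + 1`.
  · refine ⟨c + (n - 1), k₀, m₀, rfl, ?_⟩
    convert ht₀ using 2 with q
    rw [turnSign_shiftWalk, ← hs, ← hsp (q + c)]
    congr 1
    omega
  obtain ⟨a, k, m, t, hts, e, ht⟩ := hτ
  have hN := e.n_eq
  have ha := e.a_lt
  have hk := e.one_le_k
  have hm := e.one_le_m
  have t3 : ∀ x, τ.arr 3 x = 0 := fun x => by rw [hF.arr 3 rfl]; simp [inputMem]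
  clear hF
  refine Runs.seq ((runs_tableProg e le_rfl (by omega) t3).mono fun ρ hF hG => ?_)
  have e := hF.progEnv e rfl
  -- The lower bound for all competitors `w`; applied to `v` it also shows that the table has a
  -- positive entry from which to reconstruct.
  have hlay : ∀ w : ℕ → ℤ × ℤ, IsPolygon n w → Realizes w S → ∃ H : ℕ, 1 ≤ H ∧ H ≤ n ∧
      0 < tableOf n (ρ.arr 3) k m H ∧ (n : ℤ) * n - tableOf n (ρ.arr 3) k m H ≤ area n w := by
    intro w hw hwS
    have htw : turnSign (shiftWalk (a + 1) w) = t := by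
      funext q
      rw [turnSign_shiftWalk, hreal w hw hwS, hts]
    have hw' := hw.shiftWalk (a + 1)
    rw [hN] at hw'
    obtain ⟨xb, yb, xt, yt, hl, har⟩ := hw'.exists_layout (by rwa [htw])
    rw [← hN, area_shiftWalk hw.periodic] at har
    rw [← har]
    rw [htw] at hl
    exact hG.area_le hN e.f_pm e.g_pm hl
  obtain ⟨H, hH1, hH2, hH3, -⟩ := hlay v hv hvS
  refine Runs.seq ((runs_backProg e le_rfl (by omega) hG ⟨H, hH1, hH2, hH3⟩).mono
    fun π hF hπ => ?_)
  obtain ⟨b, hdone, hb⟩ := hπ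
  have e := hF.progEnv e rfl
  refine (runs_outProg e.v0 e.v1 e.v2 e.v3 hN ha (by omega) (by omega)).mono
    fun ω _ hω => ?_
  set W := outputWalk n ω with hW
  have hWp : ∀ i, W (i + n) = W i := fun i => by simp [hW, outputWalk]
  have hpm : ∀ i, t i ≠ 0 := fun i => by
    rcases ht.pm i with h | h <;> rw [h] <;> norm_num
  have hu := hdone.layout.isPolygon hω (fun i _ _ => hpm _) (fun i _ _ => hpm _)
  have harea := hdone.layout.area_eq hω
  have hturn := fun q hq => hdone.layout.turnSign_eq hω ht (q := q) hq
  rw [← hN] at hu harea hturn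
  -- The layout describes the walk started at the left edge; shifting by the rest of the period
  -- returns to the output walk.
  have hback : shiftWalk (n - (a + 1)) (shiftWalk (a + 1) W) = W := by
    funext q
    rw [shiftWalk, shiftWalk, ← hWp q]
    congr 1
    omega
  have hWpoly : IsPolygon n W := by
    rw [← hback]
    exact hu.shiftWalk _
  have hturn' : ∀ q, turnSign (shiftWalk (a + 1) W) q = t q := fun q => by
    rw [← periodic_mod (turnSign_periodic hu.periodic) q, hturn _ (Nat.mod_lt _ (by omega))]
    refine periodic_mod (fun i => ?_) q
    rw [hts, hts, add_right_comm, hsp]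
  refine ⟨hWpoly, fun i => ?_, fun w hw hwS => ?_⟩
  · refine Eq.trans ?_ (hvS i)
    change turnSign W i = s i
    rw [← turnSign_periodic hWp i, ← hsp i]
    have h1 : (i : ℕ) + n = i + (n - (a + 1)) + (a + 1) := by omega
    rw [h1, ← turnSign_shiftWalk, hturn', hts]
  · obtain ⟨H, h1, h2, -, h3⟩ := hlay w hw hwS
    have h4 := hb H h1 h2
    have h5 := hdone.area_eq
    rw [area_shiftWalk hWp] at harea
    zify
    linarith

end RectPoly

/-- There is a word-RAM program that computes, for every `x`-monotone angle sequence `S` of length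
`n`, a minimum-area polygon realizing `S` in `O(n ^ 4)` time, on words of `O(log n)` bits (numbers
bounded by a polynomial in `n`). -/
theorem mainTheorem6 :
    ∃ (p : RectPoly.Prog) (C k : ℕ), ∀ (n : ℕ) (S : Fin n → RectPoly.Turn),
      RectPoly.IsXMonotoneSeq S →
        ∃ (t : ℕ) (σ : RectPoly.Mem),
          RectPoly.Exec (C * n ^ k) p (RectPoly.inputMem S) t σ ∧
          t ≤ C * n ^ 4 ∧
          RectPoly.IsMinAreaRealization S (RectPoly.outputWalk n σ) := by
  -- `4 ^ 16` and the exponent `32` come from the word bound `(4 * n * n) ^ 16`; `81 = 3 ^ 4` comes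
  -- from `2 * n + 1 ≤ 3 * n`.
  refine ⟨RectPoly.mainProg, 4 ^ 16 + 81 * RectPoly.mainProg.time 1, 32, fun n S hS => ?_⟩
  have hn : 1 ≤ n := by
    obtain ⟨v, hv, -, -⟩ := hS
    rcases Nat.eq_zero_or_pos n with rfl | h
    · exact absurd hv.ccw (by simp [RectPoly.signedArea₂])
    · exact h
  have hM : n ≤ 4 * n * n := by nlinarith
  have hM2 : 2 ≤ 4 * n * n := by nlinarith
  have hB : (4 * n * n) ^ 16 ≤ (4 ^ 16 + 81 * RectPoly.mainProg.time 1) * n ^ 32 :=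
    calc (4 * n * n) ^ 16 = 4 ^ 16 * n ^ 32 := by ring
      _ ≤ _ := Nat.mul_le_mul_right _ (Nat.le_add_right _ _)
  have hbd : (RectPoly.inputMem S).Bounded (4 * n * n) := by
    have hM' : (n : ℤ) ≤ (4 * n * n : ℕ) := by exact_mod_cast hM
    have hM2' : (2 : ℤ) ≤ (4 * n * n : ℕ) := by exact_mod_cast hM2
    refine ⟨fun x => ?_, fun a i => ?_⟩
    · simp only [RectPoly.inputMem]
      split_ifs
      · rwa [abs_of_nonneg (by positivity)]
      · rw [abs_zero]; positivity
    · simp only [RectPoly.inputMem]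
      split_ifs with h
      · cases S ⟨i, h.2⟩ <;> simp only [RectPoly.Turn.sign, abs_neg, abs_one] <;> linarith
      · rw [abs_zero]; positivity
  obtain ⟨t, σ, h1, h2, -, h3⟩ := RectPoly.runs_mainProg hS hM2 hB hbd
  refine ⟨t, σ, h1, ?_, h3⟩
  -- The exponent `4` is the nesting depth, which unfolds by computation: three loops over the
  -- states and one over the predecessor heights.
  have h4 : RectPoly.mainProg.time (2 * n) ≤ RectPoly.mainProg.time 1 * (2 * n + 1) ^ 4 :=
    RectPoly.mainProg.time_le (2 * n)
  have h5 : (2 * n + 1) ^ 4 ≤ (3 * n) ^ 4 := Nat.pow_le_pow_left (by omega) 4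
  calc t ≤ RectPoly.mainProg.time 1 * (2 * n + 1) ^ 4 := h2.trans h4
    _ ≤ RectPoly.mainProg.time 1 * (3 * n) ^ 4 := Nat.mul_le_mul_left _ h5
    _ = 81 * RectPoly.mainProg.time 1 * n ^ 4 := by ring
    _ ≤ _ := Nat.mul_le_mul_right _ (Nat.le_add_left _ _)
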